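/- Let $n\ge 3$ be odd and let $p,q\in\mathbb{Z}/n\mathbb{Z}$ be such that $p^2+q^2$ is invertible in $\mathbb{Z}/n\mathbb{Z}$. Let $E=\mathbb{R}^2/\mathbb{Z}^2$ with origin $O$, let $\bar c(x,y)=(-y,x)$ be the rotation of $E$ by $\pi/2$, and let $P=(p/n,q/n)\in E$ be the $n$-torsion point given by $(p,q)$. Let $\kappa:X\to E$ be a covering of degree $2$ by a closed connected surface $X$ that is ramified exactly over the four points $P,\bar c(P),\bar c^2(P),\bar c^3(P)$ and such that $\bar c$ lifts to an automorphism $c$ of $X$ with exactly four fixed points. (There are four double coverings of $E$ with this ramification; the condition on $c$ holds for exactly one of them.) Let $[n]:E\to E$ be the multiplication by $n$. The covering $[n]\circ\kappa:X\to E$ is ramified only over $O$; it is the origami $D_P$. Its Veech group $\Gamma(D_P)\subset \mathrm{GL}_2(\mathbb{R})$ is the group of derivatives of all orientation preserving diffeomorphisms of $X^*=X\setminus([n]\circ\kappa)^{-1}(O)$ that are affine with respect to the translation structure lifted from $E$ via $[n]\circ\kappa$. Put $I=\begin{pmatrix}1&0\\0&1\end{pmatrix}$ and $S=\begin{pmatrix}0&-1\\1&0\end{pmatrix}$.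 Then $\Gamma(D_P)$ is a subgroup of $\mathrm{SL}_2(\mathbb{Z})$, and $$\Gamma(D_P)=\{A\in \mathrm{SL}_2(\mathbb{Z}) : A\equiv \pm I \text{ or } A\equiv\pm S \bmod n\}\cap\{A\in \mathrm{SL}_2(\mathbb{Z}) : A\equiv I \text{ or } A\equiv S \bmod 2\}$$ $$=\left\{A=\begin{pmatrix}a&b\\c&d\end{pmatrix}\in \mathrm{SL}_2(\mathbb{Z}) : a+c \text{ and } b+d \text{ are odd, and } A\equiv\pm I \text{ or } A\equiv\pm S \bmod n\right\}.$$ Moreover $\Gamma(D_P)$ is a congruence group of level $2n$: it contains the principal congruence group $\Gamma(2n)$, and $2n$ is the smallest positive integer $m$ with $\Gamma(m)\subseteq\Gamma(D_P)$. -/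

import Mathlib

open scoped Topology Matrix

/-- The torus `E = ℝ² / ℤ²`, where `ℂ` is identified with `ℝ²` through the basis `1, i`.
The distinguished point `∞`, which is also the origin `O` of the group, is `0`. -/
abbrev Torus : Type := Fin 2 → UnitAddCircle

/-- The universal covering `ℝ² → E`. -/
def toTorus (v : Fin 2 → ℝ) : Torus := fun i => (v i : UnitAddCircle)

/-- The rotation `(x, y) ↦ (-y, x)` of the torus by the angle `π / 2` around the origin. -/
def torusRotation (t : Torus) : Torus := ![-t 1, t 0]

/-- The `n`-torsion point `(p, q)`, that is the class of `(p / n, q / n)` in `ℝ² / ℤ²`. -/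
noncomputable def torsionPoint {n : ℕ} [NeZero n] (p q : ZMod n) : Torus :=
  ![ZMod.toAddCircle p, ZMod.toAddCircle q]

/-- The orbit `{P₀, P₁, P₂, P₃}` of a point `P` under the rotation by `π / 2`. -/
def rotationOrbit (P : Torus) : Set Torus :=
  {P, torusRotation P, torusRotation (torusRotation P),
    torusRotation (torusRotation (torusRotation P))}

section Veech

variable {X : Type*} [TopologicalSpace X]

/-- For `p : X → E` the punctured surface `X* = X - p⁻¹(∞)`. -/
abbrev PuncturedSurface (p : X → Torus) : Type _ := {x : X // p x ≠ 0}

/-- The charts of the translation structure on `X*` lifted from `E = ℝ² / ℤ²` via `p`: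
they are the local homeomorphisms to the plane that lift `p` through `ℝ² → ℝ² / ℤ²`. -/
def IsTranslationChart (p : X → Torus)
    (φ : OpenPartialHomeomorph (PuncturedSurface p) (Fin 2 → ℝ)) : Prop :=
  ∀ x ∈ φ.source, toTorus (φ x) = p x

/-- The map `f : X* → X*` is locally of the form `z ↦ A z + c` in the charts of the translation
structure, with the same matrix `A` everywhere. -/
def IsAffineWithDerivative (p : X → Torus) (f : PuncturedSurface p → PuncturedSurface p)
    (A : Matrix (Fin 2) (Fin 2) ℝ) : Prop :=
  ∀ φ ψ : OpenPartialHomeomorph (PuncturedSurface p) (Fin 2 → ℝ),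
    IsTranslationChart p φ → IsTranslationChart p ψ →
    ∀ x ∈ φ.source, f x ∈ ψ.source →
      ∃ c : Fin 2 → ℝ, ∀ᶠ y in 𝓝 x, ψ (f y) = A *ᵥ φ y + c

/-- The Veech group of the origami `p : X → E`: the set of the derivatives in `GL₂(ℝ)` of all
orientation preserving affine diffeomorphisms of `X*`. (A homeomorphism that is locally affine
with invertible linear part is a diffeomorphism, and it preserves the orientation if and only if
the determinant of its linear part is positive.) -/
def veechGroup (p : X → Torus) : Set (GL (Fin 2) ℝ) :=
  {A | 0 < (A : Matrix (Fin 2) (Fin 2) ℝ).det ∧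
    ∃ f : PuncturedSurface p ≃ₜ PuncturedSurface p,
      IsAffineWithDerivative p f (A : Matrix (Fin 2) (Fin 2) ℝ)}

/-- `κ : X → E` is a covering of degree two that is ramified exactly over the points of `S`.
Here `X` is meant to be a closed surface, so that a point of `S` is a branch point of `κ` if and
only if it has a single preimage. -/
structure IsDoubleCoverRamifiedOver (κ : X → Torus) (S : Set Torus) : Prop where
  continuous : Continuous κ
  isCoveringMapOn : IsCoveringMapOn κ Sᶜ
  ncard_fiber_of_notMem : ∀ t, t ∉ S → (κ ⁻¹' {t}).ncard = 2
  ncard_fiber_of_mem : ∀ t, t ∈ S → (κ ⁻¹' {t}).ncard = 1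

/-- `κ : X → E` is the double covering belonging to the origami `D_P`: it is ramified exactly
over the four points of the rotation orbit of `P`, and, among the four coverings with this
property, it is the one for which the rotation of `E` by `π / 2` lifts to an automorphism `c`
of `X` with exactly four fixed points. -/
structure IsDPDoubleCover (P : Torus) (κ : X → Torus) : Prop where
  isDoubleCover : IsDoubleCoverRamifiedOver κ (rotationOrbit P)
  exists_rotation_lift : ∃ c : X ≃ₜ X,
    (∀ x, κ (c x) = torusRotation (κ x)) ∧ (Function.fixedPoints c).ncard = 4

/-- The covering `[n] ∘ κ : X → E`, where `[n]` is the multiplication by `n` on `E`. If `κ` is the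
double covering belonging to the `n`-torsion point `P`, this is the origami `D_P`. -/
def origamiDP (n : ℕ) (κ : X → Torus) : X → Torus := fun x => n • κ x

end Veech

/-- Congruence of integral matrices of determinant one modulo `m`. -/
def CongruentMod (m : ℕ) (A B : Matrix.SpecialLinearGroup (Fin 2) ℤ) : Prop :=
  Matrix.SpecialLinearGroup.map (Int.castRingHom (ZMod m)) A =
    Matrix.SpecialLinearGroup.map (Int.castRingHom (ZMod m)) B

/-- `Γ` is a congruence group of level `m`: it contains the principal congruence group `Γ(m)`,
and `m` is minimal with this property among the positive integers. -/
def IsCongruenceGroupOfLevel (Γ : Subgroup (Matrix.SpecialLinearGroup (Fin 2) ℤ)) (m : ℕ) :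
    Prop :=
  IsLeast {k : ℕ | 0 < k ∧ CongruenceSubgroup.Gamma k ≤ Γ} m

/-!
Let `S` be the set of the four branch points, the rotates of the point `P` of odd order.

*The distinguished covering.* Two double coverings of the torus by surfaces with the same branch
points are locally isomorphic, and the local isomorphisms form a double covering of the torus that
is unramified also over `S` (`exists_isFibreIso`). This covering is trivial over the plane, so that
the two double coverings become isomorphic after pulling them back to the plane
(`exists_isLiftFamily`), uniquely up to the deck involution. The isomorphism descends to the
surfaces as soon as it is invariant under the lattice. The lift `c` of the rotation has four fixed
points, hence fixes the fibres over `(0, 0)` and `(1/2, 1/2)`, and so does the lift `c²` of the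
half-turn. Over `(1/2, 0)` and `(0, 1/2)`, however, `c²` exchanges the two sheets: up to rotations
and half-turns the sides of a quadrilateral around a single branch point match in pairs, and its
boundary has nontrivial monodromy (`rotationLift_rotationLift_eq_deckInvolution`).

*Matrices that lift.* Let `A` be an integral matrix of determinant one that preserves `S` and the
set of the two points `(1/2, 0)` and `(0, 1/2)`. The isomorphism over the plane between `κ` and its
pullback by `A` commutes with `c²`. Comparing its values over the two opposite points `-w/2` and
`w/2` for a lattice vector `w` shows that it is invariant under the lattice, and therefore `A` lifts
to the surface (`exists_homeomorph_lift`). The lift is affine with derivative `A`. The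
matrices that satisfy the two congruence conditions preserve both sets.

*Derivatives of affine maps.* Conversely let `f` be an affine homeomorphism of the punctured
surface. The images under `f` of the two points of a fibre of `κ` differ by a constant `b` with
`2 b = 0`. As the translation by `b` preserves the points that `n` does not annihilate, `n b = 0`,
so that `b = 0`. Hence `f` lies over an affine map of the torus with integral linear part `B`
(`IsAffineWithDerivative.exists_matrixAction`). This map preserves `S`, because `κ` has no section
over a punctured neighbourhood of a branch point (`matrixAction_add_mem`); its translation part
is annihilated by `n`, and also by four because the four points of `S` have sum zero, so that it
vanishes (`translation_eq_zero`). Since `(p, q)` and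
`(-q, p)` form a basis modulo `n`, this forces `B ≡ ±I, ±S` (`isSignedRotationMod_of_mem`). Finally
`f` commutes with `c²` up to the deck involution, and comparing fibres over the points of order two
gives the condition modulo two (`IsDPDoubleCover.odd_add_odd`).

*The level.* The group of matrices congruent to a power of the rotation modulo `m` contains the
principal congruence group of level `k` if and only if `m` divides `k`, as the powers of the
parabolic matrix `T` show (`gamma_le_rotationSubgroupMod_iff`).
-/

/-! ### The torus and its universal covering -/

theorem toTorus_add (v w : Fin 2 → ℝ) : toTorus (v + w) = toTorus v + toTorus w := by
  funext i; simp [toTorus]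

theorem toTorus_sub (v w : Fin 2 → ℝ) : toTorus (v - w) = toTorus v - toTorus w := by
  funext i; simp [toTorus]

theorem toTorus_neg (v : Fin 2 → ℝ) : toTorus (-v) = -toTorus v := by
  funext i; simp [toTorus]

@[simp] theorem toTorus_zero : toTorus 0 = 0 := by
  funext i; simp [toTorus]

theorem toTorus_eq_zero_iff {v : Fin 2 → ℝ} : toTorus v = 0 ↔ ∀ i, ∃ m : ℤ, v i = m := by
  rw [funext_iff]
  refine forall_congr' fun i => ?_
  rw [toTorus, Pi.zero_apply, AddCircle.coe_eq_zero_iff]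
  simp [eq_comm]

theorem toTorus_eq_iff {v w : Fin 2 → ℝ} :
    toTorus v = toTorus w ↔ ∀ i, ∃ m : ℤ, v i = w i + m := by
  rw [← sub_eq_zero, ← toTorus_sub, toTorus_eq_zero_iff]
  simp [sub_eq_iff_eq_add']

@[fun_prop] theorem continuous_toTorus : Continuous toTorus :=
  continuous_pi fun i => (AddCircle.continuous_mk' 1).comp (continuous_apply i)

theorem toTorus_surjective : Function.Surjective toTorus := fun t => by
  choose v hv using fun i => QuotientAddGroup.mk_surjective (t i)
  exact ⟨v, funext hv⟩

theorem isOpenMap_toTorus : IsOpenMap toTorus :=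
  IsOpenMap.piMap (fun _ => (AddCircle.isLocalHomeomorph_coe (1 : ℝ)).isOpenMap)
    (Filter.Eventually.of_forall fun _ => QuotientAddGroup.mk_surjective)

theorem injOn_toTorus_ball (v : Fin 2 → ℝ) : Set.InjOn toTorus (Metric.ball v (1 / 2)) := by
  intro w hw u hu h
  rw [toTorus_eq_iff] at h
  funext i
  obtain ⟨m, hm⟩ := h i
  have h1 : |w i - v i| < 1 / 2 := by
    simpa [Real.dist_eq] using (dist_le_pi_dist w v i).trans_lt hw
  have h2 : |u i - v i| < 1 / 2 := by
    simpa [Real.dist_eq] using (dist_le_pi_dist u v i).trans_lt hu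
  rw [abs_lt] at h1 h2
  have h3 : (m : ℝ) < 1 := by linarith
  have h4 : (-1 : ℝ) < m := by linarith
  have h5 : m < 1 := by exact_mod_cast h3
  have h6 : -1 < m := by exact_mod_cast h4
  have h7 : m = 0 := by omega
  simpa [h7] using hm

theorem isLocalHomeomorph_toTorus : IsLocalHomeomorph toTorus := by
  rw [isLocalHomeomorph_iff_isOpenEmbedding_restrict]
  refine fun v => ⟨Metric.ball v (1 / 2), Metric.ball_mem_nhds v (by norm_num), ?_⟩
  exact .of_continuous_injective_isOpenMap (continuous_toTorus.comp continuous_subtype_val)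
    (injOn_toTorus_ball v).injective (isOpenMap_toTorus.comp Metric.isOpen_ball.isOpenMap_subtype_val)

/-- The integral lattice is discrete: a continuous map into the plane whose class in the torus is
constantly zero is locally constant. -/
theorem eventually_eq_of_toTorus_eq_zero {Y : Type*} [TopologicalSpace Y] {g : Y → Fin 2 → ℝ}
    {y : Y} (hg : ContinuousAt g y) (h : ∀ᶠ z in 𝓝 y, toTorus (g z) = 0) :
    ∀ᶠ z in 𝓝 y, g z = g y := by
  filter_upwards [h, hg (Metric.ball_mem_nhds (g y) (by norm_num : (0 : ℝ) < 1 / 2))] with z h1 h2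
  exact injOn_toTorus_ball _ h2 (Metric.mem_ball_self (by norm_num)) (h1.trans h.self_of_nhds.symm)

theorem countable_preimage_toTorus {F : Set Torus} (hF : F.Countable) :
    (toTorus ⁻¹' F).Countable := by
  have : toTorus ⁻¹' F = ⋃ t ∈ F, toTorus ⁻¹' {t} := by ext; simp
  rw [this]
  refine hF.biUnion fun t _ => ?_
  obtain ⟨v, rfl⟩ := toTorus_surjective t
  refine (Set.countable_range fun m : Fin 2 → ℤ => v + fun i => (m i : ℝ)).mono ?_
  intro w hw
  choose m hm using toTorus_eq_iff.1 hw
  exact ⟨m, funext fun i => (hm i).symm⟩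

theorem isConnected_compl_preimage_toTorus {F : Set Torus} (hF : F.Countable) :
    IsConnected (toTorus ⁻¹' F)ᶜ :=
  (countable_preimage_toTorus hF).isConnected_compl_of_one_lt_rank (by simp)

/-! ### Double coverings and their deck involution -/

section DoubleCover

variable {X : Type*}

/-- The involution of `X` that exchanges the two points of each fibre of the double covering `κ`
and fixes the ramification points. -/
noncomputable def deckInvolution (κ : X → Torus) (x : X) : X :=
  open Classical in if h : ∃ y, κ y = κ x ∧ y ≠ x then h.choose else x

theorem map_deckInvolution (κ : X → Torus) (x : X) : κ (deckInvolution κ x) = κ x := by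
  unfold deckInvolution
  split_ifs with h
  · exact h.choose_spec.1
  · rfl

variable [TopologicalSpace X] {κ : X → Torus} {S : Set Torus}

namespace IsDoubleCoverRamifiedOver

theorem deckInvolution_eq (h : IsDoubleCoverRamifiedOver κ S) {x : X} (hx : κ x ∈ S) :
    deckInvolution κ x = x := by
  obtain ⟨a, ha⟩ := Set.ncard_eq_one.1 (h.ncard_fiber_of_mem _ hx)
  have h1 : x = a := by simpa using ha.subset (show x ∈ κ ⁻¹' {κ x} from rfl)
  have h2 : deckInvolution κ x = a := by
    simpa using ha.subset (show deckInvolution κ x ∈ κ ⁻¹' {κ x} from map_deckInvolution κ x)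
  rw [h2, h1]

theorem deckInvolution_ne (h : IsDoubleCoverRamifiedOver κ S) {x : X} (hx : κ x ∉ S) :
    deckInvolution κ x ≠ x := by
  have h1 : 1 < (κ ⁻¹' {κ x}).ncard := by rw [h.ncard_fiber_of_notMem _ hx]; norm_num
  obtain ⟨y, hy, hne⟩ := Set.exists_ne_of_one_lt_ncard h1 x
  have h2 : ∃ y, κ y = κ x ∧ y ≠ x := ⟨y, hy, hne⟩
  unfold deckInvolution
  rw [dif_pos h2]
  exact h2.choose_spec.2

theorem eq_or_eq_deckInvolution (h : IsDoubleCoverRamifiedOver κ S) {x y : X} (hxy : κ y = κ x) :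
    y = x ∨ y = deckInvolution κ x := by
  by_cases hx : κ x ∈ S
  · obtain ⟨a, ha⟩ := Set.ncard_eq_one.1 (h.ncard_fiber_of_mem _ hx)
    have h1 : x = a := by simpa using ha.subset (show x ∈ κ ⁻¹' {κ x} from rfl)
    have h2 : y = a := by simpa using ha.subset (show y ∈ κ ⁻¹' {κ x} from hxy)
    exact .inl (h2.trans h1.symm)
  · obtain ⟨a, b, -, hab⟩ := Set.ncard_eq_two.1 (h.ncard_fiber_of_notMem _ hx)
    have h1 : x = a ∨ x = b := by simpa using hab.subset (show x ∈ κ ⁻¹' {κ x} from rfl)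
    have h2 : y = a ∨ y = b := by simpa using hab.subset (show y ∈ κ ⁻¹' {κ x} from hxy)
    have h3 : deckInvolution κ x = a ∨ deckInvolution κ x = b := by
      simpa using hab.subset (show deckInvolution κ x ∈ κ ⁻¹' {κ x} from map_deckInvolution κ x)
    have h4 := h.deckInvolution_ne hx
    grind

theorem eq_deckInvolution (h : IsDoubleCoverRamifiedOver κ S) {x y : X} (hxy : κ y = κ x)
    (hne : y ≠ x) : y = deckInvolution κ x :=
  (h.eq_or_eq_deckInvolution hxy).resolve_left hne

theorem deckInvolution_deckInvolution (h : IsDoubleCoverRamifiedOver κ S) (x : X) :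
    deckInvolution κ (deckInvolution κ x) = x := by
  by_cases hx : κ x ∈ S
  · rw [h.deckInvolution_eq hx, h.deckInvolution_eq hx]
  · exact (h.eq_deckInvolution (map_deckInvolution κ x).symm (h.deckInvolution_ne hx).symm).symm

theorem surjective (h : IsDoubleCoverRamifiedOver κ S) : Function.Surjective κ := fun t => by
  by_contra hcon
  have h0 : κ ⁻¹' {t} = ∅ := Set.eq_empty_of_forall_notMem fun x hx => hcon ⟨x, hx⟩
  by_cases ht : t ∈ S
  · simpa [h0] using h.ncard_fiber_of_mem t ht
  · simpa [h0] using h.ncard_fiber_of_notMem t ht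

/-- Postcomposition with a homeomorphism of the torus preserving the branch points. -/
theorem homeomorph_comp (h : IsDoubleCoverRamifiedOver κ S) (M : Torus ≃ₜ Torus)
    (hM : ∀ t, M t ∈ S ↔ t ∈ S) : IsDoubleCoverRamifiedOver (M ∘ κ) S := by
  have hpre : ∀ t, M ∘ κ ⁻¹' {t} = κ ⁻¹' {M.symm t} := fun t => by
    ext x
    simp [Homeomorph.eq_symm_apply]
  have hM' : ∀ t, M.symm t ∈ S ↔ t ∈ S := fun t => by rw [← hM, M.apply_symm_apply]
  refine ⟨M.continuous.comp h.continuous, ?_, fun t ht => ?_, fun t ht => ?_⟩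
  · have := h.isCoveringMapOn.homeomorph_comp M
    refine this.mono fun t ht => ?_
    simpa [hM'] using ht
  · rw [hpre]; exact h.ncard_fiber_of_notMem _ (by rwa [hM'])
  · rw [hpre]; exact h.ncard_fiber_of_mem _ (by rwa [hM'])

theorem isLocalHomeomorphOn (h : IsDoubleCoverRamifiedOver κ S) :
    IsLocalHomeomorphOn κ (κ ⁻¹' Sᶜ) :=
  h.isCoveringMapOn.isLocalHomeomorphOn

/-- Near a ramification point, the preimages of the neighbourhoods of the branch point form a
basis of neighbourhoods. -/
theorem nhds_eq_comap [CompactSpace X] (h : IsDoubleCoverRamifiedOver κ S) {x : X}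
    (hx : κ x ∈ S) : 𝓝 x = Filter.comap κ (𝓝 (κ x)) := by
  obtain ⟨a, ha⟩ := Set.ncard_eq_one.1 (h.ncard_fiber_of_mem _ hx)
  have h1 : x = a := by simpa using ha.subset (show x ∈ κ ⁻¹' {κ x} from rfl)
  rw [h.continuous.isClosedMap.comap_nhds_eq h.continuous, ha, nhdsSet_singleton, h1]

/-- The graph of the deck involution is the fibre product of `κ` with itself without the
unramified part of the diagonal. The latter is open in the fibre product because `κ` is locally
injective there, so that the graph is closed. -/
theorem continuous_deckInvolution [T2Space X] [CompactSpace X] (h : IsDoubleCoverRamifiedOver κ S)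
    (hS : IsClosed S) : Continuous (deckInvolution κ) := by
  have hgraph : IsClosed {p : X × X | p.2 = deckInvolution κ p.1} := by
    rw [← isOpen_compl_iff, isOpen_iff_mem_nhds]
    rintro ⟨x, y⟩ (hxy : ¬ y = deckInvolution κ x)
    by_cases hκ : κ y = κ x
    · obtain rfl := (h.eq_or_eq_deckInvolution hκ).resolve_right hxy
      have hy : κ y ∈ Sᶜ := fun hy => hxy (h.deckInvolution_eq hy).symm
      obtain ⟨e, hye, rfl⟩ := h.isLocalHomeomorphOn y hy
      have hO : IsOpen (e.source ∩ e ⁻¹' Sᶜ) :=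
        e.open_source.inter (hS.isOpen_compl.preimage h.continuous)
      refine Filter.mem_of_superset (prod_mem_nhds (hO.mem_nhds ⟨hye, hy⟩)
        (hO.mem_nhds ⟨hye, hy⟩)) ?_
      rintro ⟨a, b⟩ ⟨⟨ha, ha'⟩, ⟨hb, -⟩⟩ (hab : b = deckInvolution e a)
      have : b = a := e.injOn hb ha (by rw [hab, map_deckInvolution e])
      exact h.deckInvolution_ne ha' (hab.symm.trans this)
    · have hO : IsOpen {p : X × X | κ p.2 ≠ κ p.1} :=
        isOpen_ne_fun (h.continuous.comp continuous_snd) (h.continuous.comp continuous_fst)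
      refine Filter.mem_of_superset (hO.mem_nhds hκ) ?_
      rintro ⟨a, b⟩ hab (hab' : b = deckInvolution κ a)
      exact hab (by rw [hab', map_deckInvolution κ])
  rw [continuous_iff_isClosed]
  intro C hC
  have : deckInvolution κ ⁻¹' C
      = Prod.fst '' ({p : X × X | p.2 = deckInvolution κ p.1} ∩ Prod.snd ⁻¹' C) := by
    ext x; simp
  rw [this]
  exact isClosedMap_fst_of_compactSpace _ (hgraph.inter (hC.preimage continuous_snd))

/-- Two lifts of the same map from a connected space to the complement of the branch points agree
or differ by the deck involution. -/
theorem eqOn_or_eqOn_deckInvolution [T2Space X] [CompactSpace X]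
    (h : IsDoubleCoverRamifiedOver κ S) (hS : IsClosed S) {T : Type*} [TopologicalSpace T]
    {s : Set T} (hs : IsPreconnected s) {f g : T → X} (hf : ContinuousOn f s)
    (hg : ContinuousOn g s) (hfg : ∀ t ∈ s, κ (f t) = κ (g t)) (hgS : ∀ t ∈ s, κ (g t) ∉ S) :
    (∀ t ∈ s, f t = g t) ∨ ∀ t ∈ s, f t = deckInvolution κ (g t) := by
  have := isPreconnected_iff_preconnectedSpace.1 hs
  rw [continuousOn_iff_continuous_domRestrict] at hf hg
  have h1 : IsClosed {t : s | f t = g t} := isClosed_eq hf hg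
  have h2 : IsClosed {t : s | f t = deckInvolution κ (g t)} :=
    isClosed_eq hf ((h.continuous_deckInvolution hS).comp hg)
  have h3 : {t : s | f t = g t}ᶜ = {t : s | f t = deckInvolution κ (g t)} := by
    ext t
    refine ⟨fun ht => h.eq_deckInvolution (hfg t t.2) ht, fun ht ht' => ?_⟩
    exact h.deckInvolution_ne (hgS t t.2) (ht.symm.trans ht')
  have h4 : IsClopen {t : s | f t = g t} := ⟨h1, by rwa [← isClosed_compl_iff, h3]⟩
  rcases isClopen_iff.1 h4 with h5 | h5
  · right
    intro t ht
    rw [h5, Set.compl_empty] at h3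
    exact h3.subset (Set.mem_univ (⟨t, ht⟩ : s))
  · left
    intro t ht
    exact h5.symm.subset (Set.mem_univ (⟨t, ht⟩ : s))

/-- Uniqueness of lifts. -/
theorem eqOn_of_eq [T2Space X] [CompactSpace X]
    (h : IsDoubleCoverRamifiedOver κ S) (hS : IsClosed S) {T : Type*} [TopologicalSpace T]
    {s : Set T} (hs : IsPreconnected s) {f g : T → X} (hf : ContinuousOn f s)
    (hg : ContinuousOn g s) (hfg : ∀ t ∈ s, κ (f t) = κ (g t)) (hgS : ∀ t ∈ s, κ (g t) ∉ S)
    {t₀ : T} (ht₀ : t₀ ∈ s) (h₀ : f t₀ = g t₀) : ∀ t ∈ s, f t = g t := by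
  refine (h.eqOn_or_eqOn_deckInvolution hS hs hf hg hfg hgS).resolve_right fun hd => ?_
  exact h.deckInvolution_ne (hgS _ ht₀) ((hd _ ht₀).symm.trans h₀)

/-- Over a star-convex region of the plane without branch points, the double covering has a
continuous section through any given point. -/
theorem exists_section (h : IsDoubleCoverRamifiedOver κ S) {D : Set (Fin 2 → ℝ)} (hD : IsOpen D)
    {v₀ : Fin 2 → ℝ} (hstar : StarConvex ℝ v₀ D) (hDS : ∀ v ∈ D, toTorus v ∉ S)
    {v : Fin 2 → ℝ} (hv : v ∈ D) {x : X} (hx : κ x = toTorus v) :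
    ∃ s : (Fin 2 → ℝ) → X, ContinuousOn s D ∧ (∀ w ∈ D, κ (s w) = toTorus w) ∧ s v = x := by
  have := hstar.contractibleSpace ⟨v, hv⟩
  have : LocallyPathConnectedSpace D := hD.locallyPathConnectedSpace
  obtain ⟨F, ⟨hF, hF'⟩, -⟩ := h.isCoveringMapOn.existsUnique_continuousMap_lifts
    (⟨fun w : D => toTorus w, by fun_prop⟩ : C(D, Torus)) (a₀ := ⟨v, hv⟩) (e₀ := x) hx
    (fun w => hDS w w.2)
  classical
  refine ⟨fun w => if hw : w ∈ D then F ⟨w, hw⟩ else x, ?_, fun w hw => ?_, ?_⟩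
  · rw [continuousOn_iff_continuous_domRestrict]
    refine F.continuous.congr fun w => ?_
    simp [Set.domRestrict]
  · simpa [hw] using congrFun hF' ⟨w, hw⟩
  · simpa [hv] using hF

end IsDoubleCoverRamifiedOver

end DoubleCover

/-! ### Punctured surfaces -/

section Surface

variable {X : Type*} [TopologicalSpace X] [ChartedSpace (EuclideanSpace ℝ (Fin 2)) X]

theorem exists_isOpen_isConnected_diff_singleton (x : X) {N : Set X} (hN : N ∈ 𝓝 x) :
    ∃ W, IsOpen W ∧ x ∈ W ∧ W ⊆ N ∧ IsConnected (W \ {x}) := by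
  set e := chartAt (EuclideanSpace ℝ (Fin 2)) x
  have hx : x ∈ e.source := mem_chart_source _ x
  have h1 : e.target ∩ e.symm ⁻¹' N ∈ 𝓝 (e x) :=
    Filter.inter_mem (e.open_target.mem_nhds (e.map_source hx))
      ((e.continuousAt_symm (e.map_source hx)) (by rwa [e.left_inv hx]))
  obtain ⟨r, hr, hball⟩ := Metric.mem_nhds_iff.1 h1
  have hsub : Metric.ball (e x) r ⊆ e.target := fun y hy => (hball hy).1
  refine ⟨e.symm '' Metric.ball (e x) r, ?_, ⟨e x, Metric.mem_ball_self hr, e.left_inv hx⟩, ?_, ?_⟩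
  · exact e.symm.isOpen_image_of_subset_source Metric.isOpen_ball hsub
  · rintro _ ⟨y, hy, rfl⟩
    exact (hball hy).2
  · have hb : Metric.ball (e x) r \ {e x}
        = OpenPartialHomeomorph.univBall (e x) r '' {0}ᶜ := by
      have hu : Metric.ball (e x) r = OpenPartialHomeomorph.univBall (e x) r '' Set.univ := by
        rw [← OpenPartialHomeomorph.univBall_source (e x) r,
          OpenPartialHomeomorph.image_source_eq_target,
          OpenPartialHomeomorph.univBall_target (e x) hr]
      have hinj : Set.InjOn (OpenPartialHomeomorph.univBall (e x) r) Set.univ := by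
        rw [← OpenPartialHomeomorph.univBall_source (e x) r]
        exact OpenPartialHomeomorph.injOn _
      rw [Set.compl_eq_univ_sdiff, (hinj.image_sdiff_subset (Set.subset_univ _)), ← hu,
        Set.image_singleton, OpenPartialHomeomorph.univBall_apply_zero]
    have hc : IsConnected (Metric.ball (e x) r \ {e x}) := by
      rw [hb]
      refine (isConnected_compl_singleton_of_one_lt_rank ?_ 0).image _
        (OpenPartialHomeomorph.continuous_univBall _ _).continuousOn
      rw [← Module.finrank_eq_rank, finrank_euclideanSpace_fin]
      norm_num
    have hd : e.symm '' Metric.ball (e x) r \ {x} = e.symm '' (Metric.ball (e x) r \ {e x}) := by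
      rw [(e.symm.injOn.mono hsub).image_sdiff_subset
        (Set.singleton_subset_iff.2 (Metric.mem_ball_self hr)), Set.image_singleton, e.left_inv hx]
    rw [hd]
    exact hc.image _ (e.symm.continuousOn.mono (Set.sdiff_subset.trans hsub))

/-- A connected surface remains connected when finitely many points are removed. -/
theorem isPreconnected_compl_of_finite [T1Space X] [ConnectedSpace X] {F : Set X}
    (hF : F.Finite) : IsPreconnected Fᶜ := by
  have hW : ∀ x : X, ∃ W, IsOpen W ∧ x ∈ W ∧ W ⊆ (F \ {x})ᶜ ∧ IsConnected (W \ {x}) := fun x =>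
    exists_isOpen_isConnected_diff_singleton x
      (((hF.subset Set.sdiff_subset).isClosed.isOpen_compl).mem_nhds (by simp))
  choose W hWo hxW hWF hWc using hW
  have hWF' : ∀ x, W x \ {x} ⊆ Fᶜ := fun x y hy hyF => hWF x hy.1 ⟨hyF, hy.2⟩
  have key : ∀ u v : Set X, IsOpen u → IsOpen v → u ⊆ Fᶜ → v ⊆ Fᶜ → Fᶜ ⊆ u ∪ v → u.Nonempty →
      v.Nonempty → (u ∩ v).Nonempty := by
    intro u v hu hv huF hvF huv hu0 hv0
    by_contra hdis
    rw [Set.not_nonempty_iff_eq_empty] at hdis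
    have hdis' : ∀ p, p ∈ u → p ∈ v → False := fun p h1 h2 =>
      (hdis.subset ⟨h1, h2⟩ : p ∈ (∅ : Set X))
    let ext (u : Set X) : Set X := u ∪ ⋃ x ∈ {x | x ∈ F ∧ W x \ {x} ⊆ u}, W x
    have hext : ∀ u, IsOpen u → IsOpen (ext u) := fun u hu =>
      hu.union (isOpen_biUnion fun x _ => hWo x)
    have hmem : ∀ u p, p ∈ ext u ↔ p ∈ u ∨ ∃ x, (x ∈ F ∧ W x \ {x} ⊆ u) ∧ p ∈ W x := by
      intro u p; simp [ext]
    have hcover : Set.univ ⊆ ext u ∪ ext v := by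
      intro p _
      by_cases hp : p ∈ F
      · rcases (hWc p).isPreconnected.subset_or_subset hu hv
          (Set.disjoint_iff_inter_eq_empty.2 hdis) ((hWF' p).trans huv) with h1 | h1
        · exact .inl ((hmem u p).2 (.inr ⟨p, ⟨hp, h1⟩, hxW p⟩))
        · exact .inr ((hmem v p).2 (.inr ⟨p, ⟨hp, h1⟩, hxW p⟩))
      · exact (huv hp).imp (fun h1 => (hmem u p).2 (.inl h1)) (fun h1 => (hmem v p).2 (.inl h1))
    obtain ⟨p, -, hpu, hpv⟩ := isPreconnected_univ (ext u) (ext v) (hext u hu) (hext v hv) hcover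
      (by rw [Set.univ_inter]; exact hu0.mono Set.subset_union_left)
      (by rw [Set.univ_inter]; exact hv0.mono Set.subset_union_left)
    rw [hmem] at hpu hpv
    rcases hpu with hpu | ⟨x, ⟨hx, hxu⟩, hpx⟩ <;> rcases hpv with hpv | ⟨y, ⟨hy, hyv⟩, hpy⟩
    · exact hdis' p hpu hpv
    · exact hdis' p hpu (hyv ⟨hpy, fun h => huF hpu (h ▸ hy)⟩)
    · exact hdis' p (hxu ⟨hpx, fun h => hvF hpv (h ▸ hx)⟩) hpv
    · by_cases hpx' : p = x
      · subst hpx'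
        by_cases hpy' : p = y
        · subst hpy'
          obtain ⟨q, hq⟩ := (hWc p).nonempty
          exact hdis' q (hxu hq) (hyv hq)
        · exact hWF' y ⟨hpy, hpy'⟩ hx
      · have hpu := hxu ⟨hpx, hpx'⟩
        exact hdis' p hpu (hyv ⟨hpy, fun h => huF hpu (h ▸ hy)⟩)
  intro u v hu hv huv hu0 hv0
  have hFo := hF.isClosed.isOpen_compl
  obtain ⟨p, hp1, hp2⟩ := key (Fᶜ ∩ u) (Fᶜ ∩ v) (hFo.inter hu) (hFo.inter hv)
    Set.inter_subset_left Set.inter_subset_left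
    (fun p hp => (huv hp).imp (fun h => ⟨hp, h⟩) (fun h => ⟨hp, h⟩)) hu0 hv0
  exact ⟨p, hp1.1, hp1.2, hp2.2⟩

variable [T2Space X] [CompactSpace X] {κ : X → Torus} {S : Set Torus}

namespace IsDoubleCoverRamifiedOver

/-- The covering is not trivial over a punctured neighbourhood of a branch point: otherwise the
two sheets would disconnect a punctured neighbourhood of the ramification point. -/
theorem not_exists_section (h : IsDoubleCoverRamifiedOver κ S) (hS : S.Finite)
    {v : Fin 2 → ℝ} (hv : toTorus v ∈ S) {Ω : Set (Fin 2 → ℝ)} (hΩ : Ω ∈ 𝓝 v)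
    {s : (Fin 2 → ℝ) → X} (hs : ContinuousOn s (Ω \ {v}))
    (hκs : ∀ w ∈ Ω \ {v}, κ (s w) = toTorus w) : False := by
  obtain ⟨e, hve, he⟩ := isLocalHomeomorph_toTorus v
  set O : Set (Fin 2 → ℝ) := interior Ω ∩ e.source ∩ toTorus ⁻¹' (S \ {toTorus v})ᶜ with hOdef
  have hO : IsOpen O := (isOpen_interior.inter e.open_source).inter
    ((hS.subset Set.sdiff_subset).isClosed.isOpen_compl.preimage continuous_toTorus)
  have hvO : v ∈ O := ⟨⟨mem_interior_iff_mem_nhds.2 hΩ, hve⟩, by simp⟩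
  have hOe : O ⊆ e.source := fun w hw => hw.1.2
  have hOS : ∀ w ∈ O, w ≠ v → toTorus w ∉ S := fun w hw hne hwS =>
    hw.2 ⟨hwS, fun heq => hne (e.injOn (hOe hw) hve (by rw [← he]; exact heq))⟩
  have hOΩ : O \ {v} ⊆ Ω \ {v} := Set.sdiff_subset_sdiff_left fun w hw => interior_subset hw.1.1
  obtain ⟨x, hx⟩ := h.surjective (toTorus v)
  have hxS : κ x ∈ S := by rwa [hx]
  have himg : IsOpen (e '' O) := e.isOpen_image_of_subset_source hO hOe
  obtain ⟨W, hWo, hxW, hWN, hWc⟩ := exists_isOpen_isConnected_diff_singleton x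
    ((himg.preimage h.continuous).mem_nhds (show κ x ∈ e '' O from ⟨v, hvO, by rw [hx, he]⟩))
  have hsymm : ∀ y ∈ W \ {x}, e.symm (κ y) ∈ O \ {v} ∧ toTorus (e.symm (κ y)) = κ y := by
    rintro y ⟨hyW, hyx⟩
    obtain ⟨w, hw, hwy⟩ := hWN hyW
    have h1 : e.symm (κ y) = w := by rw [← hwy, e.left_inv (hOe hw)]
    have h2 : toTorus w = κ y := by rw [he, hwy]
    refine ⟨⟨by rwa [h1], fun h3 => hyx ?_⟩, by rw [h1, h2]⟩
    have h4 : κ y = κ x := by rw [← h2, ← h1, h3, hx]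
    rcases h.eq_or_eq_deckInvolution h4 with h5 | h5
    · exact h5
    · rw [h5]; exact h.deckInvolution_eq hxS
  have hcont : ContinuousOn (fun y => s (e.symm (κ y))) (W \ {x}) := by
    refine (hs.mono hOΩ).comp (e.continuousOn_symm.comp h.continuous.continuousOn ?_) ?_
    · intro y hy
      obtain ⟨w, hw, hwy⟩ := hWN hy.1
      rw [← hwy]; exact e.map_source (hOe hw)
    · exact fun y hy => (hsymm y hy).1
  have hκ : ∀ y ∈ W \ {x}, κ (s (e.symm (κ y))) = κ y := fun y hy => by
    rw [hκs _ (hOΩ (hsymm y hy).1), (hsymm y hy).2]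
  have hdich := h.eqOn_or_eqOn_deckInvolution hS.isClosed hWc.isPreconnected continuousOn_id hcont
    (fun y hy => (hκ y hy).symm) (fun y hy => by
      rw [hκ y hy, ← (hsymm y hy).2]; exact hOS _ (hsymm y hy).1.1 (hsymm y hy).1.2)
  -- both sheets have points arbitrarily close to `x`
  have hWx : W ∈ 𝓝 x := hWo.mem_nhds hxW
  rw [h.nhds_eq_comap hxS, hx, Filter.mem_comap] at hWx
  obtain ⟨V, hV, hVW⟩ := hWx
  have hV' : toTorus ⁻¹' V ∩ O ∈ 𝓝 v :=
    Filter.inter_mem (continuous_toTorus.continuousAt hV) (hO.mem_nhds hvO)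
  obtain ⟨w, ⟨hwV, hwO⟩, hwv⟩ : ((toTorus ⁻¹' V ∩ O) ∩ {v}ᶜ).Nonempty :=
    Filter.nonempty_of_mem (f := 𝓝[≠] v)
      (Filter.inter_mem (mem_nhdsWithin_of_mem_nhds hV') self_mem_nhdsWithin)
  have hsw : κ (s w) = toTorus w := hκs w (hOΩ ⟨hwO, hwv⟩)
  have hswS : κ (s w) ∉ S := by rw [hsw]; exact hOS w hwO hwv
  have hey : ∀ y, κ y = toTorus w → y ∈ W \ {x} ∧ e.symm (κ y) = w := fun y hy => by
    refine ⟨⟨hVW (by rw [Set.mem_preimage, hy]; exact hwV), ?_⟩, by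
      rw [hy, he, e.left_inv (hOe hwO)]⟩
    rintro rfl
    exact hOS w hwO hwv (hy ▸ hxS)
  have hy1 := hey _ hsw
  have hy2 := hey (deckInvolution κ (s w)) (by rw [map_deckInvolution κ, hsw])
  rcases hdich with hd | hd
  · have := hd _ hy2.1
    simp only [id, hy2.2] at this
    exact h.deckInvolution_ne hswS this
  · have := hd _ hy1.1
    simp only [id, hy1.2] at this
    exact h.deckInvolution_ne hswS this.symm

/-- Over a convex region with a single branch point `p`, the covering has sections `a` and `b`
over the region slit along the horizontal ray to the left, respectively to the right, of `p`,
which agree above `p` and differ by the deck involution below `p`. -/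
theorem exists_slit_sections (h : IsDoubleCoverRamifiedOver κ S) (hS : S.Finite)
    {Ω : Set (Fin 2 → ℝ)} (hΩ : IsOpen Ω) (hconv : Convex ℝ Ω) {p : Fin 2 → ℝ} (hp : p ∈ Ω)
    (hpS : toTorus p ∈ S) (hΩS : ∀ v ∈ Ω, toTorus v ∈ S → v = p) :
    ∃ a b : (Fin 2 → ℝ) → X,
      ContinuousOn a {v ∈ Ω | ¬ (v 1 = p 1 ∧ v 0 ≤ p 0)} ∧
      (∀ v ∈ Ω, ¬ (v 1 = p 1 ∧ v 0 ≤ p 0) → κ (a v) = toTorus v) ∧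
      ContinuousOn b {v ∈ Ω | ¬ (v 1 = p 1 ∧ p 0 ≤ v 0)} ∧
      (∀ v ∈ Ω, ¬ (v 1 = p 1 ∧ p 0 ≤ v 0) → κ (b v) = toTorus v) ∧
      (∀ v ∈ Ω, p 1 < v 1 → a v = b v) ∧
      (∀ v ∈ Ω, v 1 < p 1 → a v = deckInvolution κ (b v)) := by
  have hc0 : Continuous fun v : Fin 2 → ℝ => v 0 := continuous_apply 0
  have hc1 : Continuous fun v : Fin 2 → ℝ => v 1 := continuous_apply 1
  have hcl : IsClosed {v : Fin 2 → ℝ | v 1 = p 1 ∧ v 0 ≤ p 0} :=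
    (isClosed_eq hc1 continuous_const).inter (isClosed_le hc0 continuous_const)
  have hcr : IsClosed {v : Fin 2 → ℝ | v 1 = p 1 ∧ p 0 ≤ v 0} :=
    (isClosed_eq hc1 continuous_const).inter (isClosed_le continuous_const hc0)
  set D₁ : Set (Fin 2 → ℝ) := {v ∈ Ω | ¬ (v 1 = p 1 ∧ v 0 ≤ p 0)} with hD₁
  set D₂ : Set (Fin 2 → ℝ) := {v ∈ Ω | ¬ (v 1 = p 1 ∧ p 0 ≤ v 0)} with hD₂
  have hD₁o : IsOpen D₁ := hΩ.inter hcl.isOpen_compl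
  have hD₂o : IsOpen D₂ := hΩ.inter hcr.isOpen_compl
  -- centres of the two star-convex slit regions
  have hnear : ∀ᶠ η : ℝ in 𝓝 0, p + ![η, 0] ∈ Ω := by
    have hcont : Continuous fun η : ℝ => p + ![η, 0] := by
      refine continuous_const.add (continuous_pi fun i => ?_)
      fin_cases i <;> simp <;> fun_prop
    refine hcont.continuousAt.eventually (hΩ.mem_nhds ?_)
    have : (![0, 0] : Fin 2 → ℝ) = 0 := by funext i; fin_cases i <;> rfl
    simpa [this] using hp
  obtain ⟨r, hr, hball⟩ := Metric.eventually_nhds_iff.1 hnear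
  have hplus : p + ![r / 2, 0] ∈ Ω := hball (by simp [abs_of_pos hr]; linarith)
  have hminus : p + ![-(r / 2), 0] ∈ Ω := hball (by simp [abs_of_pos hr]; linarith)
  have hstar₁ : StarConvex ℝ (p + ![r / 2, 0]) D₁ := by
    rintro y ⟨hy, hyl⟩ α β hα hβ hαβ
    refine ⟨hconv hplus hy hα hβ hαβ, ?_⟩
    rintro ⟨h1, h2⟩
    simp only [Pi.add_apply, Pi.smul_apply, smul_eq_mul, Matrix.cons_val_zero,
      Matrix.cons_val_one] at h1 h2
    obtain rfl : α = 1 - β := by linarith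
    have h3 : β * (y 1 - p 1) = 0 := by linarith
    rcases mul_eq_zero.1 h3 with rfl | h3
    · linarith
    · have h4 : p 0 < y 0 := by
        by_contra hcon
        exact hyl ⟨by linarith, by linarith⟩
      rcases hβ.eq_or_lt with rfl | hβ
      · linarith
      · nlinarith [mul_pos hβ (sub_pos.2 h4), mul_nonneg hα hr.le]
  have hstar₂ : StarConvex ℝ (p + ![-(r / 2), 0]) D₂ := by
    rintro y ⟨hy, hyl⟩ α β hα hβ hαβ
    refine ⟨hconv hminus hy hα hβ hαβ, ?_⟩
    rintro ⟨h1, h2⟩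
    simp only [Pi.add_apply, Pi.smul_apply, smul_eq_mul, Matrix.cons_val_zero,
      Matrix.cons_val_one] at h1 h2
    obtain rfl : α = 1 - β := by linarith
    have h3 : β * (y 1 - p 1) = 0 := by linarith
    rcases mul_eq_zero.1 h3 with rfl | h3
    · linarith
    · have h4 : y 0 < p 0 := by
        by_contra hcon
        exact hyl ⟨by linarith, by linarith⟩
      rcases hβ.eq_or_lt with rfl | hβ
      · linarith
      · nlinarith [mul_pos hβ (sub_pos.2 h4), mul_nonneg hα hr.le]
  have hDS₁ : ∀ v ∈ D₁, toTorus v ∉ S := fun v hv hvS => hv.2 (by simp [hΩS v hv.1 hvS])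
  have hDS₂ : ∀ v ∈ D₂, toTorus v ∉ S := fun v hv hvS => hv.2 (by simp [hΩS v hv.1 hvS])
  obtain ⟨x₁, hx₁⟩ := h.surjective (toTorus (p + ![r / 2, 0]))
  obtain ⟨x₂, hx₂⟩ := h.surjective (toTorus (p + ![-(r / 2), 0]))
  obtain ⟨a, hac, haκ, -⟩ := h.exists_section hD₁o hstar₁ hDS₁
    (v := p + ![r / 2, 0]) ⟨hplus, by simp; linarith⟩ hx₁
  obtain ⟨b, hbc, hbκ, -⟩ := h.exists_section hD₂o hstar₂ hDS₂
    (v := p + ![-(r / 2), 0]) ⟨hminus, by simp; linarith⟩ hx₂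
  have hup : {v ∈ Ω | p 1 < v 1} ⊆ D₁ ∩ D₂ := fun v hv =>
    ⟨⟨hv.1, fun h1 => hv.2.ne' h1.1⟩, ⟨hv.1, fun h1 => hv.2.ne' h1.1⟩⟩
  have hdn : {v ∈ Ω | v 1 < p 1} ⊆ D₁ ∩ D₂ := fun v hv =>
    ⟨⟨hv.1, fun h1 => hv.2.ne h1.1⟩, ⟨hv.1, fun h1 => hv.2.ne h1.1⟩⟩
  have hlin : IsLinearMap ℝ fun v : Fin 2 → ℝ => v 1 := ⟨fun _ _ => rfl, fun _ _ => rfl⟩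
  have hupc : IsPreconnected {v ∈ Ω | p 1 < v 1} :=
    (hconv.inter (convex_halfSpace_gt hlin _)).isPreconnected
  have hdnc : IsPreconnected {v ∈ Ω | v 1 < p 1} :=
    (hconv.inter (convex_halfSpace_lt hlin _)).isPreconnected
  have hσ := h.continuous_deckInvolution hS.isClosed
  -- after exchanging the sheets of `b`, the sections agree above `p`
  obtain ⟨b, hbc, hbκ, hab⟩ : ∃ b : (Fin 2 → ℝ) → X, ContinuousOn b D₂ ∧
      (∀ w ∈ D₂, κ (b w) = toTorus w) ∧ ∀ v ∈ {v ∈ Ω | p 1 < v 1}, a v = b v := by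
    rcases h.eqOn_or_eqOn_deckInvolution hS.isClosed hupc (hac.mono fun v hv => (hup hv).1)
      (hbc.mono fun v hv => (hup hv).2)
      (fun v hv => by rw [haκ v (hup hv).1, hbκ v (hup hv).2])
      (fun v hv => by rw [hbκ v (hup hv).2]; exact hDS₂ v (hup hv).2) with h1 | h1
    · exact ⟨b, hbc, hbκ, h1⟩
    · exact ⟨deckInvolution κ ∘ b, hσ.comp_continuousOn hbc,
        fun w hw => by simp [map_deckInvolution, hbκ w hw], h1⟩
  refine ⟨a, b, hac, fun v hv hv' => haκ v ⟨hv, hv'⟩, hbc, fun v hv hv' => hbκ v ⟨hv, hv'⟩,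
    fun v hv hv' => hab v ⟨hv, hv'⟩, ?_⟩
  rcases h.eqOn_or_eqOn_deckInvolution hS.isClosed hdnc (hac.mono fun v hv => (hdn hv).1)
    (hbc.mono fun v hv => (hdn hv).2)
    (fun v hv => by rw [haκ v (hdn hv).1, hbκ v (hdn hv).2])
    (fun v hv => by rw [hbκ v (hdn hv).2]; exact hDS₂ v (hdn hv).2) with h1 | h1
  · -- otherwise the two sections glue to one over the punctured region
    exfalso
    classical
    have hab' : ∀ v ∈ D₁, v ∈ D₂ → a v = b v := by
      rintro v ⟨hv, hv1⟩ ⟨-, hv2⟩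
      rcases lt_trichotomy (v 1) (p 1) with h2 | h2 | h2
      · exact h1 v ⟨hv, h2⟩
      · exact absurd (le_total (v 0) (p 0)) (by tauto)
      · exact hab v ⟨hv, h2⟩
    have hcov : ∀ v ∈ Ω \ {p}, v ∈ D₁ ∨ v ∈ D₂ := by
      rintro v ⟨hv, hvp⟩
      by_contra! hcon
      have h2 : v 1 = p 1 ∧ v 0 ≤ p 0 := by_contra fun h2 => hcon.1 ⟨hv, h2⟩
      have h3 : v 1 = p 1 ∧ p 0 ≤ v 0 := by_contra fun h3 => hcon.2 ⟨hv, h3⟩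
      refine hvp (funext fun i => ?_)
      fin_cases i
      · exact le_antisymm h2.2 h3.2
      · exact h2.1
    refine h.not_exists_section hS hpS (hΩ.mem_nhds hp) (s := fun v => if v ∈ D₁ then a v else b v)
      ?_ ?_
    · intro v hv
      refine ContinuousAt.continuousWithinAt ?_
      rcases hcov v hv with hv | hv
      · refine (hac.continuousAt (hD₁o.mem_nhds hv)).congr ?_
        filter_upwards [hD₁o.mem_nhds hv] with w hw
        rw [if_pos hw]
      · refine (hbc.continuousAt (hD₂o.mem_nhds hv)).congr ?_
        filter_upwards [hD₂o.mem_nhds hv] with w hw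
        split_ifs with hw'
        · exact (hab' w hw' hw).symm
        · rfl
    · intro v hv
      split_ifs with hv'
      · exact haκ v hv'
      · exact hbκ v ((hcov v hv).resolve_left hv')
  · exact fun v hv hv' => h1 v ⟨hv, hv'⟩

end IsDoubleCoverRamifiedOver

end Surface

/-! ### Local isomorphisms of double coverings with the same branch points -/

theorem OpenPartialHomeomorph.continuousOn_comp_symm {A B Y : Type*} [TopologicalSpace A]
    [TopologicalSpace B] [TopologicalSpace Y] (e : OpenPartialHomeomorph A B) {D : Set A}
    (hD : D ⊆ e.source) {a : A → Y} (ha : ContinuousOn a D) :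
    ContinuousOn (fun u => a (e.symm u)) (e '' D) := by
  refine ha.comp (e.continuousOn_symm.mono ?_) ?_
  · rintro _ ⟨w, hw, rfl⟩; exact e.map_source (hD hw)
  · rintro _ ⟨w, hw, rfl⟩; rwa [e.left_inv (hD hw)]

section Isomorphism

variable {X X' : Type*} [TopologicalSpace X] [TopologicalSpace X']
  {κ : X → Torus} {κ' : X' → Torus} {S : Set Torus}

/-- `φ` restricts to a morphism of double coverings from `κ` to `κ'` over the set `B`. -/
structure IsFibreIso (κ : X → Torus) (κ' : X' → Torus) (B : Set Torus) (φ : X → X') : Prop where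
  continuousOn : ContinuousOn φ (κ ⁻¹' B)
  map_eq : ∀ x, κ x ∈ B → κ' (φ x) = κ x
  map_deck : ∀ x, κ x ∈ B → φ (deckInvolution κ x) = deckInvolution κ' (φ x)

/-- The morphism of double coverings that maps the section `a` to the section `a'`. -/
noncomputable def sheetMap (κ : X → Torus) (κ' : X' → Torus) (a : Torus → X) (a' : Torus → X')
    (x : X) : X' :=
  open Classical in if x = a (κ x) then a' (κ x) else deckInvolution κ' (a' (κ x))

theorem sheetMap_congr {X X' : Type*} {κ : X → Torus} {κ' : X' → Torus}
    {a b : Torus → X} {a' b' : Torus → X'} {x : X} (h1 : a (κ x) = b (κ x))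
    (h2 : a' (κ x) = b' (κ x)) : sheetMap κ κ' a a' x = sheetMap κ κ' b b' x := by
  unfold sheetMap; rw [h1, h2]

theorem isFibreIso_sheetMap [T2Space X] [CompactSpace X] [T2Space X'] [CompactSpace X']
    (h : IsDoubleCoverRamifiedOver κ S)
    (h' : IsDoubleCoverRamifiedOver κ' S) (hS : IsClosed S) {D : Set Torus} (hD : IsOpen D)
    (hDS : ∀ t ∈ D, t ∉ S) {a : Torus → X} {a' : Torus → X'} (ha : ContinuousOn a D)
    (hκa : ∀ t ∈ D, κ (a t) = t) (ha' : ContinuousOn a' D) (hκa' : ∀ t ∈ D, κ' (a' t) = t) :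
    IsFibreIso κ κ' D (sheetMap κ κ' a a') := by
  have hσ := h.continuous_deckInvolution hS
  have hσ' := h'.continuous_deckInvolution hS
  refine ⟨fun x hx => ContinuousAt.continuousWithinAt ?_, fun x hx => ?_, fun x hx => ?_⟩
  · have hT : κ ⁻¹' D ∈ 𝓝 x := (hD.preimage h.continuous).mem_nhds hx
    have h1 : ContinuousAt (fun y => a (κ y)) x :=
      (ha.continuousAt (hD.mem_nhds hx)).comp h.continuous.continuousAt
    have h2 : ContinuousAt (fun y => a' (κ y)) x :=
      (ha'.continuousAt (hD.mem_nhds hx)).comp h.continuous.continuousAt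
    by_cases hxa : x = a (κ x)
    · have h3 : ∀ᶠ y in 𝓝 x, y ≠ deckInvolution κ (a (κ y)) :=
        (continuousAt_id.ne_iff_eventually_ne (hσ.continuousAt.comp h1)).1 (by
          simp only [id, Function.comp, ← hxa]
          exact (h.deckInvolution_ne (hDS _ hx)).symm)
      refine h2.congr ?_
      filter_upwards [h3, hT] with y hy hyD
      have : y = a (κ y) := (h.eq_or_eq_deckInvolution (hκa _ hyD).symm).resolve_right hy
      rw [sheetMap, if_pos this]
    · have h3 : ∀ᶠ y in 𝓝 x, y ≠ a (κ y) :=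
        (continuousAt_id.ne_iff_eventually_ne h1).1 hxa
      refine (hσ'.continuousAt.comp h2).congr ?_
      filter_upwards [h3] with y hy
      rw [sheetMap, if_neg hy, Function.comp]
  · unfold sheetMap
    split_ifs
    · exact hκa' _ hx
    · rw [map_deckInvolution κ', hκa' _ hx]
  · unfold sheetMap
    rw [map_deckInvolution κ]
    have hne := h.deckInvolution_ne (hDS _ hx)
    rcases h.eq_or_eq_deckInvolution (hκa _ hx) with h1 | h1
    · rw [if_pos h1.symm, if_neg (by rw [h1]; exact hne)]
    · rw [if_pos h1.symm, if_neg (by rw [h1]; exact hne.symm), h'.deckInvolution_deckInvolution]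

theorem sheetMap_congr_deck (h : IsDoubleCoverRamifiedOver κ S)
    (h' : IsDoubleCoverRamifiedOver κ' S) {a b : Torus → X} {a' b' : Torus → X'} {x : X}
    (hx : κ x ∉ S) (hb : κ (b (κ x)) = κ x) (h1 : a (κ x) = deckInvolution κ (b (κ x)))
    (h2 : a' (κ x) = deckInvolution κ' (b' (κ x))) :
    sheetMap κ κ' a a' x = sheetMap κ κ' b b' x := by
  unfold sheetMap
  rw [h1, h2, h'.deckInvolution_deckInvolution]
  have hne := h.deckInvolution_ne hx
  rcases h.eq_or_eq_deckInvolution hb with h3 | h3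
  · rw [if_pos h3.symm, if_neg (by rw [h3]; exact hne.symm)]
  · rw [if_pos (by rw [h3, h.deckInvolution_deckInvolution]), if_neg (by rw [h3]; exact hne.symm)]

variable [T2Space X] [CompactSpace X] [T2Space X'] [CompactSpace X']
  [ChartedSpace (EuclideanSpace ℝ (Fin 2)) X]
  [ChartedSpace (EuclideanSpace ℝ (Fin 2)) X']

/-- Two double coverings by surfaces with the same branch points are locally isomorphic. Near a
branch point, the isomorphism is obtained from the sections over the two slit discs: on both
surfaces these change sheets in the same way. -/
theorem exists_isFibreIso (h : IsDoubleCoverRamifiedOver κ S)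
    (h' : IsDoubleCoverRamifiedOver κ' S) (hS : S.Finite) (t : Torus) :
    ∃ B : Set Torus, IsOpen B ∧ t ∈ B ∧ (∀ u ∈ B, u ∈ S → u = t) ∧ ∃ φ, IsFibreIso κ κ' B φ := by
  classical
  obtain ⟨v, rfl⟩ := toTorus_surjective t
  obtain ⟨e, hve, he⟩ := isLocalHomeomorph_toTorus v
  have hN : e.source ∩ toTorus ⁻¹' (S \ {toTorus v})ᶜ ∈ 𝓝 v :=
    Filter.inter_mem (e.open_source.mem_nhds hve)
      (((hS.subset Set.sdiff_subset).isClosed.isOpen_compl.preimage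
        continuous_toTorus).mem_nhds (by simp))
  obtain ⟨r, hr, hball⟩ := Metric.mem_nhds_iff.1 hN
  set Ω := Metric.ball v r
  have hΩe : Ω ⊆ e.source := fun w hw => (hball hw).1
  have hvΩ : v ∈ Ω := Metric.mem_ball_self hr
  have hΩS : ∀ w ∈ Ω, toTorus w ∈ S → w = v := fun w hw hwS => by
    by_contra hne
    exact (hball hw).2 ⟨hwS, fun heq => hne (e.injOn (hΩe hw) hve (by rw [← he]; exact heq))⟩
  have hopen : ∀ D ⊆ Ω, IsOpen D → IsOpen (e '' D) := fun D hD hDo =>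
    e.isOpen_image_of_subset_source hDo (hD.trans hΩe)
  have hsec : ∀ D ⊆ Ω, ∀ a : (Fin 2 → ℝ) → X, (∀ w ∈ D, κ (a w) = toTorus w) →
      ∀ u ∈ e '' D, κ (a (e.symm u)) = u := by
    rintro D hD a ha _ ⟨w, hw, rfl⟩
    rw [e.left_inv (hΩe (hD hw)), ha w hw, he]
  have hsec' : ∀ D ⊆ Ω, ∀ a : (Fin 2 → ℝ) → X', (∀ w ∈ D, κ' (a w) = toTorus w) →
      ∀ u ∈ e '' D, κ' (a (e.symm u)) = u := by
    rintro D hD a ha _ ⟨w, hw, rfl⟩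
    rw [e.left_inv (hΩe (hD hw)), ha w hw, he]
  refine ⟨e '' Ω, hopen Ω le_rfl Metric.isOpen_ball, ⟨v, hvΩ, by rw [he]⟩, ?_, ?_⟩
  · rintro _ ⟨w, hw, rfl⟩ hwS
    rw [← he] at hwS
    rw [hΩS w hw hwS, he]
  obtain ⟨x, hx⟩ := h.surjective (toTorus v)
  obtain ⟨x', hx'⟩ := h'.surjective (toTorus v)
  by_cases hvS : toTorus v ∈ S
  swap
  · have hΩS' : ∀ w ∈ Ω, toTorus w ∉ S := fun w hw hwS => hvS (hΩS w hw hwS ▸ hwS)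
    have hstar : StarConvex ℝ v Ω := (convex_ball v r).starConvex hvΩ
    obtain ⟨a, hac, haκ, -⟩ := h.exists_section Metric.isOpen_ball hstar hΩS' hvΩ hx
    obtain ⟨a', hac', haκ', -⟩ := h'.exists_section Metric.isOpen_ball hstar hΩS' hvΩ hx'
    refine ⟨_, isFibreIso_sheetMap h h' hS.isClosed (hopen Ω le_rfl Metric.isOpen_ball) ?_
      (e.continuousOn_comp_symm (hΩe) hac) (hsec Ω le_rfl a haκ) (e.continuousOn_comp_symm (hΩe) hac')
      (hsec' Ω le_rfl a' haκ')⟩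
    rintro _ ⟨w, hw, rfl⟩
    rw [← he]; exact hΩS' w hw
  obtain ⟨a, b, hac, haκ, hbc, hbκ, hup, hdn⟩ :=
    h.exists_slit_sections hS Metric.isOpen_ball (convex_ball v r) hvΩ hvS hΩS
  obtain ⟨a', b', hac', haκ', hbc', hbκ', hup', hdn'⟩ :=
    h'.exists_slit_sections hS Metric.isOpen_ball (convex_ball v r) hvΩ hvS hΩS
  have hc0 : Continuous fun v : Fin 2 → ℝ => v 0 := continuous_apply 0
  have hc1 : Continuous fun v : Fin 2 → ℝ => v 1 := continuous_apply 1
  set D₁ : Set (Fin 2 → ℝ) := {w ∈ Ω | ¬ (w 1 = v 1 ∧ w 0 ≤ v 0)}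
  set D₂ : Set (Fin 2 → ℝ) := {w ∈ Ω | ¬ (w 1 = v 1 ∧ v 0 ≤ w 0)}
  have hD₁ : D₁ ⊆ Ω := fun w hw => hw.1
  have hD₂ : D₂ ⊆ Ω := fun w hw => hw.1
  have hD₁o : IsOpen D₁ := Metric.isOpen_ball.inter
    ((isClosed_eq hc1 continuous_const).inter (isClosed_le hc0 continuous_const)).isOpen_compl
  have hD₂o : IsOpen D₂ := Metric.isOpen_ball.inter
    ((isClosed_eq hc1 continuous_const).inter (isClosed_le continuous_const hc0)).isOpen_compl
  have hS₁ : ∀ u ∈ e '' D₁, u ∉ S := by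
    rintro _ ⟨w, hw, rfl⟩ hwS
    rw [← he] at hwS
    exact hw.2 (by simp [hΩS w hw.1 hwS])
  have hS₂ : ∀ u ∈ e '' D₂, u ∉ S := by
    rintro _ ⟨w, hw, rfl⟩ hwS
    rw [← he] at hwS
    exact hw.2 (by simp [hΩS w hw.1 hwS])
  set φ₁ := sheetMap κ κ' (fun u => a (e.symm u)) (fun u => a' (e.symm u))
  set φ₂ := sheetMap κ κ' (fun u => b (e.symm u)) (fun u => b' (e.symm u))
  have hφ₁ : IsFibreIso κ κ' (e '' D₁) φ₁ :=
    isFibreIso_sheetMap h h' hS.isClosed (hopen D₁ hD₁ hD₁o) hS₁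
      (e.continuousOn_comp_symm (hD₁.trans hΩe) hac)
      (hsec D₁ hD₁ a fun w hw => haκ w hw.1 hw.2) (e.continuousOn_comp_symm (hD₁.trans hΩe) hac')
      (hsec' D₁ hD₁ a' fun w hw => haκ' w hw.1 hw.2)
  have hφ₂ : IsFibreIso κ κ' (e '' D₂) φ₂ :=
    isFibreIso_sheetMap h h' hS.isClosed (hopen D₂ hD₂ hD₂o) hS₂
      (e.continuousOn_comp_symm (hD₂.trans hΩe) hbc)
      (hsec D₂ hD₂ b fun w hw => hbκ w hw.1 hw.2) (e.continuousOn_comp_symm (hD₂.trans hΩe) hbc')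
      (hsec' D₂ hD₂ b' fun w hw => hbκ' w hw.1 hw.2)
  have hagree : ∀ y, κ y ∈ e '' D₁ → κ y ∈ e '' D₂ → φ₁ y = φ₂ y := by
    intro y hy1 hy2
    obtain ⟨w, hw, hwy⟩ := id hy1
    obtain ⟨w', hw', hwy'⟩ := id hy2
    obtain rfl : w = w' := e.injOn (hΩe hw.1) (hΩe hw'.1) (hwy.trans hwy'.symm)
    have hsy : e.symm (κ y) = w := by rw [← hwy, e.left_inv (hΩe hw.1)]
    rcases lt_trichotomy (w 1) (v 1) with h2 | h2 | h2
    · refine sheetMap_congr_deck h h' (hS₁ _ hy1) ?_ ?_ ?_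
      · simp only [hsy]; rw [hbκ w hw.1 hw'.2, he, hwy]
      · simp only [hsy]; exact hdn w hw.1 h2
      · simp only [hsy]; exact hdn' w hw.1 h2
    · have := hw.2
      have := hw'.2
      exact absurd (le_total (w 0) (v 0)) (by tauto)
    · refine sheetMap_congr ?_ ?_
      · simp only [hsy]; exact hup w hw.1 h2
      · simp only [hsy]; exact hup' w hw.1 h2
  have hcases : ∀ y, κ y ∈ e '' Ω → κ y ∈ e '' D₁ ∨ κ y ∈ e '' D₂ ∨ κ y = toTorus v := by
    rintro y ⟨w, hw, hwy⟩
    by_cases hw1 : w ∈ D₁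
    · exact .inl ⟨w, hw1, hwy⟩
    by_cases hw2 : w ∈ D₂
    · exact .inr (.inl ⟨w, hw2, hwy⟩)
    have h2 : w 1 = v 1 ∧ w 0 ≤ v 0 := by_contra fun h2 => hw1 ⟨hw, h2⟩
    have h3 : w 1 = v 1 ∧ v 0 ≤ w 0 := by_contra fun h3 => hw2 ⟨hw, h3⟩
    have : w = v := funext fun i => by
      fin_cases i
      · exact le_antisymm h2.2 h3.2
      · exact h2.1
    exact .inr (.inr (by rw [← hwy, this, he]))
  set φ : X → X' := fun y => if κ y ∈ e '' D₁ then φ₁ y else if κ y ∈ e '' D₂ then φ₂ y else x'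
  have hφ1 : ∀ y, κ y ∈ e '' D₁ → φ y = φ₁ y := fun y hy => if_pos hy
  have hφ2 : ∀ y, κ y ∈ e '' D₂ → φ y = φ₂ y := fun y hy => by
    by_cases hy1 : κ y ∈ e '' D₁
    · rw [hφ1 y hy1, hagree y hy1 hy]
    · simp only [φ, if_neg hy1, if_pos hy]
  have hφ3 : ∀ y, κ y = toTorus v → φ y = x' := fun y hy => by
    simp only [φ]
    rw [if_neg fun hy1 => hS₁ _ hy1 (hy ▸ hvS), if_neg fun hy1 => hS₂ _ hy1 (hy ▸ hvS)]
  have hmap : ∀ y, κ y ∈ e '' Ω → κ' (φ y) = κ y := by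
    intro y hy
    rcases hcases y hy with hy | hy | hy
    · rw [hφ1 y hy, hφ₁.map_eq y hy]
    · rw [hφ2 y hy, hφ₂.map_eq y hy]
    · rw [hφ3 y hy, hx', hy]
  refine ⟨φ, fun y hy => ContinuousAt.continuousWithinAt ?_, hmap, fun y hy => ?_⟩
  · have hloc : ∀ D ⊆ Ω, IsOpen D → ∀ ψ, IsFibreIso κ κ' (e '' D) ψ →
        (∀ y, κ y ∈ e '' D → φ y = ψ y) → κ y ∈ e '' D → ContinuousAt φ y := by
      intro D hD hDo ψ hψ hφψ hyD
      have h1 : κ ⁻¹' (e '' D) ∈ 𝓝 y := ((hopen D hD hDo).preimage h.continuous).mem_nhds hyD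
      exact (hψ.continuousOn.continuousAt h1).congr
        (Filter.mem_of_superset h1 fun z hz => (hφψ z hz).symm)
    rcases hcases y hy with hy | hy | hy
    · exact hloc D₁ hD₁ hD₁o φ₁ hφ₁ hφ1 hy
    · exact hloc D₂ hD₂ hD₂o φ₂ hφ₂ hφ2 hy
    · rw [ContinuousAt, hφ3 y hy, h'.nhds_eq_comap (by rwa [hx']), Filter.tendsto_comap_iff, hx',
        ← hy]
      refine Filter.Tendsto.congr' ?_ h.continuous.continuousAt
      filter_upwards [((hopen Ω le_rfl Metric.isOpen_ball).preimage h.continuous).mem_nhds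
        (show κ y ∈ e '' Ω from ⟨v, hvΩ, by rw [hy, he]⟩)] with z hz
      exact (hmap z hz).symm
  · have hdk : κ (deckInvolution κ y) = κ y := map_deckInvolution κ y
    rcases hcases y hy with hy | hy | hy
    · rw [hφ1 y hy, hφ1 _ (by rwa [hdk]), hφ₁.map_deck y hy]
    · rw [hφ2 y hy, hφ2 _ (by rwa [hdk]), hφ₂.map_deck y hy]
    · rw [hφ3 y hy, hφ3 _ (by rw [hdk, hy]), h'.deckInvolution_eq (by rwa [hx'])]

end Isomorphism

/-! ### Isomorphisms over the universal covering of the torus -/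

section LiftFamily

variable {X X' : Type*} [TopologicalSpace X] [TopologicalSpace X']
  {κ : X → Torus} {κ' : X' → Torus} {S : Set Torus}

/-- A morphism of double coverings from `κ` to `κ'` after pulling both back to the plane: a family
of maps `Φ v` from the fibre of `κ` over `toTorus v` to the fibre of `κ'` over the same point,
which depends continuously on `v`. Only the values of `Φ v` on this fibre matter. -/
structure IsLiftFamily (κ : X → Torus) (κ' : X' → Torus) (Φ : (Fin 2 → ℝ) → X → X') : Prop where
  continuousOn : ContinuousOn (fun q : (Fin 2 → ℝ) × X => Φ q.1 q.2) {q | κ q.2 = toTorus q.1}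
  map_eq : ∀ v x, κ x = toTorus v → κ' (Φ v x) = κ x
  map_deck : ∀ v x, κ x = toTorus v → Φ v (deckInvolution κ x) = deckInvolution κ' (Φ v x)

theorem IsLiftFamily.deck [T2Space X'] [CompactSpace X'] (h' : IsDoubleCoverRamifiedOver κ' S)
    (hS : IsClosed S) {Φ : (Fin 2 → ℝ) → X → X'} (hΦ : IsLiftFamily κ κ' Φ) :
    IsLiftFamily κ κ' fun v x => deckInvolution κ' (Φ v x) where
  continuousOn := (h'.continuous_deckInvolution hS).comp_continuousOn hΦ.continuousOn
  map_eq v x hx := by rw [map_deckInvolution κ', hΦ.map_eq v x hx]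
  map_deck v x hx := by rw [hΦ.map_deck v x hx]

/-- Two morphisms over the plane that agree at one point of one unramified fibre agree. -/
theorem IsLiftFamily.eq_of_eq [T2Space X] [CompactSpace X] [T2Space X'] [CompactSpace X']
    (h : IsDoubleCoverRamifiedOver κ S) (h' : IsDoubleCoverRamifiedOver κ' S) (hS : S.Finite)
    {Φ Ψ : (Fin 2 → ℝ) → X → X'} (hΦ : IsLiftFamily κ κ' Φ) (hΨ : IsLiftFamily κ κ' Ψ)
    {v₀ : Fin 2 → ℝ} {x₀ : X} (hv₀ : toTorus v₀ ∉ S) (hx₀ : κ x₀ = toTorus v₀)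
    (heq : Φ v₀ x₀ = Ψ v₀ x₀) {v : Fin 2 → ℝ} {x : X} (hx : κ x = toTorus v) :
    Φ v x = Ψ v x := by
  by_cases hv : toTorus v ∈ S
  · have h1 : κ' (Φ v x) = κ' (Ψ v x) := by rw [hΦ.map_eq v x hx, hΨ.map_eq v x hx]
    rcases h'.eq_or_eq_deckInvolution h1 with h2 | h2
    · exact h2
    · rw [h2, h'.deckInvolution_eq]
      rwa [hΨ.map_eq v x hx, hx]
  set Q : Set ((Fin 2 → ℝ) × X) := {q | κ q.2 = toTorus q.1}
  have hQ : IsClosed Q := isClosed_eq (h.continuous.comp continuous_snd)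
    (continuous_toTorus.comp continuous_fst)
  have hclosed : ∀ Θ : (Fin 2 → ℝ) → X → X', IsLiftFamily κ κ' Θ →
      IsClosed {v | ∃ x, κ x = toTorus v ∧ Φ v x = Θ v x} := by
    intro Θ hΘ
    have h1 : IsClosed {q : Q | Φ q.1.1 q.1.2 = Θ q.1.1 q.1.2} :=
      isClosed_eq (continuousOn_iff_continuous_domRestrict.1 hΦ.continuousOn)
        (continuousOn_iff_continuous_domRestrict.1 hΘ.continuousOn)
    have h2 := isClosedMap_fst_of_compactSpace (X := Fin 2 → ℝ) (Y := X) _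
      (hQ.isClosedEmbedding_subtypeVal.isClosedMap _ h1)
    convert h2 using 1
    ext w
    constructor
    · rintro ⟨x, hx, hx'⟩
      exact ⟨(w, x), ⟨⟨(w, x), hx⟩, hx', rfl⟩, rfl⟩
    · rintro ⟨_, ⟨⟨q, hq⟩, hq', rfl⟩, rfl⟩
      exact ⟨q.2, hq, hq'⟩
  have hU : IsConnected (toTorus ⁻¹' S)ᶜ := isConnected_compl_preimage_toTorus hS.countable
  have hone : ∀ w : Fin 2 → ℝ, ∀ Θ, IsLiftFamily κ κ' Θ → ∀ y z, κ y = toTorus w →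
      κ z = toTorus w → Φ w y = Θ w y → Φ w z = Θ w z := by
    intro w Θ hΘ y z hy hz hyz
    rcases h.eq_or_eq_deckInvolution (hz.trans hy.symm) with rfl | rfl
    · exact hyz
    · rw [hΦ.map_deck w y hy, hΘ.map_deck w y hy, hyz]
  have hΨ' := hΨ.deck h' hS.isClosed
  by_contra hne
  have hne' : Φ v x = deckInvolution κ' (Ψ v x) :=
    h'.eq_deckInvolution (by rw [hΦ.map_eq v x hx, hΨ.map_eq v x hx]) hne
  obtain ⟨w, hwU, ⟨y, hy, hyΦ⟩, ⟨z, hz, hzΦ⟩⟩ := isPreconnected_closed_iff.1 hU.isPreconnected _ _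
    (hclosed Ψ hΨ) (hclosed _ hΨ') (fun w hw => by
      obtain ⟨y, hy⟩ := h.surjective (toTorus w)
      have h1 : κ' (Φ w y) = κ' (Ψ w y) := by rw [hΦ.map_eq w y hy, hΨ.map_eq w y hy]
      exact (h'.eq_or_eq_deckInvolution h1).imp (fun h2 => ⟨y, hy, h2⟩) (fun h2 => ⟨y, hy, h2⟩))
    ⟨v₀, hv₀, x₀, hx₀, heq⟩ ⟨v, hv, x, hx, hne'⟩
  have h2 := hone w Ψ hΨ y z hy hz hyΦ
  refine h'.deckInvolution_ne ?_ (hzΦ.symm.trans h2)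
  rw [hΨ.map_eq w z hz, hz]
  exact hwU

variable [T2Space X] [CompactSpace X] [T2Space X'] [CompactSpace X']
  [ChartedSpace (EuclideanSpace ℝ (Fin 2)) X] [ChartedSpace (EuclideanSpace ℝ (Fin 2)) X']

/-- Two double coverings of the torus by surfaces with the same branch points become isomorphic
over the plane. The local isomorphisms form a fibre bundle over the torus with two points in
each fibre, also over the branch points. It is a covering, so it has a section over the plane. -/
theorem exists_isLiftFamily (h : IsDoubleCoverRamifiedOver κ S)
    (h' : IsDoubleCoverRamifiedOver κ' S) (hS : S.Finite) : ∃ Φ, IsLiftFamily κ κ' Φ := by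
  classical
  choose B hBo hB hBS φ hφ using exists_isFibreIso h h' hS
  let agree (i j t : Torus) : Prop := ∀ x, κ x = t → φ i x = φ j x
  have hdich : ∀ i j t, t ∈ B i → t ∈ B j →
      agree i j t ∨ ∀ x, κ x = t → φ i x = deckInvolution κ' (φ j x) := by
    intro i j t hi hj
    obtain ⟨x, rfl⟩ := h.surjective t
    have h1 : κ' (φ i x) = κ' (φ j x) := by rw [(hφ i).map_eq x hi, (hφ j).map_eq x hj]
    refine (h'.eq_or_eq_deckInvolution h1).imp (fun h2 y hy => ?_) (fun h2 y hy => ?_)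
    · rcases h.eq_or_eq_deckInvolution hy with rfl | rfl
      · exact h2
      · rw [(hφ i).map_deck x hi, (hφ j).map_deck x hj, h2]
    · rcases h.eq_or_eq_deckInvolution hy with rfl | rfl
      · exact h2
      · rw [(hφ i).map_deck x hi, (hφ j).map_deck x hj, h2]
  have hexcl : ∀ i j t, t ∈ B j → t ∉ S → agree i j t →
      (∀ x, κ x = t → φ i x = deckInvolution κ' (φ j x)) → False := by
    intro i j t hj ht h1 h2
    obtain ⟨x, rfl⟩ := h.surjective t
    refine h'.deckInvolution_ne ?_ ((h2 x rfl).symm.trans (h1 x rfl))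
    rwa [(hφ j).map_eq x hj]
  have hram : ∀ i j t, t ∈ B i → t ∈ B j → t ∈ S → agree i j t := by
    rintro i j t hi hj ht
    rw [← hBS i t hi ht, ← hBS j t hj ht]
    exact fun x _ => rfl
  -- away from the branch points, agreement of two local isomorphisms is locally constant
  have hconst : ∀ i j t, t ∈ B i → t ∈ B j → t ∉ S → ∀ᶠ u in 𝓝 t, agree i j u ↔ agree i j t := by
    intro i j t hi hj ht
    obtain ⟨x, rfl⟩ := h.surjective t
    have hN : κ ⁻¹' (B i ∩ B j ∩ Sᶜ) ∈ 𝓝 x :=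
      ((((hBo i).inter (hBo j)).inter hS.isClosed.isOpen_compl).preimage h.continuous).mem_nhds
        ⟨⟨hi, hj⟩, ht⟩
    have hci : ContinuousAt (φ i) x :=
      (hφ i).continuousOn.continuousAt (Filter.mem_of_superset hN fun y hy => hy.1.1)
    have hcj : ContinuousAt (φ j) x :=
      (hφ j).continuousOn.continuousAt (Filter.mem_of_superset hN fun y hy => hy.1.2)
    have hcj' : ContinuousAt (fun y => deckInvolution κ' (φ j y)) x :=
      (h'.continuous_deckInvolution hS.isClosed).continuousAt.comp hcj
    rw [← h.isLocalHomeomorphOn.map_nhds_eq (show x ∈ κ ⁻¹' Sᶜ from ht), Filter.eventually_map]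
    rcases hdich i j (κ x) hi hj with h1 | h1
    · have hne : φ i x ≠ deckInvolution κ' (φ j x) := by
        rw [h1 x rfl]
        exact (h'.deckInvolution_ne (by rwa [(hφ j).map_eq x hj])).symm
      filter_upwards [hN, (hci.ne_iff_eventually_ne hcj').1 hne] with y hy hy'
      exact iff_of_true ((hdich i j _ hy.1.1 hy.1.2).resolve_right fun h2 => hy' (h2 y rfl)) h1
    · have hne : φ i x ≠ φ j x := by
        rw [h1 x rfl]
        exact h'.deckInvolution_ne (by rwa [(hφ j).map_eq x hj])
      filter_upwards [hN, (hci.ne_iff_eventually_ne hcj).1 hne] with y hy hy'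
      exact iff_of_false (fun h2 => hy' (h2 y rfl)) fun h2 => hexcl i j _ hj ht h2 h1
  obtain ⟨Z, hZB, hZi, hZc⟩ : ∃ Z : FiberBundleCore Torus Torus Bool, Z.baseSet = B ∧
      Z.indexAt = id ∧ ∀ i j t b, Z.coordChange i j t b = if agree i j t then b else !b :=
    ⟨{baseSet := B
      isOpen_baseSet := hBo
      indexAt := id
      mem_baseSet_at := hB
      coordChange := fun i j t b => if agree i j t then b else !b
      coordChange_self := fun i t _ b => if_pos fun _ _ => rfl
      continuousOn_coordChange := by
        rintro i j ⟨t, b⟩ ⟨⟨hi, hj⟩, -⟩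
        refine ContinuousAt.continuousWithinAt ?_
        have hconst' : ∀ᶠ u in 𝓝 t, agree i j u ↔ agree i j t := by
          by_cases ht : t ∈ S
          · have h1 := hram i j t hi hj ht
            obtain rfl : i = j := by rw [← hBS i t hi ht, ← hBS j t hj ht]
            exact Filter.Eventually.of_forall fun u => iff_of_true (fun _ _ => rfl) h1
          · exact hconst i j t hi hj ht
        have h2 : ContinuousAt (fun q : Torus × Bool => if agree i j t then q.2 else !q.2) (t, b) :=
          (continuous_of_discreteTopology (f := fun b : Bool => if agree i j t then b else !b)).comp
            continuous_snd |>.continuousAt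
        refine h2.congr ?_
        filter_upwards [continuousAt_fst.eventually hconst'] with q hq
        simp only [hq]
      coordChange_comp := by
        rintro i j k t ⟨⟨hi, hj⟩, hk⟩ b
        have h3 : agree i j t → agree j k t → agree i k t := fun h1 h2 x hx =>
          (h1 x hx).trans (h2 x hx)
        have h4 : agree i j t → agree i k t → agree j k t := fun h1 h2 x hx =>
          (h1 x hx).symm.trans (h2 x hx)
        have h5 : agree j k t → agree i k t → agree i j t := fun h1 h2 x hx =>
          (h2 x hx).trans (h1 x hx).symm
        have h6 : ¬ agree i j t → ¬ agree j k t → agree i k t := fun h1 h2 x hx => by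
          rw [(hdich i j t hi hj).resolve_left h1 x hx, (hdich j k t hj hk).resolve_left h2 x hx,
            h'.deckInvolution_deckInvolution]
        by_cases h1 : agree i j t <;> by_cases h2 : agree j k t <;>
          by_cases h7 : agree i k t <;> simp [h1, h2, h7] <;> tauto}, rfl, rfl, fun _ _ _ _ => rfl⟩
  have hcov : IsCoveringMap Z.proj := FiberBundle.isCoveringMap
  obtain ⟨ℓ, ⟨-, hℓ⟩, -⟩ := hcov.existsUnique_continuousMap_lifts
    (⟨toTorus, continuous_toTorus⟩ : C(Fin 2 → ℝ, Torus)) 0 ⟨toTorus 0, true⟩ rfl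
  have hproj : ∀ v, (ℓ v).proj = toTorus v := fun v => congrFun hℓ v
  -- the section in its own coordinate and in the trivialization with index `i`
  obtain ⟨β, γ, hβγ, hγ⟩ : ∃ (β : (Fin 2 → ℝ) → Bool) (γ : Torus → (Fin 2 → ℝ) → Bool),
      (∀ i v, γ i v = if agree (toTorus v) i (toTorus v) then β v else !(β v)) ∧
      ∀ v, ∀ᶠ w in 𝓝 v, γ (toTorus v) w = γ (toTorus v) v := by
    refine ⟨fun v => (ℓ v).2, fun i v => (Z.localTriv i (ℓ v)).2, fun i v => ?_, fun v => ?_⟩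
    · refine (hZc (Z.indexAt (ℓ v).proj) i (ℓ v).proj (ℓ v).2).trans ?_
      simp only [hZi, hproj, id]
    · have hsrc : ℓ v ∈ (Z.localTriv (toTorus v)).source := by
        rw [Z.mem_localTriv_source, ← Z.baseSet_at, hZB, hproj]
        exact hB _
      have hcont : ContinuousAt (fun w => (Z.localTriv (toTorus v) (ℓ w)).2) v :=
        (((Z.localTriv (toTorus v)).continuousOn.continuousAt
          ((Z.localTriv (toTorus v)).open_source.mem_nhds hsrc)).comp ℓ.continuous.continuousAt).snd
      exact hcont ((isOpen_discrete _).mem_nhds (Set.mem_singleton _))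
  let act (b : Bool) (y : X') : X' := if b then y else deckInvolution κ' y
  have hact : ∀ b y, κ' (act b y) = κ' y := by
    intro b y
    cases b <;> simp [act, map_deckInvolution]
  have hindep : ∀ i v x, κ x = toTorus v → toTorus v ∈ B i →
      act (β v) (φ (toTorus v) x) = act (γ i v) (φ i x) := by
    intro i v x hx hi
    rw [hβγ]
    rcases hdich (toTorus v) i (toTorus v) (hB _) hi with h2 | h2
    · rw [if_pos h2, h2 x hx]
    · by_cases h3 : agree (toTorus v) i (toTorus v)
      · rw [if_pos h3, h3 x hx]
      · rw [if_neg h3, h2 x hx]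
        cases β v <;> simp [act, h'.deckInvolution_deckInvolution]
  refine ⟨fun v x => act (β v) (φ (toTorus v) x), ?_, fun v x hx => ?_, fun v x hx => ?_⟩
  · rintro ⟨v, x⟩ (hx : κ x = toTorus v)
    set i := toTorus v
    have hBv : ∀ᶠ w in 𝓝 v, toTorus w ∈ B i :=
      continuous_toTorus.continuousAt.eventually ((hBo i).mem_nhds (hB _))
    have hφx : ContinuousAt (φ i) x := (hφ i).continuousOn.continuousAt
      (((hBo i).preimage h.continuous).mem_nhds (by rw [Set.mem_preimage, hx]; exact hB _))
    have hactc : Continuous (act (γ i v)) := by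
      cases γ i v
      · simpa [act] using h'.continuous_deckInvolution hS.isClosed
      · simpa [act] using continuous_id'
    have hmain : ContinuousAt (fun q : (Fin 2 → ℝ) × X => act (γ i v) (φ i q.2)) (v, x) :=
      hactc.continuousAt.comp (ContinuousAt.comp (f := Prod.snd) hφx continuousAt_snd)
    refine hmain.continuousWithinAt.congr_of_eventuallyEq ?_ ?_
    · filter_upwards [self_mem_nhdsWithin,
        mem_nhdsWithin_of_mem_nhds (continuousAt_fst.eventually (hγ v)),
        mem_nhdsWithin_of_mem_nhds (continuousAt_fst.eventually hBv)] with q hq1 hq2 hq3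
      rw [hindep i q.1 q.2 hq1 hq3, hq2]
    · exact hindep i v x hx (hB _)
  · rw [hact, (hφ _).map_eq x (hx ▸ hB _)]
  · rw [(hφ _).map_deck x (hx ▸ hB _)]
    cases β v <;> simp [act]

end LiftFamily

/-! ### The rotation of the torus and its lift -/

theorem torusRotation_toTorus (v : Fin 2 → ℝ) :
    torusRotation (toTorus v) = toTorus ![-v 1, v 0] := by
  funext i
  fin_cases i <;> simp [torusRotation, toTorus]

theorem torusRotation_torusRotation (t : Torus) : torusRotation (torusRotation t) = -t := by
  funext i
  fin_cases i <;> simp [torusRotation]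

theorem torusRotation_neg (t : Torus) : torusRotation (-t) = -torusRotation t := by
  funext i
  fin_cases i <;> simp [torusRotation]

theorem finite_rotationOrbit (P : Torus) : (rotationOrbit P).Finite := by
  unfold rotationOrbit
  exact Set.toFinite _

theorem mem_rotationOrbit_iff {P t : Torus} : t ∈ rotationOrbit P ↔
    t = P ∨ t = torusRotation P ∨ t = -P ∨ t = -torusRotation P := by
  simp [rotationOrbit, torusRotation_torusRotation, torusRotation_neg]

theorem rotationOrbit_torusRotation (P : Torus) :
    rotationOrbit (torusRotation P) = rotationOrbit P := by
  ext t
  simp only [mem_rotationOrbit_iff, torusRotation_torusRotation, neg_neg]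
  tauto

/-- The centre of the unit square is, besides the origin, the only fixed point of the rotation. -/
theorem eq_zero_or_eq_center_of_torusRotation_eq {t : Torus} (ht : torusRotation t = t) :
    t = 0 ∨ t = toTorus ![1 / 2, 1 / 2] := by
  obtain ⟨v, rfl⟩ := toTorus_surjective t
  rw [torusRotation_toTorus, toTorus_eq_iff] at ht
  obtain ⟨m, hm⟩ := ht 0
  obtain ⟨k, hk⟩ := ht 1
  simp only [Matrix.cons_val_zero, Matrix.cons_val_one] at hm hk
  rcases Int.even_or_odd' (m + k) with ⟨j, hj | hj⟩
  · have hj' : (m : ℝ) + k = 2 * j := by exact_mod_cast hj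
    refine .inl (toTorus_eq_zero_iff.2 fun i => ?_)
    fin_cases i
    · exact ⟨k - j, by push_cast; linarith⟩
    · exact ⟨-j, by push_cast; linarith⟩
  · have hj' : (m : ℝ) + k = 2 * j + 1 := by exact_mod_cast hj
    refine .inr (toTorus_eq_iff.2 fun i => ?_)
    fin_cases i
    · exact ⟨k - j - 1, by push_cast; simp; linarith⟩
    · exact ⟨-j - 1, by push_cast; simp; linarith⟩

section Rotation

variable {X : Type*} [TopologicalSpace X] {κ : X → Torus} {S : Set Torus}

/-- If the lift of the rotation has four fixed points, it fixes all points over the two fixed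
points of the rotation. -/
theorem rotationLift_eq_self (h : IsDoubleCoverRamifiedOver κ S) (h0 : (0 : Torus) ∉ S)
    (he : toTorus ![1 / 2, 1 / 2] ∉ S) {c : X → X} (hc : ∀ x, κ (c x) = torusRotation (κ x))
    (hfix : (Function.fixedPoints c).ncard = 4) {x : X}
    (hx : κ x = 0 ∨ κ x = toTorus ![1 / 2, 1 / 2]) : c x = x := by
  have hne : toTorus ![1 / 2, 1 / 2] ≠ 0 := by
    rw [Ne, toTorus_eq_zero_iff]
    intro hcon
    obtain ⟨m, hm⟩ := hcon 0
    simp only [Matrix.cons_val_zero] at hm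
    have : (1 : ℝ) = ((2 * m : ℤ) : ℝ) := by push_cast; linarith
    have : (1 : ℤ) = 2 * m := by exact_mod_cast this
    omega
  have hfin0 : (κ ⁻¹' {0}).Finite :=
    Set.finite_of_ncard_ne_zero (by rw [h.ncard_fiber_of_notMem _ h0]; norm_num)
  have hfine : (κ ⁻¹' {toTorus ![1 / 2, 1 / 2]}).Finite :=
    Set.finite_of_ncard_ne_zero (by rw [h.ncard_fiber_of_notMem _ he]; norm_num)
  have hsub : Function.fixedPoints c ⊆ κ ⁻¹' {0} ∪ κ ⁻¹' {toTorus ![1 / 2, 1 / 2]} := by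
    intro y hy
    refine eq_zero_or_eq_center_of_torusRotation_eq ?_
    rw [← hc, hy]
  have hcard : (κ ⁻¹' {0} ∪ κ ⁻¹' {toTorus ![1 / 2, 1 / 2]}).ncard = 4 := by
    rw [Set.ncard_union_eq ?_ hfin0 hfine, h.ncard_fiber_of_notMem _ h0,
      h.ncard_fiber_of_notMem _ he]
    rw [Set.disjoint_left]
    intro y hy hy'
    exact hne (hy'.symm.trans hy)
  have heq := Set.eq_of_subset_of_ncard_le hsub (by rw [hcard, hfix]) (hfin0.union hfine)
  exact heq.symm.subset hx

/-- A neighbourhood of the convex quadrilateral with vertices `0`, `(1 / 2, -x / 2)`,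
`(1 / 2, 1 / 2)` and `(x / 2, 1 / 2)`, where `x = p 0`. -/
def quadrilateral (p : Fin 2 → ℝ) (δ : ℝ) : Set (Fin 2 → ℝ) :=
  {v | v 0 < 1 / 2 + δ ∧ v 1 < 1 / 2 + δ ∧ -δ < v 1 + p 0 * v 0 ∧ -δ < v 0 - p 0 * v 1}

theorem isOpen_quadrilateral (p : Fin 2 → ℝ) (δ : ℝ) : IsOpen (quadrilateral p δ) := by
  have hc0 : Continuous fun v : Fin 2 → ℝ => v 0 := continuous_apply 0
  have hc1 : Continuous fun v : Fin 2 → ℝ => v 1 := continuous_apply 1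
  exact (isOpen_lt hc0 continuous_const).inter ((isOpen_lt hc1 continuous_const).inter
    ((isOpen_lt continuous_const (hc1.add (continuous_const.mul hc0))).inter
      (isOpen_lt continuous_const (hc0.sub (continuous_const.mul hc1)))))

theorem convex_quadrilateral (p : Fin 2 → ℝ) (δ : ℝ) : Convex ℝ (quadrilateral p δ) := by
  have h0 : IsLinearMap ℝ fun v : Fin 2 → ℝ => v 0 := ⟨fun _ _ => rfl, fun _ _ => rfl⟩
  have h1 : IsLinearMap ℝ fun v : Fin 2 → ℝ => v 1 := ⟨fun _ _ => rfl, fun _ _ => rfl⟩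
  have h2 : IsLinearMap ℝ fun v : Fin 2 → ℝ => v 1 + p 0 * v 0 :=
    ⟨fun v w => by simp; ring, fun a v => by simp; ring⟩
  have h3 : IsLinearMap ℝ fun v : Fin 2 → ℝ => v 0 - p 0 * v 1 :=
    ⟨fun v w => by simp; ring, fun a v => by simp; ring⟩
  exact (convex_halfSpace_lt h0 _).inter ((convex_halfSpace_lt h1 _).inter
    ((convex_halfSpace_gt h2 _).inter (convex_halfSpace_gt h3 _)))

/-- A neighbourhood of the quadrilateral contains a single point over the rotation orbit of a
point `p` in the first quadrant of the fundamental square. -/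
theorem exists_quadrilateral {p : Fin 2 → ℝ} (hp0 : 0 < p 0) (hp0' : p 0 < 1 / 2) (hp1 : 0 ≤ p 1)
    (hp1' : p 1 < 1 / 2) : ∃ δ > 0, p ∈ quadrilateral p δ ∧
      ∀ v ∈ quadrilateral p δ, toTorus v ∈ rotationOrbit (toTorus p) → v = p := by
  obtain ⟨δ, hδ, hδ0, hδ1, hδ2⟩ : ∃ δ : ℝ, 0 < δ ∧ δ ≤ 1 / 2 - p 0 ∧ δ ≤ 1 / 2 - p 1 ∧
      δ ≤ p 0 ^ 2 / 2 :=
    ⟨min (min (1 / 2 - p 0) (1 / 2 - p 1)) (p 0 ^ 2 / 2),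
      lt_min (lt_min (by linarith) (by linarith)) (by positivity),
      (min_le_left _ _).trans (min_le_left _ _), (min_le_left _ _).trans (min_le_right _ _),
      min_le_right _ _⟩
  have hδ3 : δ ≤ p 0 / 4 := by nlinarith
  refine ⟨δ, hδ, ⟨by linarith, by linarith, by nlinarith, by nlinarith⟩, ?_⟩
  rintro v ⟨h1, h2, h3, h4⟩ hvS
  have hv1 : -(7 / 8) * p 0 < v 1 := by nlinarith
  have hv0 : -p 0 < v 0 := by nlinarith
  have hint : ∀ m : ℤ, (-1 : ℝ) < m → (m : ℝ) < 1 → m = 0 := fun m h5 h6 => by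
    have h7 : -1 < m := by exact_mod_cast h5
    have h8 : m < 1 := by exact_mod_cast h6
    omega
  have hint' : ∀ m : ℤ, (m : ℝ) < 1 → (m : ℝ) ≤ 0 := fun m h6 => by
    have h8 : m < 1 := by exact_mod_cast h6
    exact_mod_cast (by omega : m ≤ 0)
  rw [mem_rotationOrbit_iff, torusRotation_toTorus, ← toTorus_neg, ← toTorus_neg] at hvS
  simp only [toTorus_eq_iff, Fin.forall_fin_two] at hvS
  simp only [Pi.neg_apply, Matrix.cons_val_zero, Matrix.cons_val_one, neg_neg] at hvS
  rcases hvS with ⟨⟨i, hi⟩, j, hj⟩ | ⟨⟨i, hi⟩, j, hj⟩ | ⟨⟨i, hi⟩, j, hj⟩ | ⟨⟨i, hi⟩, j, hj⟩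
  · have hi0 := hint i (by linarith) (by linarith)
    have hj0 := hint j (by linarith) (by linarith)
    subst hi0 hj0
    funext k
    fin_cases k
    · simpa using hi
    · simpa using hj
  · have hi0 := hint' i (by linarith)
    have hj0 := hint j (by linarith) (by linarith)
    subst hj0
    exfalso
    simp only [Int.cast_zero, add_zero] at hj
    nlinarith
  · have hi0 := hint' i (by linarith)
    linarith
  · have hj0 := hint' j (by linarith)
    linarith

/-- A bijective lift of a map preserving the branch points commutes with the deck involution. -/
theorem deckInvolution_comm (h : IsDoubleCoverRamifiedOver κ S) {c : X → X}
    (hinj : Function.Injective c) {g : Torus → Torus} (hc : ∀ x, κ (c x) = g (κ x))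
    (hg : ∀ t, g t ∈ S ↔ t ∈ S) (x : X) : c (deckInvolution κ x) = deckInvolution κ (c x) := by
  by_cases hx : κ x ∈ S
  · rw [h.deckInvolution_eq hx, h.deckInvolution_eq (by rwa [hc, hg])]
  · refine h.eq_deckInvolution (by rw [hc, hc, map_deckInvolution κ]) fun heq => ?_
    exact h.deckInvolution_ne hx (hinj heq)

variable [T2Space X] [CompactSpace X] [ChartedSpace (EuclideanSpace ℝ (Fin 2)) X]

/-- The square of the lift of the rotation exchanges the two points over `(1 / 2, 0)`.
The reason is the monodromy along the boundary of a quadrilateral with vertices `0`,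
`(1 / 2, -ε)`, `(1 / 2, 1 / 2)`, `(ε, 1 / 2)`, which contains exactly one branch point `p`: the
rotation about `0` maps the first side to the last one, the rotation about `(1 / 2, 1 / 2)` maps
the third side into the second one, and the half-turn about `(1 / 2, 0)` maps the segment between
`(1 / 2, -ε)` and `(1 / 2, ε)` to itself. If the half-turn fixed the points over `(1 / 2, 0)`,
the boundary would lift to a closed path. -/
theorem rotationLift_rotationLift_eq_deckInvolution {p : Fin 2 → ℝ} (hp0 : 0 < p 0)
    (hp0' : p 0 < 1 / 2) (hp1 : 0 ≤ p 1) (hp1' : p 1 < 1 / 2)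
    (h : IsDoubleCoverRamifiedOver κ (rotationOrbit (toTorus p))) {c : X → X} (hcc : Continuous c)
    (hcσ : ∀ x, c (deckInvolution κ x) = deckInvolution κ (c x))
    (hc : ∀ x, κ (c x) = torusRotation (κ x)) (hfix0 : ∀ x, κ x = 0 → c x = x)
    (hfixe : ∀ x, κ x = toTorus ![1 / 2, 1 / 2] → c x = x) {x : X}
    (hx : κ x = toTorus ![1 / 2, 0]) : c (c x) = deckInvolution κ x := by
  have hS := finite_rotationOrbit (toTorus p)
  obtain ⟨δ, hδ, hpΩ, hΩS⟩ := exists_quadrilateral hp0 hp0' hp1 hp1'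
  have hpS : toTorus p ∈ rotationOrbit (toTorus p) := mem_rotationOrbit_iff.2 (.inl rfl)
  obtain ⟨a, b, hac, haκ, hbc, hbκ, hup, hdn⟩ := h.exists_slit_sections hS
    (isOpen_quadrilateral p δ) (convex_quadrilateral p δ) hpΩ hpS hΩS
  set Ω := quadrilateral p δ
  have hσ := h.continuous_deckInvolution hS.isClosed
  have hmem : ∀ s t : ℝ, s < 1 / 2 + δ → t < 1 / 2 + δ → -δ < t + p 0 * s → -δ < s - p 0 * t →
      ![s, t] ∈ Ω := fun s t h1 h2 h3 h4 => ⟨h1, h2, h3, h4⟩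
  -- first and last side
  have h1 : ∀ t ∈ Set.Icc (0 : ℝ) 1, c (b ![t / 2, -(t * p 0 / 2)]) = b ![t * p 0 / 2, t / 2] := by
    have hA : ∀ t ∈ Set.Icc (0 : ℝ) 1, ![t / 2, -(t * p 0 / 2)] ∈ Ω ∧
        ¬ (-(t * p 0 / 2) = p 1 ∧ p 0 ≤ t / 2) := by
      rintro t ⟨ht0, ht1⟩
      refine ⟨hmem _ _ (by linarith) (by nlinarith) (by nlinarith)
        (by nlinarith [sq_nonneg (p 0), mul_nonneg ht0 (sq_nonneg (p 0))]), ?_⟩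
      rintro ⟨h2, h3⟩
      nlinarith
    have hB : ∀ t ∈ Set.Icc (0 : ℝ) 1, ![t * p 0 / 2, t / 2] ∈ Ω ∧
        ¬ (t / 2 = p 1 ∧ p 0 ≤ t * p 0 / 2) := by
      rintro t ⟨ht0, ht1⟩
      refine ⟨hmem _ _ (by nlinarith) (by linarith)
        (by nlinarith [mul_nonneg ht0 (sq_nonneg (p 0))]) (by nlinarith), ?_⟩
      rintro ⟨h2, h3⟩
      nlinarith
    refine h.eqOn_of_eq hS.isClosed isPreconnected_Icc (f := fun t => c (b ![t / 2, -(t * p 0 / 2)]))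
      (g := fun t => b ![t * p 0 / 2, t / 2]) ?_ ?_ ?_ ?_ (Set.left_mem_Icc.2 zero_le_one) ?_
    · exact hcc.comp_continuousOn (hbc.comp (by fun_prop) hA)
    · exact hbc.comp (by fun_prop) hB
    · intro t ht
      rw [hc, hbκ _ (hA t ht).1 (hA t ht).2, hbκ _ (hB t ht).1 (hB t ht).2, torusRotation_toTorus]
      simp
    · intro t ht hcon
      rw [hbκ _ (hB t ht).1 (hB t ht).2] at hcon
      have h2 := hΩS _ (hB t ht).1 hcon
      exact (hB t ht).2 ⟨congrFun h2 1, (congrFun h2 0).ge⟩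
    · have h0 : (![0, 0] : Fin 2 → ℝ) = 0 := by funext i; fin_cases i <;> rfl
      have h2 := hB 0 (Set.left_mem_Icc.2 zero_le_one)
      simp only [zero_mul, zero_div, neg_zero] at h2 ⊢
      refine hfix0 _ ?_
      rw [hbκ _ h2.1 h2.2, h0, toTorus_zero]
  -- second and third side
  have h2 : ∀ s ∈ Set.Icc (0 : ℝ) (1 / 2 - p 0 / 2), deckInvolution κ (a ![1 / 2, 1 / 2 - s])
      = c (deckInvolution κ (b ![1 / 2 - s, 1 / 2])) := by
    have hA : ∀ s ∈ Set.Icc (0 : ℝ) (1 / 2 - p 0 / 2), ![1 / 2, 1 / 2 - s] ∈ Ω ∧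
        ¬ (1 / 2 - s = p 1 ∧ 1 / 2 ≤ p 0) := by
      rintro s ⟨hs0, hs1⟩
      exact ⟨hmem _ _ (by linarith) (by linarith) (by nlinarith) (by nlinarith), fun h2 => by
        linarith [h2.2]⟩
    have hB : ∀ s ∈ Set.Icc (0 : ℝ) (1 / 2 - p 0 / 2), ![1 / 2 - s, 1 / 2] ∈ Ω ∧
        ¬ (1 / 2 = p 1 ∧ p 0 ≤ 1 / 2 - s) := by
      rintro s ⟨hs0, hs1⟩
      exact ⟨hmem _ _ (by linarith) (by linarith) (by nlinarith) (by nlinarith), fun h2 => by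
        linarith [h2.1]⟩
    have h0 : (0 : ℝ) ∈ Set.Icc (0 : ℝ) (1 / 2 - p 0 / 2) := Set.left_mem_Icc.2 (by linarith)
    refine h.eqOn_of_eq hS.isClosed isPreconnected_Icc
      (f := fun s => deckInvolution κ (a ![1 / 2, 1 / 2 - s]))
      (g := fun s => c (deckInvolution κ (b ![1 / 2 - s, 1 / 2]))) ?_ ?_ ?_ ?_ h0 ?_
    · exact hσ.comp_continuousOn (hac.comp (by fun_prop) hA)
    · exact (hcc.comp hσ).comp_continuousOn (hbc.comp (by fun_prop) hB)
    · intro s hs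
      rw [hc, map_deckInvolution κ, map_deckInvolution κ, hbκ _ (hB s hs).1 (hB s hs).2,
        haκ _ (hA s hs).1 (hA s hs).2, torusRotation_toTorus, toTorus_eq_iff]
      intro i
      fin_cases i
      · exact ⟨1, by simp; norm_num⟩
      · exact ⟨0, by simp⟩
    · intro s hs hcon
      have h3 : κ (c (deckInvolution κ (b ![1 / 2 - s, 1 / 2]))) = toTorus ![1 / 2, 1 / 2 - s] := by
        rw [hc, map_deckInvolution κ, hbκ _ (hB s hs).1 (hB s hs).2, torusRotation_toTorus,
          toTorus_eq_iff]
        intro i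
        fin_cases i
        · exact ⟨-1, by simp; norm_num⟩
        · exact ⟨0, by simp⟩
      rw [h3] at hcon
      have h2 := hΩS _ (hA s hs).1 hcon
      exact (hA s hs).2 ⟨congrFun h2 1, (congrFun h2 0).le⟩
    · have h3 := hB 0 h0
      simp only [sub_zero] at h3 ⊢
      rw [hup _ h3.1 (by simpa using hp1'), hfixe]
      rw [map_deckInvolution κ, hbκ _ h3.1 h3.2]
  -- the half-turn about `(1 / 2, 0)`
  have hA : ∀ s ∈ Set.Icc (-(p 0 / 2)) (p 0 / 2), ![1 / 2, s] ∈ Ω ∧ ¬ (s = p 1 ∧ 1 / 2 ≤ p 0) := by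
    rintro s ⟨hs0, hs1⟩
    exact ⟨hmem _ _ (by linarith) (by linarith) (by linarith) (by nlinarith), fun h2 => by
      linarith [h2.2]⟩
  have hneg : ∀ s ∈ Set.Icc (-(p 0 / 2)) (p 0 / 2), -s ∈ Set.Icc (-(p 0 / 2)) (p 0 / 2) :=
    fun s hs => ⟨by linarith [hs.2], by linarith [hs.1]⟩
  have hAκ : ∀ s ∈ Set.Icc (-(p 0 / 2)) (p 0 / 2), κ (a ![1 / 2, s]) = toTorus ![1 / 2, s] :=
    fun s hs => haκ _ (hA s hs).1 (hA s hs).2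
  have hAS : ∀ s ∈ Set.Icc (-(p 0 / 2)) (p 0 / 2),
      toTorus ![1 / 2, s] ∉ rotationOrbit (toTorus p) := fun s hs hcon => by
    have h2 := hΩS _ (hA s hs).1 hcon
    exact (hA s hs).2 ⟨congrFun h2 1, (congrFun h2 0).le⟩
  have hcard : ∀ s ∈ Set.Icc (-(p 0 / 2)) (p 0 / 2), κ (c (c (a ![1 / 2, s])))
      = toTorus ![1 / 2, -s] := fun s hs => by
    rw [hc, hc, hAκ s hs, torusRotation_torusRotation, ← toTorus_neg, toTorus_eq_iff]
    intro i
    fin_cases i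
    · exact ⟨-1, by simp; norm_num⟩
    · exact ⟨0, by simp⟩
  have hz : (0 : ℝ) ∈ Set.Icc (-(p 0 / 2)) (p 0 / 2) := ⟨by linarith, by linarith⟩
  have hzS := hAS 0 hz
  have hy : c (c (a ![1 / 2, 0])) ≠ a ![1 / 2, 0] := by
    intro hcon
    have h3 := h.eqOn_of_eq hS.isClosed isPreconnected_Icc
      (f := fun s => c (c (a ![1 / 2, s]))) (g := fun s => a ![1 / 2, -s])
      ((hcc.comp hcc).comp_continuousOn (hac.comp (by fun_prop) hA))
      (hac.comp (by fun_prop) fun s hs => hA _ (hneg s hs))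
      (fun s hs => by rw [hcard s hs, hAκ _ (hneg s hs)])
      (fun s hs => by rw [hAκ _ (hneg s hs)]; exact hAS _ (hneg s hs)) hz (by simpa using hcon)
      (-(p 0 / 2)) ⟨le_rfl, by linarith⟩
    have h4 := h1 1 (Set.right_mem_Icc.2 zero_le_one)
    have h5 := h2 (1 / 2 - p 0 / 2) (Set.right_mem_Icc.2 (by linarith))
    have hl : -(p 0 / 2) ∈ Set.Icc (-(p 0 / 2)) (p 0 / 2) := ⟨le_rfl, by linarith⟩
    have h6 := hdn ![1 / 2, -(p 0 / 2)] (hA _ hl).1 (by simp; linarith)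
    have h7 := hcard _ hl
    simp only [one_mul, neg_neg, sub_sub_cancel] at h3 h4 h5 h6 h7
    rw [← h4, hcσ, h3.symm, h6] at h5
    rw [h6] at h7
    simp only [hcσ, h.deckInvolution_deckInvolution] at h5 h7
    refine h.deckInvolution_ne ?_ h5.symm
    rw [map_deckInvolution κ] at h7
    rw [h7]
    simpa using hAS _ (hneg _ hl)
  have hy' : c (c (a ![1 / 2, 0])) = deckInvolution κ (a ![1 / 2, 0]) := by
    refine h.eq_deckInvolution ?_ hy
    rw [hcard 0 hz, hAκ 0 hz, neg_zero]
  rcases h.eq_or_eq_deckInvolution (hx.trans (hAκ 0 hz).symm) with rfl | rfl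
  · exact hy'
  · rw [hcσ, hcσ, hy']

end Rotation

/-! ### Integral matrices acting on the torus -/

/-- The endomorphism of the torus given by an integral matrix. -/
def matrixAction (A : Matrix (Fin 2) (Fin 2) ℤ) (t : Torus) : Torus :=
  fun i => A i 0 • t 0 + A i 1 • t 1

theorem matrixAction_toTorus (A : Matrix (Fin 2) (Fin 2) ℤ) (v : Fin 2 → ℝ) :
    matrixAction A (toTorus v) = toTorus (A.map (Int.cast : ℤ → ℝ) *ᵥ v) := by
  funext i
  simp [matrixAction, toTorus, Matrix.mulVec, dotProduct, Fin.sum_univ_two, ← zsmul_eq_mul]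

theorem matrixAction_add (A : Matrix (Fin 2) (Fin 2) ℤ) (s t : Torus) :
    matrixAction A (s + t) = matrixAction A s + matrixAction A t := by
  funext i
  simp only [matrixAction, Pi.add_apply, smul_add]
  abel

theorem matrixAction_neg (A : Matrix (Fin 2) (Fin 2) ℤ) (t : Torus) :
    matrixAction A (-t) = -matrixAction A t := by
  funext i
  simp only [matrixAction, Pi.neg_apply, smul_neg]
  abel

theorem matrixAction_zero (A : Matrix (Fin 2) (Fin 2) ℤ) : matrixAction A 0 = 0 := by
  funext i
  simp [matrixAction]

theorem matrixAction_nsmul (A : Matrix (Fin 2) (Fin 2) ℤ) (n : ℕ) (t : Torus) :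
    matrixAction A (n • t) = n • matrixAction A t := by
  funext i
  simp only [matrixAction, Pi.smul_apply, smul_add]
  rw [smul_comm, smul_comm (A i 1)]

theorem matrixAction_mul (A B : Matrix (Fin 2) (Fin 2) ℤ) (t : Torus) :
    matrixAction (A * B) t = matrixAction A (matrixAction B t) := by
  obtain ⟨v, rfl⟩ := toTorus_surjective t
  rw [matrixAction_toTorus, matrixAction_toTorus, matrixAction_toTorus, Matrix.mulVec_mulVec]
  congr 2
  ext i j
  simp [Matrix.mul_apply]

theorem matrixAction_one (t : Torus) : matrixAction 1 t = t := by
  funext i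
  fin_cases i <;> simp [matrixAction, Matrix.one_apply]

theorem continuous_matrixAction (A : Matrix (Fin 2) (Fin 2) ℤ) : Continuous (matrixAction A) := by
  unfold matrixAction
  fun_prop

/-- The automorphism of the torus given by an integral matrix of determinant one. -/
def torusHomeomorph (A : Matrix.SpecialLinearGroup (Fin 2) ℤ) : Torus ≃ₜ Torus where
  toFun := matrixAction A
  invFun := matrixAction (A⁻¹ : Matrix.SpecialLinearGroup (Fin 2) ℤ)
  left_inv t := by
    rw [← matrixAction_mul, ← Matrix.SpecialLinearGroup.coe_mul, inv_mul_cancel,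
      Matrix.SpecialLinearGroup.coe_one, matrixAction_one]
  right_inv t := by
    rw [← matrixAction_mul, ← Matrix.SpecialLinearGroup.coe_mul, mul_inv_cancel,
      Matrix.SpecialLinearGroup.coe_one, matrixAction_one]
  continuous_toFun := continuous_matrixAction _
  continuous_invFun := continuous_matrixAction _

theorem torusHomeomorph_apply (A : Matrix.SpecialLinearGroup (Fin 2) ℤ) (t : Torus) :
    torusHomeomorph A t = matrixAction A t := rfl

theorem nsmul_toTorus (n : ℕ) (v : Fin 2 → ℝ) : n • toTorus v = toTorus ((n : ℝ) • v) := by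
  funext i
  simp [toTorus, ← nsmul_eq_mul]

theorem toTorus_int_half_eq_zero_iff {i j : ℤ} :
    toTorus ![(i : ℝ) / 2, (j : ℝ) / 2] = 0 ↔ Even i ∧ Even j := by
  rw [toTorus_eq_zero_iff, Fin.forall_fin_two]
  have key : ∀ i : ℤ, (∃ m : ℤ, (i : ℝ) / 2 = m) ↔ Even i := fun i => by
    rw [even_iff_exists_two_mul]
    refine exists_congr fun m => ?_
    rw [div_eq_iff two_ne_zero, mul_comm]
    exact_mod_cast Iff.rfl
  simpa using and_congr (key i) (key j)

theorem toTorus_int_half_eq_iff {i j k l : ℤ} :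
    toTorus ![(i : ℝ) / 2, (j : ℝ) / 2] = toTorus ![(k : ℝ) / 2, (l : ℝ) / 2] ↔
      Even (i - k) ∧ Even (j - l) := by
  rw [← sub_eq_zero, ← toTorus_sub, ← toTorus_int_half_eq_zero_iff]
  congr! 2
  funext m
  fin_cases m <;> simp <;> ring

theorem matrixAction_int_half (A : Matrix (Fin 2) (Fin 2) ℤ) (i j : ℤ) :
    matrixAction A (toTorus ![(i : ℝ) / 2, (j : ℝ) / 2]) =
      toTorus ![((A 0 0 * i + A 0 1 * j : ℤ) : ℝ) / 2, ((A 1 0 * i + A 1 1 * j : ℤ) : ℝ) / 2] := by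
  rw [matrixAction_toTorus]
  congr 1
  funext m
  fin_cases m <;> simp [Matrix.mulVec, dotProduct, Fin.sum_univ_two] <;> ring

theorem nsmul_int_half (n : ℕ) (i j : ℤ) : n • toTorus ![(i : ℝ) / 2, (j : ℝ) / 2] =
    toTorus ![((n * i : ℤ) : ℝ) / 2, ((n * j : ℤ) : ℝ) / 2] := by
  rw [nsmul_toTorus]
  congr 1
  funext m
  fin_cases m <;> simp <;> ring

/-! ### Lifting an automorphism of the torus to the surface -/

theorem IsDoubleCoverRamifiedOver.deckInvolution_homeomorph_comp {X : Type*}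
    [TopologicalSpace X] {κ : X → Torus} {S : Set Torus}
    (h : IsDoubleCoverRamifiedOver κ S) (M : Torus ≃ₜ Torus) (hM : ∀ t, M t ∈ S ↔ t ∈ S) :
    deckInvolution (M ∘ κ) = deckInvolution κ := by
  have h' := h.homeomorph_comp M hM
  funext x
  by_cases hx : κ x ∈ S
  · rw [h.deckInvolution_eq hx, h'.deckInvolution_eq ((hM _).2 hx)]
  · refine (h'.eq_deckInvolution ?_ (h.deckInvolution_ne hx)).symm
    rw [Function.comp, map_deckInvolution κ, Function.comp]

/-- A morphism of double coverings over the plane that is invariant under two generators of the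
lattice descends to the surfaces. -/
theorem IsLiftFamily.exists_continuous {X X' : Type*} [TopologicalSpace X]
    [TopologicalSpace X'] {κ : X → Torus} {κ' : X' → Torus} {S : Set Torus}
    (h : IsDoubleCoverRamifiedOver κ S) {Φ : (Fin 2 → ℝ) → X → X'} (hΦ : IsLiftFamily κ κ' Φ)
    (h0 : ∀ v x, κ x = toTorus v → Φ (v + ![1, 0]) x = Φ v x)
    (h1 : ∀ v x, κ x = toTorus v → Φ (v + ![0, 1]) x = Φ v x) :
    ∃ f : X → X', Continuous f ∧ (∀ x, κ' (f x) = κ x) ∧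
      ∀ x, f (deckInvolution κ x) = deckInvolution κ' (f x) := by
  have hper : ∀ w : Fin 2 → ℝ, toTorus w = 0 →
      (∀ v x, κ x = toTorus v → Φ (v + w) x = Φ v x) → ∀ m : ℤ, ∀ v x, κ x = toTorus v →
      Φ (v + (m : ℝ) • w) x = Φ v x := by
    intro w hw hΦw m
    have hmw : ∀ m : ℤ, toTorus ((m : ℝ) • w) = 0 := fun m => by
      rw [toTorus_eq_zero_iff] at hw ⊢
      intro i
      obtain ⟨k, hk⟩ := hw i
      exact ⟨m * k, by simp [hk]⟩
    induction m with
    | zero => intro v x _; simp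
    | succ m ih =>
      intro v x hx
      have h2 : v + ((m + 1 : ℤ) : ℝ) • w = v + ((m : ℤ) : ℝ) • w + w := by push_cast; module
      rw [h2, hΦw _ x (by rw [toTorus_add, hmw, add_zero, hx]), ih v x hx]
    | pred m ih =>
      intro v x hx
      have h2 : v + ((-m - 1 : ℤ) : ℝ) • w + w = v + ((-m : ℤ) : ℝ) • w := by push_cast; module
      rw [← ih v x hx, ← h2, hΦw _ x (by rw [toTorus_add, hmw, add_zero, hx])]
  have e0 : toTorus ![1, 0] = 0 := toTorus_eq_zero_iff.2 fun i => by
    fin_cases i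
    · exact ⟨1, by simp⟩
    · exact ⟨0, by simp⟩
  have e1 : toTorus ![0, 1] = 0 := toTorus_eq_zero_iff.2 fun i => by
    fin_cases i
    · exact ⟨0, by simp⟩
    · exact ⟨1, by simp⟩
  have hinv : ∀ v w x, κ x = toTorus v → toTorus v = toTorus w → Φ v x = Φ w x := by
    intro v w x hx hvw
    rw [toTorus_eq_iff] at hvw
    obtain ⟨m, hm⟩ := hvw 0
    obtain ⟨k, hk⟩ := hvw 1
    have hw : v = w + (m : ℝ) • ![1, 0] + (k : ℝ) • ![0, 1] := by
      funext i
      fin_cases i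
      · simpa [Matrix.vecHead] using hm
      · simpa [Matrix.vecHead, Matrix.vecTail] using hk
    have hxw : κ x = toTorus w := by
      rw [hx]; exact toTorus_eq_iff.2 hvw
    have hm0 : toTorus ((m : ℝ) • ![1, 0]) = 0 := toTorus_eq_zero_iff.2 fun i => by
      fin_cases i
      · exact ⟨m, by simp⟩
      · exact ⟨0, by simp⟩
    rw [hw, hper _ e1 h1 k _ x (by rw [toTorus_add, hm0, add_zero, hxw]), hper _ e0 h0 m _ x hxw]
  choose ν hν using toTorus_surjective
  have hf : ∀ v x, κ x = toTorus v → Φ (ν (κ x)) x = Φ v x := fun v x hx =>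
    hinv _ _ x (hν _).symm ((hν _).trans hx)
  refine ⟨fun x => Φ (ν (κ x)) x, ?_, fun x => hΦ.map_eq _ _ (hν _).symm, fun x => ?_⟩
  · rw [continuous_iff_continuousAt]
    intro x
    obtain ⟨e, hve, he⟩ := isLocalHomeomorph_toTorus (ν (κ x))
    have het : κ x ∈ e.target := by
      have := e.map_source hve
      rwa [← he, hν] at this
    have hκe : ∀ᶠ y in 𝓝 x, κ y ∈ e.target :=
      h.continuous.continuousAt.eventually (e.open_target.mem_nhds het)
    have hsec : ∀ y, κ y ∈ e.target → κ y = toTorus (e.symm (κ y)) := fun y hy => by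
      rw [he, e.right_inv hy]
    have hg : ContinuousAt (fun y => (e.symm (κ y), y)) x :=
      ((e.continuousAt_symm het).comp h.continuous.continuousAt).prodMk continuousAt_id
    have h2 := hΦ.continuousOn (e.symm (κ x), x) (hsec x het)
    have h3 : Filter.Tendsto (fun y => (e.symm (κ y), y)) (𝓝 x)
        (𝓝[{q : (Fin 2 → ℝ) × X | κ q.2 = toTorus q.1}] (e.symm (κ x), x)) :=
      tendsto_nhdsWithin_iff.2 ⟨hg, hκe.mono fun y hy => hsec y hy⟩
    have h4 := h2.tendsto.comp h3
    rw [ContinuousAt, hf _ x (hsec x het)]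
    refine h4.congr' ?_
    filter_upwards [hκe] with y hy
    exact (hf _ y (hsec y hy)).symm
  · dsimp only
    rw [map_deckInvolution κ, hΦ.map_deck _ _ (hν _).symm]

section Lift

variable {X : Type*} [TopologicalSpace X] [T2Space X] [CompactSpace X]
  [ChartedSpace (EuclideanSpace ℝ (Fin 2)) X] {κ : X → Torus} {S : Set Torus}

/-- An automorphism of the torus lifts to the surface if it preserves the branch points and the
way in which a lift `ι` of the half-turn acts on the fibres over the points of order two. Indeed,
the isomorphism over the plane between `κ` and its pullback commutes with `ι`, and comparing the
fibres over opposite points of order two shows that it is invariant under the lattice. -/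
theorem exists_homeomorph_lift (h : IsDoubleCoverRamifiedOver κ S) (hS : S.Finite) {ι : X → X}
    (hι : Continuous ι) (hικ : ∀ x, κ (ι x) = -κ x)
    (hισ : ∀ x, ι (deckInvolution κ x) = deckInvolution κ (ι x))
    (hι0 : ∀ x, κ x = 0 → ι x = x)
    (hι1 : ∀ x, κ x = toTorus ![1 / 2, 0] → ι x = deckInvolution κ x)
    (hι2 : ∀ x, κ x = toTorus ![0, 1 / 2] → ι x = deckInvolution κ x) (h0S : (0 : Torus) ∉ S)
    (h1S : toTorus ![1 / 2, 0] ∉ S) (h2S : toTorus ![0, 1 / 2] ∉ S)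
    (A : Matrix.SpecialLinearGroup (Fin 2) ℤ) (hA : ∀ t, matrixAction A t ∈ S ↔ t ∈ S)
    (hA1 : matrixAction A (toTorus ![1 / 2, 0]) = toTorus ![1 / 2, 0] ∨
      matrixAction A (toTorus ![1 / 2, 0]) = toTorus ![0, 1 / 2])
    (hA2 : matrixAction A (toTorus ![0, 1 / 2]) = toTorus ![1 / 2, 0] ∨
      matrixAction A (toTorus ![0, 1 / 2]) = toTorus ![0, 1 / 2]) :
    ∃ f : X ≃ₜ X, ∀ x, κ (f x) = matrixAction A (κ x) := by
  set M := (torusHomeomorph A).symm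
  have hM : ∀ t, M t ∈ S ↔ t ∈ S := fun t => by
    rw [← hA, ← torusHomeomorph_apply, Homeomorph.apply_symm_apply]
  have hMA : ∀ y t, M (κ y) = t ↔ κ y = matrixAction A t := fun y t => by
    rw [Homeomorph.symm_apply_eq, torusHomeomorph_apply]
  have hMneg : ∀ t, M (-t) = -M t := fun t => matrixAction_neg _ t
  have h' := h.homeomorph_comp M hM
  have hdeck := h.deckInvolution_homeomorph_comp M hM
  obtain ⟨Φ, hΦ⟩ := exists_isLiftFamily h h' hS
  have hΦκ : ∀ v x, κ x = toTorus v → κ (Φ v x) = matrixAction A (κ x) := fun v x hx =>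
    (hMA _ _).1 (hΦ.map_eq v x hx)
  have hneg : ∀ v x, κ x = toTorus v → κ (ι x) = toTorus (-v) := fun v x hx => by
    rw [hικ, hx, toTorus_neg]
  have hΦd : ∀ v x, κ x = toTorus v →
      Φ v (deckInvolution κ x) = deckInvolution κ (Φ v x) := fun v x hx => by
    rw [hΦ.map_deck v x hx, hdeck]
  -- the isomorphism commutes with the half-turn
  have hΨ : IsLiftFamily κ (M ∘ κ) fun v x => ι (Φ (-v) (ι x)) := by
    refine ⟨?_, fun v x hx => ?_, fun v x hx => ?_⟩
    · refine hι.comp_continuousOn (hΦ.continuousOn.comp (f := fun q : (Fin 2 → ℝ) × X =>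
        (-q.1, ι q.2)) (by fun_prop) fun q hq => hneg q.1 q.2 hq)
    · have h1 := hΦ.map_eq (-v) (ι x) (hneg v x hx)
      simp only [Function.comp] at h1 ⊢
      rw [hικ, hMneg, h1, hικ, neg_neg]
    · rw [hισ, hΦd _ _ (hneg v x hx), hισ, hdeck]
  have hΦι : ∀ v x, κ x = toTorus v → Φ v x = ι (Φ (-v) (ι x)) := by
    intro v x hx
    obtain ⟨x₀, hx₀⟩ := h.surjective 0
    refine hΦ.eq_of_eq h h' hS hΨ (v₀ := 0) (x₀ := x₀) (by simpa) (by simpa) ?_ hx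
    rw [hι0 x₀ hx₀, neg_zero, hι0]
    rw [hΦκ 0 x₀ (by simpa), hx₀, matrixAction_zero]
  have hιA : ∀ x, (κ x = toTorus ![1 / 2, 0] ∨ κ x = toTorus ![0, 1 / 2]) →
      ι x = deckInvolution κ x := fun x hx => hx.elim (hι1 x) (hι2 x)
  have hhalf : ∀ v x, κ x = toTorus v → ι x = deckInvolution κ x →
      (matrixAction A (κ x) = toTorus ![1 / 2, 0] ∨ matrixAction A (κ x) = toTorus ![0, 1 / 2]) →
      κ x = toTorus (-v) → Φ v x = Φ (-v) x := by
    intro v x hx hιx hAx hx'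
    rw [hΦι v x hx, hιx, hΦd _ _ hx', hισ, hιA, h.deckInvolution_deckInvolution]
    rwa [hΦκ _ _ hx']
  have htrans : ∀ w : Fin 2 → ℝ, toTorus w = 0 → toTorus ((1 / 2 : ℝ) • w) ∉ S →
      (∀ x, κ x = toTorus ((1 / 2 : ℝ) • w) → ι x = deckInvolution κ x) →
      (matrixAction A (toTorus ((1 / 2 : ℝ) • w)) = toTorus ![1 / 2, 0] ∨
        matrixAction A (toTorus ((1 / 2 : ℝ) • w)) = toTorus ![0, 1 / 2]) →
      ∀ v x, κ x = toTorus v → Φ (v + w) x = Φ v x := by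
    intro w hw hwS hιw hAw v x hx
    have hadd : ∀ v, toTorus (v + w) = toTorus v := fun v => by rw [toTorus_add, hw, add_zero]
    have hΦw : IsLiftFamily κ (M ∘ κ) fun v x => Φ (v + w) x := by
      refine ⟨hΦ.continuousOn.comp (f := fun q : (Fin 2 → ℝ) × X => (q.1 + w, q.2))
        (by fun_prop) fun q hq => ?_, fun v x hx => hΦ.map_eq _ _ (by rw [hadd, hx]),
        fun v x hx => hΦ.map_deck _ _ (by rw [hadd, hx])⟩
      exact (show κ q.2 = toTorus q.1 from hq).trans (hadd _).symm
    have hww : -((1 / 2 : ℝ) • w) + w = (1 / 2 : ℝ) • w := by module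
    have hneg' : toTorus (-((1 / 2 : ℝ) • w)) = toTorus ((1 / 2 : ℝ) • w) := by
      rw [← hadd, hww]
    obtain ⟨x₀, hx₀⟩ := h.surjective (toTorus ((1 / 2 : ℝ) • w))
    refine hΦw.eq_of_eq h h' hS hΦ (v₀ := -((1 / 2 : ℝ) • w)) (x₀ := x₀) (by rwa [hneg'])
      (by rw [hneg', hx₀]) ?_ hx
    rw [hww]
    exact hhalf _ _ hx₀ (hιw x₀ hx₀) (by rwa [hx₀]) (by rw [hneg', hx₀])
  have hv1 : (1 / 2 : ℝ) • (![1, 0] : Fin 2 → ℝ) = ![1 / 2, 0] := by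
    funext i; fin_cases i <;> simp
  have hv2 : (1 / 2 : ℝ) • (![0, 1] : Fin 2 → ℝ) = ![0, 1 / 2] := by
    funext i; fin_cases i <;> simp
  obtain ⟨f, hf, hκf, hfd⟩ := hΦ.exists_continuous h
    (htrans _ (toTorus_eq_zero_iff.2 fun i => by
      fin_cases i
      · exact ⟨1, by simp⟩
      · exact ⟨0, by simp⟩) (by rwa [hv1]) (by rwa [hv1]) (by rwa [hv1]))
    (htrans _ (toTorus_eq_zero_iff.2 fun i => by
      fin_cases i
      · exact ⟨0, by simp⟩
      · exact ⟨1, by simp⟩) (by rwa [hv2]) (by rwa [hv2]) (by rwa [hv2]))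
  rw [hdeck] at hfd
  have hbij : Function.Bijective f := by
    refine ⟨fun x y hxy => ?_, fun y => ?_⟩
    · have h1 : κ y = κ x := by rw [← hκf, ← hκf, hxy]
      rcases h.eq_or_eq_deckInvolution h1 with rfl | rfl
      · rfl
      · rw [hfd] at hxy
        have h2 : κ (f x) ∈ S := by_contra fun h2 => h.deckInvolution_ne h2 hxy.symm
        rw [h.deckInvolution_eq]
        rwa [← hκf, Function.comp, hM]
    · obtain ⟨x, hx⟩ := h.surjective (M (κ y))
      have h1 : κ y = κ (f x) := M.injective ((hκf x).trans hx).symm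
      rcases h.eq_or_eq_deckInvolution h1 with h2 | h2
      · exact ⟨x, h2.symm⟩
      · exact ⟨deckInvolution κ x, by rw [hfd, h2]⟩
  refine ⟨Continuous.homeoOfEquivCompactToT2 (f := Equiv.ofBijective f hbij) hf, fun x => ?_⟩
  exact (hMA _ _).1 (hκf x)

end Lift

/-! ### Congruence conditions -/

theorem congruentMod_iff {m : ℕ} {A B : Matrix.SpecialLinearGroup (Fin 2) ℤ} :
    CongruentMod m A B ↔ ∀ i j, ((A i j : ℤ) : ZMod m) = ((B i j : ℤ) : ZMod m) := by
  rw [CongruentMod, Matrix.SpecialLinearGroup.ext_iff]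
  rfl

/-- `A` is congruent modulo `n` to one of the four powers `±I`, `±S` of the rotation by `π / 2`. -/
def IsSignedRotationMod (n : ℕ) (A : Matrix.SpecialLinearGroup (Fin 2) ℤ) : Prop :=
  CongruentMod n A 1 ∨ CongruentMod n A (-1) ∨
    CongruentMod n A ModularGroup.S ∨ CongruentMod n A (-ModularGroup.S)

theorem isSignedRotationMod_iff {n : ℕ} {A : Matrix.SpecialLinearGroup (Fin 2) ℤ} :
    IsSignedRotationMod n A ↔
      ((A 0 0 : ZMod n) = 1 ∧ (A 0 1 : ZMod n) = 0 ∧ (A 1 0 : ZMod n) = 0 ∧ (A 1 1 : ZMod n) = 1) ∨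
      ((A 0 0 : ZMod n) = -1 ∧ (A 0 1 : ZMod n) = 0 ∧ (A 1 0 : ZMod n) = 0 ∧
        (A 1 1 : ZMod n) = -1) ∨
      ((A 0 0 : ZMod n) = 0 ∧ (A 0 1 : ZMod n) = -1 ∧ (A 1 0 : ZMod n) = 1 ∧
        (A 1 1 : ZMod n) = 0) ∨
      ((A 0 0 : ZMod n) = 0 ∧ (A 0 1 : ZMod n) = 1 ∧ (A 1 0 : ZMod n) = -1 ∧
        (A 1 1 : ZMod n) = 0) := by
  simp only [IsSignedRotationMod, congruentMod_iff, Fin.forall_fin_two]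
  simp [Matrix.SpecialLinearGroup.coe_neg, Matrix.neg_apply, ModularGroup.coe_S, and_assoc]

/-! ### Torsion points -/

theorem ne_zero_of_isUnit_sq_add_sq {n : ℕ} (hn3 : 3 ≤ n) {p q : ZMod n} (hpq : IsUnit (p ^ 2 + q ^ 2)) :
    ¬ (p = 0 ∧ q = 0) := by
  rintro ⟨rfl, rfl⟩
  have : Fact (1 < n) := ⟨by omega⟩
  simp at hpq

theorem isUnit_two {n : ℕ} (hn : Odd n) : IsUnit (2 : ZMod n) := by
  have := (ZMod.isUnit_iff_coprime 2 n).2 (Nat.coprime_two_left.2 hn)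
  exact_mod_cast this

theorem nsmul_int_half_ne_zero {n : ℕ} (hn : Odd n) {i j : ℤ} (hij : Odd i ∨ Odd j) :
    n • toTorus ![(i : ℝ) / 2, (j : ℝ) / 2] ≠ 0 := by
  rw [nsmul_int_half, Ne, toTorus_int_half_eq_zero_iff]
  have hn' : Odd (n : ℤ) := by exact_mod_cast hn
  rintro ⟨h1, h2⟩
  rcases hij with h | h
  · exact (Int.not_even_iff_odd.2 (hn'.mul h)) h1
  · exact (Int.not_even_iff_odd.2 (hn'.mul h)) h2

section Torsion

variable {n : ℕ} [NeZero n]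

theorem torsionPoint_eq_toTorus (p q : ZMod n) :
    torsionPoint p q = toTorus ![(p.valMinAbs : ℝ) / n, (q.valMinAbs : ℝ) / n] := by
  funext i
  fin_cases i
  · simpa [torsionPoint, toTorus] using ZMod.toAddCircle_intCast (N := n) p.valMinAbs
  · simpa [torsionPoint, toTorus] using ZMod.toAddCircle_intCast (N := n) q.valMinAbs

theorem torsionPoint_add (p q p' q' : ZMod n) :
    torsionPoint (p + p') (q + q') = torsionPoint p q + torsionPoint p' q' := by
  funext i
  fin_cases i <;> simp [torsionPoint]

theorem torsionPoint_zero : torsionPoint (0 : ZMod n) 0 = 0 := by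
  funext i
  fin_cases i <;> simp [torsionPoint]

theorem torsionPoint_neg (p q : ZMod n) : torsionPoint (-p) (-q) = -torsionPoint p q := by
  funext i
  fin_cases i <;> simp [torsionPoint]

theorem torusRotation_torsionPoint (p q : ZMod n) :
    torusRotation (torsionPoint p q) = torsionPoint (-q) p := by
  funext i
  fin_cases i <;> simp [torsionPoint, torusRotation]

theorem matrixAction_torsionPoint (A : Matrix (Fin 2) (Fin 2) ℤ) (p q : ZMod n) :
    matrixAction A (torsionPoint p q) =
      torsionPoint ((A 0 0 : ZMod n) * p + (A 0 1 : ZMod n) * q)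
        ((A 1 0 : ZMod n) * p + (A 1 1 : ZMod n) * q) := by
  funext i
  fin_cases i <;> simp [torsionPoint, matrixAction, ← zsmul_eq_mul, map_add, map_zsmul]

theorem nsmul_torsionPoint (p q : ZMod n) : n • torsionPoint p q = 0 := by
  funext i
  fin_cases i <;> simp [torsionPoint, ← map_nsmul]

theorem torsionPoint_inj {p q p' q' : ZMod n} :
    torsionPoint p q = torsionPoint p' q' ↔ p = p' ∧ q = q' := by
  rw [funext_iff, Fin.forall_fin_two]
  simp [torsionPoint, (ZMod.toAddCircle_injective n).eq_iff]

theorem mem_rotationOrbit_torsionPoint_iff {p q p' q' : ZMod n} :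
    torsionPoint p' q' ∈ rotationOrbit (torsionPoint p q) ↔
      (p' = p ∧ q' = q) ∨ (p' = -q ∧ q' = p) ∨ (p' = -p ∧ q' = -q) ∨ (p' = q ∧ q' = -p) := by
  rw [mem_rotationOrbit_iff, torusRotation_torsionPoint, ← torsionPoint_neg, ← torsionPoint_neg,
    neg_neg]
  simp only [torsionPoint_inj]

theorem zero_notMem_rotationOrbit_torsionPoint {p q : ZMod n} (hpq : ¬ (p = 0 ∧ q = 0)) :
    (0 : Torus) ∉ rotationOrbit (torsionPoint p q) := by
  rw [← torsionPoint_zero (n := n), mem_rotationOrbit_torsionPoint_iff]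
  grind

theorem exists_torsionPoint_of_mem_rotationOrbit {p q : ZMod n} {t : Torus}
    (ht : t ∈ rotationOrbit (torsionPoint p q)) : ∃ p' q' : ZMod n, t = torsionPoint p' q' := by
  rw [mem_rotationOrbit_iff, torusRotation_torsionPoint, ← torsionPoint_neg,
    ← torsionPoint_neg] at ht
  rcases ht with h | h | h | h
  exacts [⟨_, _, h⟩, ⟨_, _, h⟩, ⟨_, _, h⟩, ⟨_, _, h⟩]

theorem nsmul_eq_zero_of_mem_rotationOrbit {p q : ZMod n} {t : Torus}
    (ht : t ∈ rotationOrbit (torsionPoint p q)) : n • t = 0 := by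
  obtain ⟨p', q', rfl⟩ := exists_torsionPoint_of_mem_rotationOrbit ht
  exact nsmul_torsionPoint p' q'

/-- Every point of odd order has a rotate in the open first quadrant of the fundamental square or
on its lower side. -/
theorem exists_rotationOrbit_eq_of_quadrant (hn : Odd n) {p q : ZMod n}
    (hpq : ¬ (p = 0 ∧ q = 0)) : ∃ w : Fin 2 → ℝ, 0 < w 0 ∧ w 0 < 1 / 2 ∧ 0 ≤ w 1 ∧ w 1 < 1 / 2 ∧
      rotationOrbit (torsionPoint p q) = rotationOrbit (toTorus w) := by
  have hn0 : (0 : ℝ) < n := by exact_mod_cast NeZero.pos n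
  have habs : ∀ a : ZMod n, |(a.valMinAbs : ℝ) / n| < 1 / 2 := by
    intro a
    rw [abs_div, abs_of_pos hn0, div_lt_iff₀ hn0]
    have h1 : a.valMinAbs.natAbs ≤ n / 2 := ZMod.natAbs_valMinAbs_le a
    obtain ⟨k, hk⟩ := hn
    have h2 : 2 * a.valMinAbs.natAbs < n := by omega
    have h3 : (2 : ℝ) * |(a.valMinAbs : ℝ)| < n := by
      rw [← Int.cast_abs, Int.abs_eq_natAbs]
      exact_mod_cast h2
    linarith
  have hne : ¬ ((p.valMinAbs : ℝ) / n = 0 ∧ (q.valMinAbs : ℝ) / n = 0) := by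
    rintro ⟨h1, h2⟩
    rw [div_eq_zero_iff, or_iff_left hn0.ne', Int.cast_eq_zero, ZMod.valMinAbs_eq_zero] at h1 h2
    exact hpq ⟨h1, h2⟩
  rw [torsionPoint_eq_toTorus]
  have hx := abs_lt.1 (habs p)
  have hy := abs_lt.1 (habs q)
  generalize (p.valMinAbs : ℝ) / n = x at hx hne
  generalize (q.valMinAbs : ℝ) / n = y at hy hne
  have hrot : ∀ x y : ℝ, rotationOrbit (toTorus ![x, y]) = rotationOrbit (toTorus ![-y, x]) :=
    fun x y => by
      rw [← rotationOrbit_torusRotation, torusRotation_toTorus]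
      simp
  by_cases h1 : 0 < x ∧ 0 ≤ y
  · exact ⟨![x, y], h1.1, hx.2, h1.2, hy.2, rfl⟩
  by_cases h2 : 0 ≤ x ∧ y < 0
  · exact ⟨![-y, x], by simpa using h2.2, by simp; linarith, h2.1, hx.2, hrot x y⟩
  by_cases h3 : x < 0 ∧ y ≤ 0
  · refine ⟨![-x, -y], by simpa using h3.1, by simp; linarith, by simpa using h3.2,
      by simp; linarith, ?_⟩
    rw [hrot, hrot]
  · have h4 : x ≤ 0 ∧ 0 < y := by
      rcases lt_trichotomy x 0 with h5 | h5 | h5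
      · exact ⟨h5.le, not_le.1 fun h => h3 ⟨h5, h⟩⟩
      · refine ⟨h5.le, lt_of_le_of_ne (not_lt.1 fun h => h2 ⟨h5.ge, h⟩) fun h => hne ⟨h5, h.symm⟩⟩
      · rcases le_or_gt 0 y with h | h
        · exact absurd ⟨h5, h⟩ h1
        · exact absurd ⟨h5.le, h⟩ h2
    refine ⟨![y, -x], h4.2, hy.2, by simpa using h4.1, by simp; linarith, ?_⟩
    rw [hrot, hrot, hrot]
    simp

/-- A matrix of determinant one that permutes the four rotates of `(p, q)` modulo `n` is a signed
rotation modulo `n`, because `(p, q)` and `(-q, p)` form a basis. -/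
theorem isSignedRotationMod_of_mem (hn : Odd n) (hn3 : 3 ≤ n) {p q : ZMod n}
    (hpq : IsUnit (p ^ 2 + q ^ 2)) {A : Matrix.SpecialLinearGroup (Fin 2) ℤ}
    (h1 : matrixAction A (torsionPoint p q) ∈ rotationOrbit (torsionPoint p q))
    (h2 : matrixAction A (torsionPoint (-q) p) ∈ rotationOrbit (torsionPoint p q)) :
    IsSignedRotationMod n A := by
  have hdet : ((A 0 0 : ZMod n)) * A 1 1 - A 0 1 * A 1 0 = 1 := by
    have h3 := A.det_coe
    rw [Matrix.det_fin_two] at h3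
    exact_mod_cast congrArg (Int.cast : ℤ → ZMod n) h3
  have : Fact (1 < n) := ⟨by omega⟩
  have h2u := isUnit_two hn
  rw [matrixAction_torsionPoint, mem_rotationOrbit_torsionPoint_iff] at h1 h2
  rw [isSignedRotationMod_iff]
  generalize (A 0 0 : ZMod n) = a at *
  generalize (A 0 1 : ZMod n) = b at *
  generalize (A 1 0 : ZMod n) = c at *
  generalize (A 1 1 : ZMod n) = d at *
  obtain ⟨e, he⟩ := hpq.exists_left_inv
  obtain ⟨g, hg⟩ := h2u.exists_left_inv
  have hbasis : ∀ x y x' y' : ZMod n, a * p + b * q = x → c * p + d * q = y →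
      a * (-q) + b * p = x' → c * (-q) + d * p = y' →
      a = e * (x * p - x' * q) ∧ b = e * (x * q + x' * p) ∧ c = e * (y * p - y' * q) ∧
        d = e * (y * q + y' * p) ∧ x * y' - x' * y = p ^ 2 + q ^ 2 := by
    rintro x y x' y' rfl rfl rfl rfl
    refine ⟨?_, ?_, ?_, ?_, ?_⟩
    · linear_combination (-a) * he
    · linear_combination (-b) * he
    · linear_combination (-c) * he
    · linear_combination (-d) * he
    · linear_combination (p ^ 2 + q ^ 2) * hdet
  have h0 : p ^ 2 + q ^ 2 ≠ 0 := hpq.ne_zero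
  have hnn : ∀ z : ZMod n, z = -z → z = 0 := fun z hz => by
    linear_combination (-z) * hg + g * hz
  rcases h1 with ⟨hx, hy⟩ | ⟨hx, hy⟩ | ⟨hx, hy⟩ | ⟨hx, hy⟩ <;>
    rcases h2 with ⟨hx', hy'⟩ | ⟨hx', hy'⟩ | ⟨hx', hy'⟩ | ⟨hx', hy'⟩ <;>
    obtain ⟨ha, hb, hc, hd, hD⟩ := hbasis _ _ _ _ hx hy hx' hy'
  · exact absurd (by linear_combination -hD) h0
  · exact .inl ⟨by linear_combination ha + he, by linear_combination hb,
      by linear_combination hc, by linear_combination hd + he⟩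
  · exact absurd (by linear_combination -hD) h0
  · exact absurd (hnn _ (by linear_combination -hD)) h0
  · exact absurd (hnn _ (by linear_combination -hD)) h0
  · exact absurd (by linear_combination -hD) h0
  · exact .inr (.inr (.inl ⟨by linear_combination ha, by linear_combination hb - he,
      by linear_combination hc + he, by linear_combination hd⟩))
  · exact absurd (by linear_combination -hD) h0
  · exact absurd (by linear_combination -hD) h0
  · exact absurd (hnn _ (by linear_combination -hD)) h0
  · exact absurd (by linear_combination -hD) h0
  · exact .inr (.inl ⟨by linear_combination ha - he, by linear_combination hb,
      by linear_combination hc, by linear_combination hd - he⟩)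
  · exact .inr (.inr (.inr ⟨by linear_combination ha, by linear_combination hb + he,
      by linear_combination hc - he, by linear_combination hd⟩))
  · exact absurd (by linear_combination -hD) h0
  · exact absurd (hnn _ (by linear_combination -hD)) h0
  · exact absurd (by linear_combination -hD) h0

theorem matrixAction_mem_rotationOrbit_iff {p q : ZMod n}
    {A : Matrix.SpecialLinearGroup (Fin 2) ℤ} (hA : IsSignedRotationMod n A) (t : Torus) :
    matrixAction A t ∈ rotationOrbit (torsionPoint p q) ↔
      t ∈ rotationOrbit (torsionPoint p q) := by
  have key : ∀ p' q' : ZMod n,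
      torsionPoint ((A 0 0 : ZMod n) * p' + (A 0 1 : ZMod n) * q')
        ((A 1 0 : ZMod n) * p' + (A 1 1 : ZMod n) * q') ∈
        rotationOrbit (torsionPoint p q) ↔ torsionPoint p' q' ∈ rotationOrbit (torsionPoint p q) := by
    intro p' q'
    rw [isSignedRotationMod_iff] at hA
    rw [mem_rotationOrbit_torsionPoint_iff, mem_rotationOrbit_torsionPoint_iff]
    rcases hA with ⟨h1, h2, h3, h4⟩ | ⟨h1, h2, h3, h4⟩ | ⟨h1, h2, h3, h4⟩ | ⟨h1, h2, h3, h4⟩ <;>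
      rw [h1, h2, h3, h4] <;> grind
  constructor
  · intro ht
    obtain ⟨p', q', hpq'⟩ := exists_torsionPoint_of_mem_rotationOrbit ht
    have h1 : t = matrixAction (A⁻¹ : Matrix.SpecialLinearGroup (Fin 2) ℤ) (torsionPoint p' q') := by
      rw [← hpq', ← matrixAction_mul, ← Matrix.SpecialLinearGroup.coe_mul, inv_mul_cancel,
        Matrix.SpecialLinearGroup.coe_one, matrixAction_one]
    rw [matrixAction_torsionPoint] at h1
    rw [h1, matrixAction_torsionPoint] at ht
    rw [h1]
    exact (key _ _).1 ht
  · intro ht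
    obtain ⟨p', q', rfl⟩ := exists_torsionPoint_of_mem_rotationOrbit ht
    rw [matrixAction_torsionPoint]
    exact (key _ _).2 ht

end Torsion

/-! ### Affine maps of the punctured surface -/

theorem finite_setOf_nsmul_eq_zero {n : ℕ} (hn : 0 < n) : {t : Torus | n • t = 0}.Finite := by
  have h1 : {t : Torus | n • t = 0} = Set.univ.pi fun _ => {u : UnitAddCircle | n • u = 0} := by
    ext t
    simp [funext_iff]
  rw [h1]
  exact Set.Finite.pi fun _ => AddCircle.finite_torsion (1 : ℝ) hn

/-- A matrix that preserves the lattice of integral vectors in both directions is integral, and so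
is its inverse. -/
theorem exists_specialLinearGroup_map_eq {A : Matrix (Fin 2) (Fin 2) ℝ} (hdet : 0 < A.det)
    (hA : ∀ v, toTorus (A *ᵥ v) = 0 ↔ toTorus v = 0) :
    ∃ B : Matrix.SpecialLinearGroup (Fin 2) ℤ,
      (B : Matrix (Fin 2) (Fin 2) ℤ).map (Int.cast : ℤ → ℝ) = A := by
  have hint : ∀ M : Matrix (Fin 2) (Fin 2) ℝ, (∀ v, toTorus v = 0 → toTorus (M *ᵥ v) = 0) →
      ∃ N : Matrix (Fin 2) (Fin 2) ℤ, N.map (Int.cast : ℤ → ℝ) = M := by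
    intro M hM
    have h1 : ∀ i j, ∃ m : ℤ, M i j = m := by
      intro i j
      have h2 := hM (Pi.single j 1) (toTorus_eq_zero_iff.2 fun k => by
        by_cases h : k = j
        · exact ⟨1, by simp [h]⟩
        · exact ⟨0, by simp [h]⟩)
      simpa using toTorus_eq_zero_iff.1 h2 i
    choose N hN using h1
    exact ⟨Matrix.of N, by ext i j; simp [hN]⟩
  have hunit : IsUnit A.det := hdet.ne'.isUnit
  obtain ⟨B, hB⟩ := hint A fun v hv => (hA v).2 hv
  obtain ⟨C, hC⟩ := hint A⁻¹ fun v hv => by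
    rw [← hA, Matrix.mulVec_mulVec, Matrix.mul_nonsing_inv _ hunit, Matrix.one_mulVec]
    exact hv
  have hdetB : ((B.det : ℤ) : ℝ) = A.det := by
    rw [← hB]
    exact (Int.castRingHom ℝ).map_det B
  have hdetC : ((C.det : ℤ) : ℝ) = A⁻¹.det := by
    rw [← hC]
    exact (Int.castRingHom ℝ).map_det C
  have h1 : B.det * C.det = 1 := by
    have : ((B.det * C.det : ℤ) : ℝ) = 1 := by
      rw [Int.cast_mul, hdetB, hdetC, ← Matrix.det_mul, Matrix.mul_nonsing_inv _ hunit,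
        Matrix.det_one]
    exact_mod_cast this
  have h2 : 0 < B.det := by
    rw [← hdetB] at hdet
    exact_mod_cast hdet
  have h3 : B.det = 1 := by
    rcases Int.isUnit_iff.1 (IsUnit.of_mul_eq_one _ h1) with h | h
    · exact h
    · omega
  exact ⟨⟨B, h3⟩, hB⟩

section Affine

variable {X : Type*} [TopologicalSpace X] {κ : X → Torus} {S : Set Torus} {n : ℕ}

/-- A translation chart around a point of the punctured surface is `n` times a local inverse of
the projection from the plane. -/
theorem exists_translationChart (h : IsDoubleCoverRamifiedOver κ S) (hn : 0 < n)
    (hSn : ∀ t ∈ S, n • t = 0) (x₀ : PuncturedSurface (origamiDP n κ)) {v₀ : Fin 2 → ℝ}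
    (hv₀ : κ x₀ = toTorus v₀) :
    ∃ φ : OpenPartialHomeomorph (PuncturedSurface (origamiDP n κ)) (Fin 2 → ℝ),
      IsTranslationChart (origamiDP n κ) φ ∧ x₀ ∈ φ.source ∧ φ x₀ = (n : ℝ) • v₀ ∧
      ∀ x ∈ φ.source, κ x = toTorus ((n : ℝ)⁻¹ • φ x) := by
  have hn' : (n : ℝ) ≠ 0 := by exact_mod_cast hn.ne'
  have hopen : IsOpen {x : X | origamiDP n κ x ≠ 0} :=
    isOpen_ne_fun (h.continuous.const_smul n) continuous_const
  have hloc : IsLocalHomeomorphOn (κ ∘ (Subtype.val : PuncturedSurface (origamiDP n κ) → X))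
      Set.univ :=
    h.isLocalHomeomorphOn.comp hopen.isOpenEmbedding_subtypeVal.isLocalHomeomorph.isLocalHomeomorphOn
      fun x _ hx => x.2 (hSn _ hx)
  obtain ⟨e₁, h₁, he₁⟩ := hloc x₀ (Set.mem_univ _)
  obtain ⟨e₂, h₂, he₂⟩ := isLocalHomeomorph_toTorus v₀
  have hκ₁ : ∀ x : PuncturedSurface (origamiDP n κ), e₁ x = κ x := fun x => by rw [← he₁]; rfl
  have key : ∀ x ∈ (e₁.trans e₂.symm).source, toTorus (e₂.symm (e₁ x)) = κ x := by
    intro x hx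
    rw [he₂, e₂.right_inv (by simpa using hx.2), hκ₁]
  have hx₀ : e₂.symm (e₁ x₀) = v₀ := by
    rw [hκ₁, hv₀, he₂, e₂.left_inv h₂]
  let φ := (e₁.trans e₂.symm).trans
    (Homeomorph.smulOfNeZero (n : ℝ) hn').toOpenPartialHomeomorph
  have hφ : ∀ x, φ x = (n : ℝ) • e₂.symm (e₁ x) := fun x => rfl
  have hsource : φ.source = (e₁.trans e₂.symm).source := by simp [φ]
  have hκφ : ∀ x ∈ φ.source, κ x = toTorus ((n : ℝ)⁻¹ • φ x) := by
    intro x hx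
    rw [hφ, inv_smul_smul₀ hn', key x (hsource ▸ hx)]
  refine ⟨φ, ?_, ?_, by rw [hφ, hx₀], hκφ⟩
  · intro x hx
    rw [origamiDP, hκφ x hx, nsmul_toTorus, smul_inv_smul₀ hn']
  · rw [hsource, OpenPartialHomeomorph.trans_source]
    refine ⟨h₁, ?_⟩
    rw [Set.mem_preimage, hκ₁, hv₀, he₂]
    exact e₂.map_source h₂

/-- Over a neighbourhood of a point of the plane, an affine map of the punctured surface is given
by its derivative. -/
theorem IsAffineWithDerivative.exists_section (h : IsDoubleCoverRamifiedOver κ S) (hn : 0 < n)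
    (hSn : ∀ t ∈ S, n • t = 0) {f : PuncturedSurface (origamiDP n κ) →
      PuncturedSurface (origamiDP n κ)} {A : Matrix (Fin 2) (Fin 2) ℝ} (hfc : Continuous f)
    (hf : IsAffineWithDerivative (origamiDP n κ) f A) (x₀ : PuncturedSurface (origamiDP n κ))
    {v₀ : Fin 2 → ℝ} (hv₀ : κ x₀ = toTorus v₀) :
    ∃ s : (Fin 2 → ℝ) → PuncturedSurface (origamiDP n κ),
      Filter.map s (𝓝 v₀) = 𝓝 x₀ ∧ s v₀ = x₀ ∧ ∀ᶠ v in 𝓝 v₀, κ (s v) = toTorus v ∧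
        κ (f (s v)) = toTorus (A *ᵥ (v - v₀)) + κ (f x₀) := by
  have hn' : (n : ℝ) ≠ 0 := by exact_mod_cast hn.ne'
  obtain ⟨w₀, hw₀⟩ := toTorus_surjective (κ (f x₀))
  obtain ⟨φ, hφ, hφ₀, hφv, hκφ⟩ := exists_translationChart h hn hSn x₀ hv₀
  obtain ⟨ψ, hψ, hψ₀, hψw, hκψ⟩ := exists_translationChart h hn hSn (f x₀) hw₀.symm
  obtain ⟨c, hc⟩ := hf φ ψ hφ hψ x₀ hφ₀ hψ₀
  have hmap : Filter.map (fun v => φ.symm ((n : ℝ) • v)) (𝓝 v₀) = 𝓝 x₀ := by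
    have h1 : Filter.map (fun v : Fin 2 → ℝ => (n : ℝ) • v) (𝓝 v₀) = 𝓝 ((n : ℝ) • v₀) :=
      (Homeomorph.smulOfNeZero (n : ℝ) hn').map_nhds_eq v₀
    rw [← Function.comp_def φ.symm, ← Filter.map_map, h1, ← hφv]
    exact φ.symm_map_nhds_eq hφ₀
  have htarget : ∀ᶠ v in 𝓝 v₀, (n : ℝ) • v ∈ φ.target :=
    (continuous_const_smul (n : ℝ)).continuousAt.eventually (φ.open_target.mem_nhds (by
      simp only [← hφv]
      exact φ.map_source hφ₀))
  have hev : ∀ᶠ y in 𝓝 x₀, f y ∈ ψ.source ∧ ψ (f y) = A *ᵥ φ y + c :=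
    (hfc.continuousAt.eventually (ψ.open_source.mem_nhds hψ₀)).and hc
  rw [← hmap, Filter.eventually_map] at hev
  refine ⟨fun v => φ.symm ((n : ℝ) • v), hmap, by simp only [← hφv, φ.left_inv hφ₀], ?_⟩
  have hc₀ : (n : ℝ) • w₀ = A *ᵥ ((n : ℝ) • v₀) + c := by
    rw [← hψw, ← hφv]
    exact hc.self_of_nhds
  filter_upwards [htarget, hev] with v h1 ⟨h2, h3⟩
  refine ⟨?_, ?_⟩
  · rw [hκφ _ (φ.map_target h1), φ.right_inv h1, inv_smul_smul₀ hn']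
  · rw [hκψ _ h2, h3, φ.right_inv h1, ← hw₀, ← toTorus_add]
    congr 1
    have h4 : c = (n : ℝ) • (w₀ - A *ᵥ v₀) := by
      rw [smul_sub, ← Matrix.mulVec_smul, hc₀, add_sub_cancel_left]
    rw [h4, Matrix.mulVec_smul, ← smul_add, inv_smul_smul₀ hn', Matrix.mulVec_sub]
    abel

theorem preconnectedSpace_puncturedSurface [T1Space X] [ConnectedSpace X]
    [ChartedSpace (EuclideanSpace ℝ (Fin 2)) X] (h : IsDoubleCoverRamifiedOver κ S) (hn : 0 < n) :
    PreconnectedSpace (PuncturedSurface (origamiDP n κ)) := by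
  have hfin : (κ ⁻¹' {t | n • t = 0}).Finite := by
    refine (finite_setOf_nsmul_eq_zero hn).preimage' fun t _ => Set.finite_of_ncard_ne_zero ?_
    by_cases ht : t ∈ S
    · rw [h.ncard_fiber_of_mem t ht]
      exact one_ne_zero
    · rw [h.ncard_fiber_of_notMem t ht]
      exact two_ne_zero
  exact isPreconnected_iff_preconnectedSpace.1 (isPreconnected_compl_of_finite hfin)

variable [T2Space X] [ConnectedSpace X]
  [ChartedSpace (EuclideanSpace ℝ (Fin 2)) X]

/-- An affine homeomorphism of the punctured surface maps fibres of the double covering to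
fibres. The images of the two points of a fibre differ by a translation of the torus of order two
that preserves the set of points of order dividing `n`. -/
theorem IsAffineWithDerivative.map_eq_of_map_eq (h : IsDoubleCoverRamifiedOver κ S)
    (hn : Odd n) (hSn : ∀ t ∈ S, n • t = 0)
    {f : PuncturedSurface (origamiDP n κ) ≃ₜ PuncturedSurface (origamiDP n κ)}
    {A : Matrix (Fin 2) (Fin 2) ℝ} (hf : IsAffineWithDerivative (origamiDP n κ) f A)
    {x y : PuncturedSurface (origamiDP n κ)} (hxy : κ x = κ y) : κ (f x) = κ (f y) := by
  have := preconnectedSpace_puncturedSurface h hn.pos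
  have hnotS : ∀ x : PuncturedSurface (origamiDP n κ), κ x ∉ S := fun x hx => x.2 (hSn _ hx)
  let σ : PuncturedSurface (origamiDP n κ) → PuncturedSurface (origamiDP n κ) :=
    fun x => ⟨deckInvolution κ x, by
      change n • κ (deckInvolution κ x) ≠ 0
      rw [map_deckInvolution κ]
      exact x.2⟩
  have hκσ : ∀ x, κ (σ x) = κ x := fun x => map_deckInvolution κ _
  have hσσ : ∀ x, σ (σ x) = x := fun x => Subtype.ext (h.deckInvolution_deckInvolution _)
  have hloc : IsLocallyConstant fun x => κ (f (σ x)) - κ (f x) := by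
    rw [IsLocallyConstant.iff_eventually_eq]
    intro x₀
    obtain ⟨v₀, hv₀⟩ := toTorus_surjective (κ x₀)
    obtain ⟨s, hs, hs₀, hsv⟩ := hf.exists_section h hn.pos hSn f.continuous x₀ hv₀.symm
    obtain ⟨s', hs', hs₀', hsv'⟩ := hf.exists_section h hn.pos hSn f.continuous (σ x₀)
      (v₀ := v₀) (by rw [hκσ, hv₀])
    have hne : ∀ᶠ v in 𝓝 v₀, s' v ≠ s v := by
      refine (Filter.Tendsto.prodMk_nhds (x := σ x₀) (y := x₀) hs'.le hs.le).eventually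
        (isClosed_diagonal.isOpen_compl.mem_nhds fun heq => ?_)
      exact h.deckInvolution_ne (hnotS x₀) (congrArg Subtype.val heq)
    rw [← hs, Filter.eventually_map]
    filter_upwards [hsv, hsv', hne] with v h1 h2 h3
    have h4 : σ (s v) = s' v := by
      refine (Subtype.ext (h.eq_deckInvolution (h2.1.trans h1.1.symm) fun h5 => ?_)).symm
      exact h3 (Subtype.ext h5)
    rw [h4, h1.2, h2.2]
    abel
  have hb : ∀ x y, κ (f (σ x)) - κ (f x) = κ (f (σ y)) - κ (f y) := fun x y =>
    hloc.apply_eq_of_preconnectedSpace x y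
  obtain ⟨b, hb⟩ : ∃ b : Torus, ∀ x, κ (f (σ x)) = κ (f x) + b :=
    ⟨κ (f (σ x)) - κ (f x), fun y => by rw [hb x y]; abel⟩
  have h2b : (2 : ℕ) • b = 0 := by
    have h1 := hb (σ x)
    rw [hσσ, hb x, add_assoc] at h1
    rw [two_nsmul]
    exact left_eq_add.1 h1
  have hnb : n • b = 0 := by
    by_contra hne
    obtain ⟨y, hy⟩ := h.surjective (-b)
    obtain ⟨z, hz⟩ := f.surjective ⟨y, by
      change n • κ y ≠ 0
      rwa [hy, smul_neg, Ne, neg_eq_zero]⟩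
    have h1 := hb z
    rw [hz, hy, neg_add_cancel] at h1
    exact (f (σ z)).2 (by rw [origamiDP, h1, smul_zero])
  have hb0 : b = 0 := by
    obtain ⟨k, rfl⟩ := hn
    rw [add_smul, mul_comm, mul_smul, h2b, smul_zero, zero_add, one_smul] at hnb
    exact hnb
  rcases h.eq_or_eq_deckInvolution hxy with h1 | h1
  · rw [Subtype.ext h1]
  · rw [show x = σ y from Subtype.ext h1, hb, hb0, add_zero]

/-- An affine homeomorphism of the punctured surface lies over an affine map of the torus. -/
theorem IsAffineWithDerivative.exists_map_eq (h : IsDoubleCoverRamifiedOver κ S)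
    (hn : Odd n) (hSn : ∀ t ∈ S, n • t = 0)
    {f : PuncturedSurface (origamiDP n κ) ≃ₜ PuncturedSurface (origamiDP n κ)}
    {A : Matrix (Fin 2) (Fin 2) ℝ} (hf : IsAffineWithDerivative (origamiDP n κ) f A) :
    ∃ b : Torus, ∀ (x : PuncturedSurface (origamiDP n κ)) (v : Fin 2 → ℝ), κ x = toTorus v →
      κ (f x) = toTorus (A *ᵥ v) + b := by
  have hU : IsConnected (toTorus ⁻¹' {t | n • t = 0})ᶜ :=
    isConnected_compl_preimage_toTorus (finite_setOf_nsmul_eq_zero hn.pos).countable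
  have hex : ∀ v : ↥((toTorus ⁻¹' {t | n • t = 0})ᶜ),
      ∃ x : PuncturedSurface (origamiDP n κ), κ x = toTorus v := by
    intro v
    obtain ⟨x, hx⟩ := h.surjective (toTorus v)
    exact ⟨⟨x, by rw [origamiDP, hx]; exact v.2⟩, hx⟩
  choose r hr using hex
  have := isPreconnected_iff_preconnectedSpace.1 hU.isPreconnected
  have hloc : IsLocallyConstant fun v : ↥((toTorus ⁻¹' {t | n • t = 0})ᶜ) =>
      κ (f (r v)) - toTorus (A *ᵥ v) := by
    rw [IsLocallyConstant.iff_eventually_eq]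
    intro v₀
    obtain ⟨s, -, -, hs⟩ := hf.exists_section h hn.pos hSn f.continuous (r v₀) (hr v₀)
    have hs' := continuous_subtype_val.continuousAt.eventually hs
    filter_upwards [hs'] with v hv
    rw [hf.map_eq_of_map_eq h hn hSn ((hr v).trans hv.1.symm), hv.2, Matrix.mulVec_sub,
      toTorus_sub]
    abel
  obtain ⟨v₀, hv₀⟩ := hU.nonempty
  refine ⟨κ (f (r ⟨v₀, hv₀⟩)) - toTorus (A *ᵥ v₀), fun x v hxv => ?_⟩
  have hv : v ∈ (toTorus ⁻¹' {t | n • t = 0})ᶜ := fun hv => x.2 (by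
    rw [origamiDP, hxv]
    exact hv)
  rw [hf.map_eq_of_map_eq h hn hSn (hxv.trans (hr ⟨v, hv⟩).symm),
    ← hloc.apply_eq_of_preconnectedSpace ⟨v, hv⟩ ⟨v₀, hv₀⟩]
  simp

/-- The derivative of an affine homeomorphism of the punctured surface is integral. -/
theorem IsAffineWithDerivative.exists_matrixAction (h : IsDoubleCoverRamifiedOver κ S)
    (hn : Odd n) (hSn : ∀ t ∈ S, n • t = 0)
    {f : PuncturedSurface (origamiDP n κ) ≃ₜ PuncturedSurface (origamiDP n κ)}
    {A : Matrix (Fin 2) (Fin 2) ℝ} (hA : 0 < A.det)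
    (hf : IsAffineWithDerivative (origamiDP n κ) f A) :
    ∃ B : Matrix.SpecialLinearGroup (Fin 2) ℤ,
      (B : Matrix (Fin 2) (Fin 2) ℤ).map (Int.cast : ℤ → ℝ) = A ∧
      ∃ b : Torus, ∀ x : PuncturedSurface (origamiDP n κ),
        κ (f x) = matrixAction B (κ x) + b := by
  obtain ⟨b, hb⟩ := hf.exists_map_eq h hn hSn
  have hinj : ∀ x y, κ (f x) = κ (f y) → κ x = κ y := by
    intro x y hxy
    have hnotS : ∀ x : PuncturedSurface (origamiDP n κ), κ x ∉ S := fun x hx => x.2 (hSn _ hx)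
    have hσ : origamiDP n κ (deckInvolution κ y) ≠ 0 := by
      rw [origamiDP, map_deckInvolution κ]
      exact y.2
    have h1 : (f ⟨_, hσ⟩ : X) = deckInvolution κ (f y) := by
      refine h.eq_deckInvolution
        (hf.map_eq_of_map_eq h hn hSn (map_deckInvolution κ _)) fun h2 => ?_
      exact h.deckInvolution_ne (hnotS y) (congrArg Subtype.val (f.injective (Subtype.ext h2)))
    rcases h.eq_or_eq_deckInvolution hxy with h2 | h2
    · rw [f.injective (Subtype.ext h2)]
    · rw [f.injective (Subtype.ext (h2.trans h1.symm))]
      exact map_deckInvolution κ _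
  obtain ⟨B, hB⟩ := exists_specialLinearGroup_map_eq hA fun w => by
    -- both `v` and `v + w` avoid the points of order dividing `n` for most `v`
    have hF : ({t : Torus | n • t = 0} ∪ (fun t => t + toTorus w) ⁻¹' {t | n • t = 0}).Countable :=
      ((finite_setOf_nsmul_eq_zero hn.pos).union ((finite_setOf_nsmul_eq_zero hn.pos).preimage
        (add_left_injective _).injOn)).countable
    obtain ⟨v, hv⟩ := (isConnected_compl_preimage_toTorus hF).nonempty
    obtain ⟨x, hx⟩ := h.surjective (toTorus v)
    obtain ⟨y, hy⟩ := h.surjective (toTorus (v + w))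
    have hx0 : origamiDP n κ x ≠ 0 := fun h0 => hv (Or.inl (by
      rw [origamiDP, hx] at h0
      exact h0))
    have hy0 : origamiDP n κ y ≠ 0 := fun h0 => hv (Or.inr (by
      rw [origamiDP, hy, toTorus_add] at h0
      exact h0))
    have h1 := hb ⟨x, hx0⟩ v hx
    have h2 := hb ⟨y, hy0⟩ (v + w) hy
    rw [Matrix.mulVec_add, toTorus_add] at h2
    rw [toTorus_add] at hy
    constructor
    · intro h3
      have h4 := hinj ⟨y, hy0⟩ ⟨x, hx0⟩ (by rw [h1, h2, h3, add_zero])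
      change κ y = κ x at h4
      rw [hx, hy] at h4
      exact left_eq_add.1 h4.symm
    · intro h3
      have h4 := hf.map_eq_of_map_eq h hn hSn (x := ⟨y, hy0⟩) (y := ⟨x, hx0⟩)
        (by change κ y = κ x; rw [hx, hy, h3, add_zero])
      rw [h1, h2] at h4
      exact left_eq_add.1 (add_right_cancel h4).symm
  refine ⟨B, hB, b, fun x => ?_⟩
  obtain ⟨v, hv⟩ := toTorus_surjective (κ x)
  rw [hb x v hv.symm, ← hv, matrixAction_toTorus, hB]

end Affine

/-! ### Derivatives of affine maps: the conditions modulo `n` and modulo two -/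

section Branch

variable {X : Type*} [TopologicalSpace X] [T2Space X] [CompactSpace X]
  [ChartedSpace (EuclideanSpace ℝ (Fin 2)) X] {κ : X → Torus} {S : Set Torus} {n : ℕ}

/-- The affine map of the torus below an affine homeomorphism of the punctured surface preserves
the branch points: otherwise the inverse homeomorphism would transport a local section of the
double covering to a punctured neighbourhood of a branch point. -/
theorem matrixAction_add_mem (h : IsDoubleCoverRamifiedOver κ S) (hS : S.Finite) (hn : 0 < n)
    (hSn : ∀ t ∈ S, n • t = 0)
    (f : PuncturedSurface (origamiDP n κ) ≃ₜ PuncturedSurface (origamiDP n κ))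
    {B : Matrix.SpecialLinearGroup (Fin 2) ℤ} {b : Torus}
    (hf : ∀ x : PuncturedSurface (origamiDP n κ), κ (f x) = matrixAction B (κ x) + b) {t : Torus}
    (ht : t ∈ S) : matrixAction B t + b ∈ S := by
  by_contra hmem
  have hn' : (0 : ℝ) < n := by exact_mod_cast hn
  obtain ⟨v, rfl⟩ := toTorus_surjective t
  obtain ⟨β, rfl⟩ := toTorus_surjective b
  let L : (Fin 2 → ℝ) → Fin 2 → ℝ :=
    fun w => (B : Matrix (Fin 2) (Fin 2) ℤ).map (Int.cast : ℤ → ℝ) *ᵥ w + β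
  have hL : Continuous L := (continuous_const.matrix_mulVec continuous_id).add continuous_const
  have hLt : ∀ w, toTorus (L w) = matrixAction B (toTorus w) + toTorus β := fun w => by
    rw [toTorus_add, matrixAction_toTorus]
  obtain ⟨ε, hε, hball⟩ := Metric.isOpen_iff.1
    (hS.isClosed.isOpen_compl.preimage continuous_toTorus) (L v)
    (by rw [Set.mem_preimage, hLt]; exact hmem)
  obtain ⟨x, hx⟩ := h.surjective (toTorus (L v))
  obtain ⟨s, hs, hκs, -⟩ := h.exists_section Metric.isOpen_ball
    ((convex_ball (L v) ε).starConvex (Metric.mem_ball_self hε)) hball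
    (Metric.mem_ball_self hε) hx
  let Ω : Set (Fin 2 → ℝ) := L ⁻¹' Metric.ball (L v) ε ∩ (fun w => (n : ℝ) • w) ⁻¹'
    Metric.ball ((n : ℝ) • v) (1 / 2)
  have hΩ : Ω ∈ 𝓝 v :=
    Filter.inter_mem (hL.continuousAt.preimage_mem_nhds (Metric.ball_mem_nhds _ hε))
      ((continuous_const_smul (n : ℝ)).continuousAt.preimage_mem_nhds
        (Metric.ball_mem_nhds _ (by norm_num)))
  have hne : ∀ w ∈ Ω \ {v}, n • toTorus w ≠ 0 := by
    intro w hw h0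
    have h1 : toTorus ((n : ℝ) • w) = toTorus ((n : ℝ) • v) := by
      rw [← nsmul_toTorus, ← nsmul_toTorus, h0, hSn _ ht]
    exact hw.2 (smul_right_injective _ hn'.ne'
      (injOn_toTorus_ball _ hw.1.2 (Metric.mem_ball_self (by norm_num)) h1))
  -- on `Ω \ {v}` the section takes values in the punctured surface
  have hX : ∀ w ∈ Ω \ {v}, origamiDP n κ (s (L w)) ≠ 0 := by
    intro w hw
    obtain ⟨y, hy⟩ := h.surjective (toTorus w)
    have h1 := (f ⟨y, by rw [origamiDP, hy]; exact hne w hw⟩).2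
    rw [origamiDP, hf] at h1
    rw [origamiDP, hκs _ hw.1.1, hLt, ← hy]
    exact h1
  classical
  let r : (Fin 2 → ℝ) → X := fun w =>
    if hw : origamiDP n κ (s (L w)) ≠ 0 then f.symm ⟨s (L w), hw⟩ else x
  have hr : ∀ w (hw : w ∈ Ω \ {v}), r w = f.symm ⟨s (L w), hX w hw⟩ := fun w hw =>
    dif_pos (hX w hw)
  refine h.not_exists_section hS ht hΩ (s := r) ?_ ?_
  · rw [continuousOn_iff_continuous_domRestrict]
    have h1 : (Ω \ {v}).domRestrict r = fun w : ↥(Ω \ {v}) => (f.symm ⟨s (L w), hX w w.2⟩ : X) :=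
      funext fun w => hr w w.2
    rw [h1]
    refine continuous_subtype_val.comp (f.symm.continuous.comp (Continuous.subtype_mk ?_ _))
    exact hs.comp_continuous (hL.comp continuous_subtype_val) fun w => w.2.1.1
  · intro w hw
    have h1 := hf (f.symm ⟨s (L w), hX w hw⟩)
    rw [f.apply_symm_apply] at h1
    change κ (s (L w)) = _ at h1
    rw [hκs _ hw.1.1, hLt] at h1
    rw [hr w hw]
    have h2 := congrArg (matrixAction (B⁻¹ : Matrix.SpecialLinearGroup (Fin 2) ℤ))
      (add_right_cancel h1)
    rw [← matrixAction_mul, ← matrixAction_mul, ← Matrix.SpecialLinearGroup.coe_mul,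
      inv_mul_cancel, Matrix.SpecialLinearGroup.coe_one, matrixAction_one, matrixAction_one] at h2
    exact h2.symm

end Branch

/-- An affine map of the torus that preserves the four rotates of a point of odd order fixes the
origin: the sum of the four points is zero, so the translation part is killed by four. -/
theorem translation_eq_zero {n : ℕ} [NeZero n] (hn : Odd n) {p q : ZMod n}
    (hpq : ¬ (p = 0 ∧ q = 0)) {B : Matrix.SpecialLinearGroup (Fin 2) ℤ} {b : Torus}
    (hB : ∀ t ∈ rotationOrbit (torsionPoint p q),
      matrixAction B t + b ∈ rotationOrbit (torsionPoint p q)) : b = 0 := by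
  classical
  let F : Finset Torus := {torsionPoint p q, torsionPoint (-q) p, torsionPoint (-p) (-q),
    torsionPoint q (-p)}
  have hF : ∀ t, t ∈ F ↔ t ∈ rotationOrbit (torsionPoint p q) := by
    intro t
    rw [mem_rotationOrbit_iff, torusRotation_torsionPoint, ← torsionPoint_neg, ← torsionPoint_neg,
      neg_neg]
    simp [F]
  obtain ⟨g, hg⟩ := (isUnit_two hn).exists_left_inv
  have hnn : ∀ z : ZMod n, z = -z → z = 0 := fun z hz => by
    linear_combination (-z) * hg + g * hz
  have h1 : torsionPoint p q ∉ ({torsionPoint (-q) p, torsionPoint (-p) (-q),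
      torsionPoint q (-p)} : Finset Torus) := by
    simp only [Finset.mem_insert, Finset.mem_singleton, torsionPoint_inj]
    grind
  have h2 : torsionPoint (-q) p ∉ ({torsionPoint (-p) (-q), torsionPoint q (-p)} :
      Finset Torus) := by
    simp only [Finset.mem_insert, Finset.mem_singleton, torsionPoint_inj]
    grind
  have h3 : torsionPoint (-p) (-q) ∉ ({torsionPoint q (-p)} : Finset Torus) := by
    simp only [Finset.mem_singleton, torsionPoint_inj]
    grind
  have hcard : F.card = 4 := by
    rw [Finset.card_insert_of_notMem h1, Finset.card_insert_of_notMem h2,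
      Finset.card_insert_of_notMem h3, Finset.card_singleton]
  have hsum : ∑ t ∈ F, t = 0 := by
    rw [Finset.sum_insert h1, Finset.sum_insert h2, Finset.sum_insert h3, Finset.sum_singleton,
      ← torsionPoint_add, ← torsionPoint_add, ← torsionPoint_add]
    rw [show p + (-q + (-p + q)) = 0 by ring, show q + (p + (-q + -p)) = 0 by ring]
    funext i
    fin_cases i <;> simp [torsionPoint]
  have hinj : Function.Injective fun t => matrixAction B t + b := fun s t hst =>
    (torusHomeomorph B).injective (add_right_cancel hst)
  have himage : F.image (fun t => matrixAction B t + b) = F := by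
    refine Finset.eq_of_subset_of_card_le ?_ (Finset.card_image_of_injective _ hinj).ge
    intro t ht
    obtain ⟨u, hu, rfl⟩ := Finset.mem_image.1 ht
    exact (hF _).2 (hB _ ((hF _).1 hu))
  have h4 : (4 : ℕ) • b = 0 := by
    have h5 : ∑ t ∈ F, (matrixAction B t + b) = 0 := by
      rw [← hsum]
      nth_rw 2 [← himage]
      rw [Finset.sum_image hinj.injOn]
    have h6 : ∑ t ∈ F, matrixAction B t = matrixAction B (∑ t ∈ F, t) := by
      let φ : Torus →+ Torus := ⟨⟨matrixAction B, matrixAction_zero _⟩, matrixAction_add _⟩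
      exact (map_sum φ _ _).symm
    rwa [Finset.sum_add_distrib, h6, hsum, matrixAction_zero, zero_add, Finset.sum_const,
      hcard] at h5
  have hnb : n • b = 0 := by
    have h5 : torsionPoint p q ∈ rotationOrbit (torsionPoint p q) := .inl rfl
    have h6 := nsmul_eq_zero_of_mem_rotationOrbit (hB _ h5)
    rwa [smul_add, ← matrixAction_nsmul, nsmul_torsionPoint, matrixAction_zero, zero_add] at h6
  have hcop : Nat.Coprime n 4 := by
    rw [show 4 = 2 ^ 2 by norm_num]
    exact (Nat.coprime_two_right.2 hn).pow_right 2
  have h5 : addOrderOf b ∣ 1 := by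
    rw [← hcop]
    exact Nat.dvd_gcd (addOrderOf_dvd_of_nsmul_eq_zero hnb) (addOrderOf_dvd_of_nsmul_eq_zero h4)
  exact AddMonoid.addOrderOf_eq_one_iff.1 (Nat.dvd_one.1 h5)

theorem torusRotation_mem_rotationOrbit_iff {P t : Torus} :
    torusRotation t ∈ rotationOrbit P ↔ t ∈ rotationOrbit P := by
  have h1 : ∀ t, t ∈ rotationOrbit P → torusRotation t ∈ rotationOrbit P := by
    intro t ht
    rw [mem_rotationOrbit_iff] at *
    rcases ht with rfl | rfl | rfl | rfl <;>
      simp [torusRotation_neg, torusRotation_torusRotation]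
  refine ⟨fun ht => ?_, h1 t⟩
  have h2 := h1 _ (h1 _ (h1 _ ht))
  rwa [torusRotation_torusRotation, torusRotation_torusRotation, neg_neg] at h2

section Parity

variable {X : Type*} [TopologicalSpace X] [T2Space X] [CompactSpace X]
  [ChartedSpace (EuclideanSpace ℝ (Fin 2)) X] {κ : X → Torus} {n : ℕ} [NeZero n]

/-- The square of the lift of the rotation is a lift of the inversion of the torus. It fixes the
fibres over the origin and the centre of the fundamental square and interchanges the two points of
the fibres over the other two points of order two. -/
theorem IsDPDoubleCover.exists_inversionLift (hn : Odd n) {p q : ZMod n}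
    (hpq : ¬ (p = 0 ∧ q = 0)) (hκ : IsDPDoubleCover (torsionPoint p q) κ) :
    ∃ ι : X → X, Continuous ι ∧ (∀ x, κ (ι x) = -κ x) ∧
      (∀ x, ι (deckInvolution κ x) = deckInvolution κ (ι x)) ∧
      ∀ (i j : ℤ) (x : X), κ x = toTorus ![(i : ℝ) / 2, (j : ℝ) / 2] →
        (Even (i + j) → ι x = x) ∧ (Odd (i + j) → ι x = deckInvolution κ x) := by
  obtain ⟨h, c, hc, hfix⟩ := hκ
  have hσ := deckInvolution_comm h c.injective hc fun t => torusRotation_mem_rotationOrbit_iff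
  have h0 := zero_notMem_rotationOrbit_torsionPoint hpq
  have hhalf : toTorus ![1 / 2, 1 / 2] = toTorus ![((1 : ℤ) : ℝ) / 2, ((1 : ℤ) : ℝ) / 2] := by
    norm_num
  have he : toTorus ![1 / 2, 1 / 2] ∉ rotationOrbit (torsionPoint p q) := fun hmem =>
    nsmul_int_half_ne_zero hn (.inl odd_one) (hhalf ▸ nsmul_eq_zero_of_mem_rotationOrbit hmem)
  have hfix' := fun x => rotationLift_eq_self (x := x) h h0 he hc hfix
  have hodd : ∀ x, κ x = toTorus ![1 / 2, 0] → c (c x) = deckInvolution κ x := by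
    obtain ⟨w, hw0, hw0', hw1, hw1', hw⟩ := exists_rotationOrbit_eq_of_quadrant hn hpq
    rw [hw] at h
    exact fun x => rotationLift_rotationLift_eq_deckInvolution hw0 hw0' hw1 hw1' h c.continuous hσ
      hc (fun x hx => hfix' x (.inl hx)) (fun x hx => hfix' x (.inr hx))
  refine ⟨fun x => c (c x), c.continuous.comp c.continuous, fun x => ?_, fun x => ?_,
    fun i j x hx => ⟨fun hij => ?_, fun hij => ?_⟩⟩
  · rw [hc, hc, torusRotation_torusRotation]
  · change c (c _) = deckInvolution κ (c (c x))
    rw [hσ, hσ]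
  · change c (c x) = x
    have h1 : c x = x := by
      refine hfix' x ?_
      rw [hx, toTorus_int_half_eq_zero_iff, hhalf, toTorus_int_half_eq_iff]
      grind
    rw [h1, h1]
  · rcases Int.even_or_odd j with hj | hj
    · refine hodd x ?_
      rw [hx, show toTorus ![1 / 2, 0] = toTorus ![((1 : ℤ) : ℝ) / 2, ((0 : ℤ) : ℝ) / 2] by simp,
        toTorus_int_half_eq_iff]
      grind
    · -- the fibre over `(0, 1/2)` is the image under `c` of the fibre over `(1/2, 0)`
      obtain ⟨y, rfl⟩ := c.surjective x
      have hy : κ y = toTorus ![1 / 2, 0] := by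
        rw [hc] at hx
        apply_fun torusRotation at hx
        rw [torusRotation_torusRotation, torusRotation_toTorus, neg_eq_iff_eq_neg,
          ← toTorus_neg] at hx
        rw [hx, show -![-(![(i : ℝ) / 2, (j : ℝ) / 2]) 1, (![(i : ℝ) / 2, (j : ℝ) / 2]) 0] =
            ![(j : ℝ) / 2, ((-i : ℤ) : ℝ) / 2] by simp [neg_div],
          show toTorus ![1 / 2, 0] = toTorus ![((1 : ℤ) : ℝ) / 2, ((0 : ℤ) : ℝ) / 2] by simp,
          toTorus_int_half_eq_iff]
        grind
      change c (c (c y)) = _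
      rw [hodd y hy, hσ]

variable [ConnectedSpace X]

/-- The derivative of an affine homeomorphism of the punctured surface satisfies the condition
modulo two. The homeomorphism commutes with the lift of the inversion up to the deck
transformation, and so compares its action on the fibres over the points of order two. -/
theorem IsDPDoubleCover.odd_add_odd (hn : Odd n) {p q : ZMod n}
    (hpq : ¬ (p = 0 ∧ q = 0)) (hκ : IsDPDoubleCover (torsionPoint p q) κ)
    (f : PuncturedSurface (origamiDP n κ) ≃ₜ PuncturedSurface (origamiDP n κ))
    {B : Matrix.SpecialLinearGroup (Fin 2) ℤ}
    (hf : ∀ x : PuncturedSurface (origamiDP n κ), κ (f x) = matrixAction B (κ x)) :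
    Odd (B 0 0 + B 1 0) ∧ Odd (B 0 1 + B 1 1) := by
  obtain ⟨ι, hι, hικ, -, hιhalf⟩ := hκ.exists_inversionLift hn hpq
  have h := hκ.isDoubleCover
  have hSn := fun t => nsmul_eq_zero_of_mem_rotationOrbit (p := p) (q := q) (t := t)
  have := preconnectedSpace_puncturedSurface h hn.pos
  have hnotS : ∀ x : PuncturedSurface (origamiDP n κ), κ x ∉ rotationOrbit (torsionPoint p q) :=
    fun x hx => x.2 (hSn _ hx)
  have hfσ : ∀ x : PuncturedSurface (origamiDP n κ), ∀ hx : origamiDP n κ (deckInvolution κ x) ≠ 0,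
      (f ⟨deckInvolution κ x, hx⟩ : X) = deckInvolution κ (f x) := by
    intro x hx
    refine h.eq_deckInvolution ?_ fun h1 => ?_
    · rw [hf, hf, map_deckInvolution κ]
    · exact h.deckInvolution_ne (hnotS x) (congrArg Subtype.val (f.injective (Subtype.ext h1)))
  have hιX : ∀ x : PuncturedSurface (origamiDP n κ), origamiDP n κ (ι x) ≠ 0 := by
    intro x
    rw [origamiDP, hικ, smul_neg, Ne, neg_eq_zero]
    exact x.2
  have hcomm := h.eqOn_or_eqOn_deckInvolution (finite_rotationOrbit _).isClosed
    (isPreconnected_univ (α := PuncturedSurface (origamiDP n κ)))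
    (f := fun x => (f ⟨ι x, hιX x⟩ : X)) (g := fun x => ι (f x))
    (continuous_subtype_val.comp (f.continuous.comp
      ((hι.comp continuous_subtype_val).subtype_mk _))).continuousOn
    (hι.comp (continuous_subtype_val.comp f.continuous)).continuousOn
    (fun x _ => by rw [hf, hικ, hικ, hf, matrixAction_neg])
    (fun x _ hx => (hιX (f x)) (hSn _ hx))
  -- the fibres over the two points of order two that `ι` does not fix
  have hfib : ∀ i j : ℤ, Odd (i + j) → ∃ x : PuncturedSurface (origamiDP n κ),
      κ x = toTorus ![(i : ℝ) / 2, (j : ℝ) / 2] ∧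
        (f ⟨ι x, hιX x⟩ : X) = deckInvolution κ (f x) := by
    intro i j hij
    obtain ⟨x, hx⟩ := h.surjective (toTorus ![(i : ℝ) / 2, (j : ℝ) / 2])
    have hx0 : origamiDP n κ x ≠ 0 := by
      rw [origamiDP, hx]
      refine nsmul_int_half_ne_zero hn ?_
      grind
    refine ⟨⟨x, hx0⟩, hx, ?_⟩
    have h1 : ι x = deckInvolution κ x := (hιhalf i j x hx).2 hij
    have h2 := hfσ ⟨x, hx0⟩ (by rw [← h1]; exact hιX ⟨x, hx0⟩)
    rw [← h2]
    simp only [h1]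
  obtain ⟨x, hx, hfx⟩ := hfib 1 0 (by decide)
  obtain ⟨y, hy, hfy⟩ := hfib 0 1 (by decide)
  have hfx' := hf x
  have hfy' := hf y
  rw [hx, matrixAction_int_half] at hfx'
  rw [hy, matrixAction_int_half] at hfy'
  have hx2 := hιhalf _ _ _ hfx'
  have hy2 := hιhalf _ _ _ hfy'
  simp only [mul_one, mul_zero, add_zero, zero_add] at hx2 hy2
  have hx3 := h.deckInvolution_ne (hnotS (f x))
  have hy3 := h.deckInvolution_ne (hnotS (f y))
  rcases hcomm with h1 | h1
  · have hx1 := h1 x trivial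
    have hy1 := h1 y trivial
    simp only [hfx, hfy] at hx1 hy1
    rw [← Int.not_even_iff_odd, ← Int.not_even_iff_odd]
    exact ⟨fun h2 => hx3 (hx1.trans (hx2.1 h2)), fun h2 => hy3 (hy1.trans (hy2.1 h2))⟩
  · exfalso
    have hx1 := congrArg (deckInvolution κ) (h1 x trivial)
    have hy1 := congrArg (deckInvolution κ) (h1 y trivial)
    simp only [hfx, hfy, h.deckInvolution_deckInvolution] at hx1 hy1
    have hxe : Even (B 0 0 + B 1 0) := Int.not_odd_iff_even.1 fun h2 =>
      hx3 ((hx2.2 h2).symm.trans hx1.symm)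
    have hye : Even (B 0 1 + B 1 1) := Int.not_odd_iff_even.1 fun h2 =>
      hy3 ((hy2.2 h2).symm.trans hy1.symm)
    have hdet := B.det_coe
    rw [Matrix.det_fin_two] at hdet
    obtain ⟨k, hk⟩ := hxe
    obtain ⟨l, hl⟩ := hye
    have h2 : (2 : ℤ) ∣ 1 := ⟨B 0 0 * l - B 0 1 * k, by
      linear_combination (B 0 0 : ℤ) * hl - (B 0 1 : ℤ) * hk - hdet⟩
    norm_num at h2

end Parity

/-! ### The Veech group -/

section Veech

variable {X : Type*} [TopologicalSpace X] {κ : X → Torus} {n : ℕ}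

/-- A lift of a linear automorphism of the torus is affine: in charts it differs from the linear
map by a continuous function with values in the lattice. -/
theorem isAffineWithDerivative_of_map_eq {p : X → Torus}
    {f : PuncturedSurface p → PuncturedSurface p} (hfc : Continuous f)
    {A : Matrix (Fin 2) (Fin 2) ℤ} (hf : ∀ x : PuncturedSurface p, p (f x) = matrixAction A (p x)) :
    IsAffineWithDerivative p f (A.map (Int.cast : ℤ → ℝ)) := by
  intro φ ψ hφ hψ x hx hfx
  have hcont : ContinuousAt (fun y => ψ (f y) - A.map (Int.cast : ℤ → ℝ) *ᵥ φ y) x := by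
    refine ((ψ.continuousAt hfx).comp (f := f) hfc.continuousAt).sub ?_
    exact (continuous_const.matrix_mulVec continuous_id).continuousAt.comp (φ.continuousAt hx)
  have hev : ∀ᶠ y in 𝓝 x, toTorus (ψ (f y) - A.map (Int.cast : ℤ → ℝ) *ᵥ φ y) = 0 := by
    filter_upwards [φ.open_source.mem_nhds hx,
      hfc.continuousAt.preimage_mem_nhds (ψ.open_source.mem_nhds hfx)] with y hy hfy
    rw [toTorus_sub, ← matrixAction_toTorus, hφ y hy, hψ _ hfy, hf, sub_self]
  refine ⟨ψ (f x) - A.map (Int.cast : ℤ → ℝ) *ᵥ φ x,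
    (eventually_eq_of_toTorus_eq_zero hcont hev).mono fun y hy => ?_⟩
  rw [← hy]
  abel

theorem matrixAction_eq_zero_iff (A : Matrix.SpecialLinearGroup (Fin 2) ℤ) {t : Torus} :
    matrixAction A t = 0 ↔ t = 0 := by
  rw [← torusHomeomorph_apply, ← (torusHomeomorph A).injective.eq_iff (a := t) (b := 0),
    torusHomeomorph_apply, torusHomeomorph_apply, matrixAction_zero]

variable [T2Space X] [CompactSpace X]
  [ChartedSpace (EuclideanSpace ℝ (Fin 2)) X]

/-- Matrices that satisfy the congruence conditions are derivatives: they preserve the branch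
points and the two points of order two over which the lift of the half-turn exchanges the
sheets, so that they lift to the surface. -/
theorem mapGL_mem_veechGroup [NeZero n] (hn : Odd n) {p q : ZMod n} (hpq : ¬ (p = 0 ∧ q = 0))
    (hκ : IsDPDoubleCover (torsionPoint p q) κ) {A : Matrix.SpecialLinearGroup (Fin 2) ℤ}
    (hA1 : Odd (A 0 0 + A 1 0)) (hA2 : Odd (A 0 1 + A 1 1)) (hA : IsSignedRotationMod n A) :
    Matrix.SpecialLinearGroup.mapGL ℝ A ∈ veechGroup (origamiDP n κ) := by
  obtain ⟨ι, hι, hικ, hισ, hιhalf⟩ := hκ.exists_inversionLift hn hpq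
  have hz : (0 : Torus) = toTorus ![((0 : ℤ) : ℝ) / 2, ((0 : ℤ) : ℝ) / 2] :=
    (toTorus_int_half_eq_zero_iff.2 ⟨by decide, by decide⟩).symm
  have he₁ : toTorus ![1 / 2, 0] = toTorus ![((1 : ℤ) : ℝ) / 2, ((0 : ℤ) : ℝ) / 2] := by simp
  have he₂ : toTorus ![0, 1 / 2] = toTorus ![((0 : ℤ) : ℝ) / 2, ((1 : ℤ) : ℝ) / 2] := by simp
  have h0 := zero_notMem_rotationOrbit_torsionPoint hpq
  obtain ⟨f, hf⟩ := exists_homeomorph_lift hκ.isDoubleCover (finite_rotationOrbit _) hι hικ hισ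
    (fun x hx => (hιhalf 0 0 x (hx.trans hz)).1 (by decide))
    (fun x hx => (hιhalf 1 0 x (hx.trans he₁)).2 (by decide))
    (fun x hx => (hιhalf 0 1 x (hx.trans he₂)).2 (by decide)) h0
    (fun hmem => nsmul_int_half_ne_zero hn (.inl odd_one)
      (he₁ ▸ nsmul_eq_zero_of_mem_rotationOrbit hmem))
    (fun hmem => nsmul_int_half_ne_zero hn (.inr odd_one)
      (he₂ ▸ nsmul_eq_zero_of_mem_rotationOrbit hmem)) A
    (fun t => matrixAction_mem_rotationOrbit_iff hA t)
    (by
      rw [he₁, he₂, matrixAction_int_half, toTorus_int_half_eq_iff, toTorus_int_half_eq_iff]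
      grind)
    (by
      rw [he₁, he₂, matrixAction_int_half, toTorus_int_half_eq_iff, toTorus_int_half_eq_iff]
      grind)
  have hf' : ∀ x, origamiDP n κ (f x) = matrixAction A (origamiDP n κ x) := fun x => by
    rw [origamiDP, origamiDP, hf, matrixAction_nsmul]
  refine ⟨?_, f.subtype fun x => ?_, ?_⟩
  · rw [← Matrix.GeneralLinearGroup.val_det_apply]
    simp
  · rw [hf', Ne, Ne, matrixAction_eq_zero_iff]
  · exact isAffineWithDerivative_of_map_eq (Homeomorph.continuous _) fun x => hf' x

/-- Derivatives of affine homeomorphisms are integral and satisfy the congruence conditions. -/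
theorem exists_eq_mapGL_of_mem_veechGroup [ConnectedSpace X] [NeZero n] (hn : Odd n) (hn3 : 3 ≤ n) {p q : ZMod n}
    (hpq : IsUnit (p ^ 2 + q ^ 2)) (hκ : IsDPDoubleCover (torsionPoint p q) κ)
    {A : GL (Fin 2) ℝ} (hA : A ∈ veechGroup (origamiDP n κ)) :
    ∃ B : Matrix.SpecialLinearGroup (Fin 2) ℤ, Odd (B 0 0 + B 1 0) ∧ Odd (B 0 1 + B 1 1) ∧
      IsSignedRotationMod n B ∧ Matrix.SpecialLinearGroup.mapGL ℝ B = A := by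
  have hpq' := ne_zero_of_isUnit_sq_add_sq hn3 hpq
  obtain ⟨hdet, f, hf⟩ := hA
  have hSn := fun t => nsmul_eq_zero_of_mem_rotationOrbit (p := p) (q := q) (t := t)
  obtain ⟨B, hB, b, hb⟩ := hf.exists_matrixAction hκ.isDoubleCover hn hSn hdet
  have hmem := fun t ht => matrixAction_add_mem hκ.isDoubleCover (finite_rotationOrbit _) hn.pos
    hSn f hb (t := t) ht
  have hb0 : b = 0 := translation_eq_zero hn hpq' hmem
  simp only [hb0, add_zero] at hb hmem
  obtain ⟨h1, h2⟩ := hκ.odd_add_odd hn hpq' f hb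
  refine ⟨B, h1, h2, isSignedRotationMod_of_mem hn hn3 hpq (hmem _ (.inl rfl)) (hmem _ ?_), ?_⟩
  · rw [← torusRotation_torsionPoint]
    exact .inr (.inl rfl)
  · ext i j
    rw [← hB]
    simp

end Veech

/-! ### The congruence group -/

/-- The matrices of determinant one that are congruent modulo `m` to a power of the rotation. -/
def rotationSubgroupMod (m : ℕ) : Subgroup (Matrix.SpecialLinearGroup (Fin 2) ℤ) :=
  (Subgroup.zpowers (Matrix.SpecialLinearGroup.map (Int.castRingHom (ZMod m))
    ModularGroup.S)).comap (Matrix.SpecialLinearGroup.map (Int.castRingHom (ZMod m)))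

theorem mem_rotationSubgroupMod_iff {m : ℕ} {A : Matrix.SpecialLinearGroup (Fin 2) ℤ} :
    A ∈ rotationSubgroupMod m ↔ IsSignedRotationMod m A := by
  have hS2 : (ModularGroup.S ^ 2 : Matrix.SpecialLinearGroup (Fin 2) ℤ) = -1 := by
    decide
  have hS4 : (ModularGroup.S ^ 4 : Matrix.SpecialLinearGroup (Fin 2) ℤ) = 1 := by
    decide
  rw [rotationSubgroupMod, Subgroup.mem_comap, Subgroup.mem_zpowers_iff]
  constructor
  · rintro ⟨k, hk⟩
    rw [← map_zpow] at hk
    have h1 : (ModularGroup.S ^ k : Matrix.SpecialLinearGroup (Fin 2) ℤ) =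
        ModularGroup.S ^ (k % 4).toNat := by
      rw [← zpow_natCast, Int.toNat_of_nonneg (Int.emod_nonneg _ (by norm_num))]
      conv_lhs => rw [← Int.emod_add_mul_ediv k 4, zpow_add, zpow_mul]
      rw [show (4 : ℤ) = (4 : ℕ) by rfl, zpow_natCast, hS4, one_zpow, mul_one]
    have h2 : (k % 4).toNat < 4 := by omega
    rw [h1] at hk
    generalize (k % 4).toNat = l at hk h2
    interval_cases l
    · exact .inl (by rw [CongruentMod, ← hk, pow_zero])
    · exact .inr (.inr (.inl (by rw [CongruentMod, ← hk, pow_one])))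
    · exact .inr (.inl (by rw [CongruentMod, ← hk, hS2]))
    · refine .inr (.inr (.inr ?_))
      rw [CongruentMod, ← hk, pow_succ, hS2, neg_one_mul]
  · rintro (h | h | h | h)
    · exact ⟨0, by rw [h, ← map_zpow, zpow_zero]⟩
    · exact ⟨2, by rw [h, ← map_zpow, zpow_ofNat, hS2]⟩
    · exact ⟨1, by rw [h, ← map_zpow, zpow_one]⟩
    · exact ⟨3, by rw [h, ← map_zpow, zpow_ofNat, pow_succ, hS2, neg_one_mul]⟩

theorem congruentMod_two_iff {A : Matrix.SpecialLinearGroup (Fin 2) ℤ} :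
    CongruentMod 2 A 1 ∨ CongruentMod 2 A ModularGroup.S ↔
      Odd (A 0 0 + A 1 0) ∧ Odd (A 0 1 + A 1 1) := by
  have hdet : ((A 0 0 : ℤ) : ZMod 2) * (A 1 1 : ℤ) - (A 0 1 : ℤ) * (A 1 0 : ℤ) = 1 := by
    have h3 := A.det_coe
    rw [Matrix.det_fin_two] at h3
    exact_mod_cast congrArg (Int.cast : ℤ → ZMod 2) h3
  simp only [congruentMod_iff, Fin.forall_fin_two, ← ZMod.intCast_eq_one_iff_odd, Int.cast_add]
  simp only [ModularGroup.coe_S, Matrix.SpecialLinearGroup.coe_one]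
  simp
  generalize ((A 0 0 : ℤ) : ZMod 2) = a at *
  generalize ((A 0 1 : ℤ) : ZMod 2) = b at *
  generalize ((A 1 0 : ℤ) : ZMod 2) = c at *
  generalize ((A 1 1 : ℤ) : ZMod 2) = d at *
  revert a b c d
  decide

theorem isSignedRotationMod_two_iff {A : Matrix.SpecialLinearGroup (Fin 2) ℤ} :
    IsSignedRotationMod 2 A ↔ CongruentMod 2 A 1 ∨ CongruentMod 2 A ModularGroup.S := by
  simp only [IsSignedRotationMod, congruentMod_iff, Matrix.SpecialLinearGroup.coe_neg,
    Matrix.neg_apply, Int.cast_neg, ZMod.neg_eq_self_mod_two]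
  tauto

theorem gamma_le_rotationSubgroupMod_iff {m k : ℕ} :
    CongruenceSubgroup.Gamma k ≤ rotationSubgroupMod m ↔ m ∣ k := by
  constructor
  · intro h
    -- the powers of `T` that lie in the group detect its level
    have h1 : ModularGroup.T ^ (k : ℤ) ∈ rotationSubgroupMod m := by
      refine h ?_
      rw [CongruenceSubgroup.Gamma_mem, ModularGroup.coe_T_zpow]
      simp
    rw [mem_rotationSubgroupMod_iff, isSignedRotationMod_iff, ModularGroup.coe_T_zpow] at h1
    rw [← ZMod.natCast_eq_zero_iff]
    simp only [Matrix.of_apply, Matrix.cons_val_zero, Matrix.cons_val_one, Int.cast_one,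
      Int.cast_natCast] at h1
    rcases h1 with h2 | h2 | h2 | h2
    · exact h2.2.1
    · exact h2.2.1
    · rw [← mul_one (k : ZMod m), h2.1, mul_zero]
    · rw [← mul_one (k : ZMod m), h2.1, mul_zero]
  · intro h A hA
    rw [mem_rotationSubgroupMod_iff]
    refine .inl (congruentMod_iff.2 fun i j => ?_)
    have h1 : CongruentMod k A 1 := by
      rw [CongruentMod, map_one]
      exact CongruenceSubgroup.Gamma_mem'.1 hA
    have h2 := (ZMod.intCast_eq_intCast_iff_dvd_sub _ _ _).1 (congruentMod_iff.1 h1 i j)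
    exact (ZMod.intCast_eq_intCast_iff_dvd_sub _ _ _).2
      ((Int.natCast_dvd_natCast.2 h).trans h2)

theorem isCongruenceGroupOfLevel_rotationSubgroupMod {n : ℕ} [NeZero n] (hn : Odd n) :
    IsCongruenceGroupOfLevel (rotationSubgroupMod n ⊓ rotationSubgroupMod 2) (2 * n) := by
  have h1 : ∀ k, CongruenceSubgroup.Gamma k ≤ rotationSubgroupMod n ⊓ rotationSubgroupMod 2 ↔
      2 * n ∣ k := by
    intro k
    rw [le_inf_iff, gamma_le_rotationSubgroupMod_iff, gamma_le_rotationSubgroupMod_iff]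
    refine ⟨fun h => (Nat.coprime_two_left.2 hn).mul_dvd_of_dvd_of_dvd h.2 h.1, fun h => ?_⟩
    exact ⟨(dvd_mul_left n 2).trans h, (dvd_mul_right 2 n).trans h⟩
  have hn' := NeZero.pos n
  exact ⟨⟨by omega, (h1 _).2 dvd_rfl⟩, fun k hk => Nat.le_of_dvd hk.1 ((h1 k).1 hk.2)⟩

theorem mainTheorem3 (n : ℕ) [NeZero n] (hn : Odd n) (hn3 : 3 ≤ n)
    (p q : ZMod n) (hpq : IsUnit (p ^ 2 + q ^ 2))
    (X : Type*) [TopologicalSpace X] [T2Space X] [CompactSpace X] [ConnectedSpace X]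
    [ChartedSpace (EuclideanSpace ℝ (Fin 2)) X]
    (κ : X → Torus) (hκ : IsDPDoubleCover (torsionPoint p q) κ) :
    ∃ Γ : Subgroup (Matrix.SpecialLinearGroup (Fin 2) ℤ),
      veechGroup (origamiDP n κ) =
        (Matrix.SpecialLinearGroup.mapGL ℝ : Matrix.SpecialLinearGroup (Fin 2) ℤ →* _) ''
          (Γ : Set (Matrix.SpecialLinearGroup (Fin 2) ℤ)) ∧
      (Γ : Set (Matrix.SpecialLinearGroup (Fin 2) ℤ)) =
        {A | CongruentMod n A 1 ∨ CongruentMod n A (-1) ∨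
            CongruentMod n A ModularGroup.S ∨ CongruentMod n A (-ModularGroup.S)} ∩
          {A | CongruentMod 2 A 1 ∨ CongruentMod 2 A ModularGroup.S} ∧
      (Γ : Set (Matrix.SpecialLinearGroup (Fin 2) ℤ)) =
        {A | Odd (A 0 0 + A 1 0) ∧ Odd (A 0 1 + A 1 1) ∧
          (CongruentMod n A 1 ∨ CongruentMod n A (-1) ∨
            CongruentMod n A ModularGroup.S ∨ CongruentMod n A (-ModularGroup.S))} ∧
      IsCongruenceGroupOfLevel Γ (2 * n) := by
  have h2 : ((rotationSubgroupMod n ⊓ rotationSubgroupMod 2 : Subgroup _) :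
      Set (Matrix.SpecialLinearGroup (Fin 2) ℤ)) =
      {A | IsSignedRotationMod n A} ∩ {A | CongruentMod 2 A 1 ∨ CongruentMod 2 A ModularGroup.S} := by
    ext A
    rw [SetLike.mem_coe, Subgroup.mem_inf, mem_rotationSubgroupMod_iff,
      mem_rotationSubgroupMod_iff, isSignedRotationMod_two_iff]
    rfl
  have h3 : ∀ A, A ∈ rotationSubgroupMod n ⊓ rotationSubgroupMod 2 ↔
      Odd (A 0 0 + A 1 0) ∧ Odd (A 0 1 + A 1 1) ∧ IsSignedRotationMod n A := by
    intro A
    rw [← SetLike.mem_coe, h2, Set.mem_inter_iff, Set.mem_ofPred_eq, Set.mem_ofPred_eq,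
      congruentMod_two_iff]
    tauto
  refine ⟨rotationSubgroupMod n ⊓ rotationSubgroupMod 2, ?_, h2, Set.ext h3,
    isCongruenceGroupOfLevel_rotationSubgroupMod hn⟩
  ext A
  constructor
  · intro hA
    obtain ⟨B, hB1, hB2, hB, rfl⟩ := exists_eq_mapGL_of_mem_veechGroup hn hn3 hpq hκ hA
    exact ⟨B, (h3 B).2 ⟨hB1, hB2, hB⟩, rfl⟩
  · rintro ⟨B, hB, rfl⟩
    obtain ⟨hB1, hB2, hB3⟩ := (h3 B).1 hB
    exact mapGL_mem_veechGroup hn (ne_zero_of_isUnit_sq_add_sq hn3 hpq) hκ hB1 hB2 hB3
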